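/- **Setting.** A network is a finite acyclic directed graph (parallel links allowed) with a sender Alice and a receiver Bob; each link carries one symbol of a finite field $\mathbb F_q$ per time step. Its capacity $C$ is the value of a maximum flow from Alice to Bob. Let $0\le z\le C$, $b=C-z$, and let $n\ge b+C$ be the block length. A word $X\in\mathbb F_q^{b\times n}$ is sent column by column by random linear network coding: on each of her links Alice sends a random linear combination of the $b$ symbols of the column, every other node sends on each of its links a random linear combination of the symbols it receives, and Bob forms $C$ random linear combinations of the symbols he receives; the coefficients are independent, uniform, and the same for all columns. Bob thus obtains $Y\in\mathbb F_q^{C\times n}$. **The scheme $\mathcal A_{rs}$.** The message is a matrix $M\in\mathbb F_q^{b\times(n-b-C)}$. Alice and Bob share a uniformly random secret $(R,H)$, with $R\in\mathbb F_q^{C}$ and $H\in\mathbb F_q^{b\times C}$, independent of the message and of the network code. Let $P\in\mathbb F_q^{n\times C}$ have entries $P_{ij}=(r_j)^i$. Alice sends $X=[L\ M\ I]$, where $L\in\mathbb F_q^{b\times C}$ is the solution of $H=XP$ if there is exactly one, and $L=0$ otherwise. Let $\hat T$ consist of the last $b$ columns of $Y$. Bob finds the unique $\bar X=[\bar L\ \bar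 M\ *]\in\mathbb F_q^{b\times n}$ such that every column of $Y-\hat T\bar X$ lies in the column space of $YP-\hat TH$ (if there is none or more than one he takes $\bar X=0$) and outputs $\bar M$. **The adversary (random-secret model).** Calvin knows everything, including the network and the coefficients of the network code, except the secret. He chooses $M$ knowing the network code; then, knowing also $X$, he chooses at most $z$ links and replaces the symbols on them by arbitrary ones. His choices may be randomized. The error probability is the probability that Bob's output differs from $M$. The rate is $(1-\frac{C+b}{n})\,b$. **Theorem.** 1. The secret consists of at most $C^2+C$ symbols of $\mathbb F_q$. 2. $\mathcal A_{rs}$ is a polynomial-time scheme with code complexity $O(nC^2)$: there are fixed programs (for a random access machine over a field, the same programs for all fields and dimensions) and a constant $K$ such that, for all $C\ge 1$, $b\le C$ and $n\ge b+C$, Alice's encoder and Bob's decoder are each computed in at most $KnC^2$ steps, and the linear combinations that a node with $d$ inputs and $k$ outputs forms of its inputs of length $n$ are computed in at most $K(k+1)(d+1)(n+1)$ steps. 3. $\mathcal A_{rs}$ is distributed (encoder, decoder and the coding at the nodes do not depend on the topology of the network or on the links Calvin controls) and achieves rate $C-z$: for all $C\ge z\ge 0$ and $\alpha>0$, for every large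 enough $n$ the rate is at least $C-z-\alpha$, and for every $\varepsilon>0$ and every $\ell$ there is $q_0$ such that for every finite field with $q\ge q_0$ elements, every network with at most $\ell$ links and capacity $C$, and every strategy of Calvin, the error probability is at most $\varepsilon$. -/

import Mathlib

open scoped BigOperators ENNReal

namespace RandomSecret

/-! ## Networks -/

/-- An acyclic directed network with node type `V` and link type `E` (parallel links are allowed),
one sender and one receiver. Every link carries one packet per time step. -/
structure Network (V E : Type*) where
  src : E → V
  tgt : E → V
  alice : V
  bob : V
  alice_ne_bob : alice ≠ bob
  /-- There is no directed cycle of links. -/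
  acyclic : ∀ e, ¬ Relation.TransGen (fun e₁ e₂ => tgt e₁ = src e₂) e e

namespace Network

variable {V E : Type*}

/-- `e₁` feeds `e₂`: the link `e₁` ends where the link `e₂` starts. -/
def Feeds (N : Network V E) (e₁ e₂ : E) : Prop := N.tgt e₁ = N.src e₂

theorem wellFounded_feeds [Finite E] (N : Network V E) : WellFounded N.Feeds := by
  have h : WellFounded (Relation.TransGen N.Feeds) := by
    have : IsTrans E (Relation.TransGen N.Feeds) := ⟨fun _ _ _ => Relation.TransGen.trans⟩
    have : Std.Irrefl (Relation.TransGen N.Feeds) := ⟨N.acyclic⟩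
    exact Finite.wellFounded_of_trans_of_irrefl _
  exact Subrelation.wf (fun h => Relation.TransGen.single h) h

/-- `f` is an integral flow of value `k` from Alice to Bob (all links have capacity one). -/
def IsFlow [Fintype E] [DecidableEq V] (N : Network V E) (f : E → ℕ) (k : ℕ) : Prop :=
  (∀ e, f e ≤ 1) ∧
  (∀ v, v ≠ N.alice → v ≠ N.bob →
    ∑ e with N.tgt e = v, f e = ∑ e with N.src e = v, f e) ∧
  ∑ e with N.src e = N.alice, f e = ∑ e with N.tgt e = N.alice, f e + k

/-- The capacity of the network: the value of a maximum flow from Alice to Bob. -/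
noncomputable def capacity [Fintype E] [DecidableEq V] (N : Network V E) : ℕ :=
  sSup {k | ∃ f, N.IsFlow f k}

end Network

/-! ## The code: secret, encoder, decoder

Throughout, `C` is the number of parity symbols, `b` the number of packets (rows), `m` the number
of columns of the message, and the block length is `n = C + m + b`. -/

/-- The block length. -/
abbrev blockLength (C b m : ℕ) : ℕ := C + m + b

/-- Alice's message, a `b × (n - b - C)` matrix. -/
abbrev Message (F : Type*) (b m : ℕ) := Matrix (Fin b) (Fin m) F

/-- A codeword, a `b × n` matrix. -/
abbrev Codeword (F : Type*) (C b m : ℕ) := Matrix (Fin b) (Fin (blockLength C b m)) F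

/-- The packets handed to Bob's decoder, a `C × n` matrix. -/
abbrev Received (F : Type*) (C b m : ℕ) := Matrix (Fin C) (Fin (blockLength C b m)) F

/-- The secret `(R, H)`: `C` parity symbols and a `b × C` hash matrix. -/
abbrev Secret (F : Type*) (C b : ℕ) := (Fin C → F) × Matrix (Fin b) (Fin C) F

section Code

variable {F : Type*} [Field F] {C b m : ℕ}

/-- The `n × C` parity-check matrix: its entry in row `i` (counted from one) and column `j`
is `r_j ^ i`. -/
def parityCheck (m b : ℕ) (R : Fin C → F) : Matrix (Fin (blockLength C b m)) (Fin C) F :=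
  fun i j => R j ^ (i.val + 1)

/-- The block matrix `[L M I]`. -/
def assemble (L : Matrix (Fin b) (Fin C) F) (M : Message F b m) : Codeword F C b m :=
  fun i => Fin.append (Fin.append (L i) (M i)) ((1 : Matrix (Fin b) (Fin b) F) i)

open Classical in
/-- Alice's block `L`: the solution of `H = [L M I] P` if there is exactly one, and zero
otherwise. -/
noncomputable def tweak (s : Secret F C b) (M : Message F b m) : Matrix (Fin b) (Fin C) F :=
  if h : ∃! L : Matrix (Fin b) (Fin C) F, s.2 = assemble L M * parityCheck m b s.1
  then h.choose else 0

/-- Alice's encoder. -/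
noncomputable def encode (s : Secret F C b) (M : Message F b m) : Codeword F C b m :=
  assemble (tweak s M) M

/-- The last `b` columns of the received matrix: Bob's estimate of the transfer matrix. -/
def transferEstimate (Y : Received F C b m) : Matrix (Fin C) (Fin b) F :=
  fun i j => Y i (Fin.natAdd (C + m) j)

/-- The discrepancy `Y P - T̂ H` between the received packets and the hash. -/
def discrepancy (s : Secret F C b) (Y : Received F C b m) : Matrix (Fin C) (Fin C) F :=
  Y * parityCheck m b s.1 - transferEstimate Y * s.2

/-- `X` explains `Y`: the error `Y - T̂ X` lies in the column space of the discrepancy. -/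
def Explains (s : Secret F C b) (Y : Received F C b m) (X : Codeword F C b m) : Prop :=
  ∃ W : Received F C b m, transferEstimate Y * X + discrepancy s Y * W = Y

open Classical in
/-- Bob's reconstruction of the codeword: the only one that explains `Y`, and zero if there is no
such codeword or more than one. -/
noncomputable def decodeCodeword (s : Secret F C b) (Y : Received F C b m) : Codeword F C b m :=
  if h : ∃! X : Codeword F C b m, Explains s Y X then h.choose else 0

/-- Bob's decoder: he drops the first `C` and the last `b` columns of the reconstruction. -/
noncomputable def decode (s : Secret F C b) (Y : Received F C b m) : Message F b m :=
  fun i j => decodeCodeword s Y i (Fin.castAdd b (Fin.natAdd C j))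

end Code

/-- The rate `(1 - δ) b`, where `δ n = C + b` is the number of redundant columns. -/
noncomputable def rate (C b m : ℕ) : ℝ :=
  (1 - ((C : ℝ) + b) / (blockLength C b m : ℝ)) * b

/-! ## Random linear network coding and the adversary -/

/-- The coefficients of the network code: those of Alice's outgoing links (one for each row of
the codeword), those of the links of the other nodes (one for each incoming link of the node),
and those with which Bob combines his incoming links into `C` packets. Coefficients for pairs
that are not incident are never used. -/
abbrev Coeffs (E F : Type*) (C b : ℕ) := (E → Fin b → F) × (E → E → F) × (Fin C → E → F)

/-- An attack of Calvin: at most `z` links and, for every time slot, the symbols that he puts on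
these links (the values at other links are ignored). -/
abbrev Attack (E F : Type*) (z n : ℕ) := {S : Finset E // S.card ≤ z} × (E → Fin n → F)

/-- A strategy of Calvin, possibly randomized. He chooses the message, knowing the network code;
then he chooses the links and the injected symbols, knowing the network code, the message and the
codeword, hence everything sent over any link. He is not given the secret. The strategy may depend
on all parameters and on the network. -/
structure Calvin (E F : Type*) (C b m z : ℕ) where
  message : Coeffs E F C b → PMF (Message F b m)
  attack : Coeffs E F C b → Message F b m → Codeword F C b m →
    PMF (Attack E F z (blockLength C b m))

namespace Network

variable {V E F : Type*} [DecidableEq V] [Fintype E] [DecidableEq E] [Field F] {C b m z : ℕ}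

/-- The symbols on the links for one slice `x` of the codeword, if Calvin puts the symbols `w` on
the links in `S`: on her links Alice sends linear combinations of the slice, every other node
sends linear combinations of what it receives. -/
noncomputable def symbol (N : Network V E) (κ : Coeffs E F C b) (S : Finset E) (w : E → F)
    (x : Fin b → F) : E → F :=
  N.wellFounded_feeds.fix fun e prev =>
    if e ∈ S then w e
    else if N.src e = N.alice then ∑ i, κ.1 e i * x i
    else ∑ e' : {e' // N.tgt e' = N.src e}, κ.2.1 e e'.1 * prev e'.1 e'.2

theorem symbol_eq (N : Network V E) (κ : Coeffs E F C b) (S : Finset E) (w : E → F)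
    (x : Fin b → F) (e : E) :
    N.symbol κ S w x e =
      if e ∈ S then w e
      else if N.src e = N.alice then ∑ i, κ.1 e i * x i
      else ∑ e' : {e' // N.tgt e' = N.src e}, κ.2.1 e e'.1 * N.symbol κ S w x e'.1 := by
  unfold symbol
  rw [WellFounded.fix_eq]

/-- The matrix handed to Bob's decoder: `C` random linear combinations of his incoming packets. -/
noncomputable def received (N : Network V E) (κ : Coeffs E F C b) (X : Codeword F C b m)
    (a : Attack E F z (blockLength C b m)) : Received F C b m :=
  fun j t => ∑ e with N.tgt e = N.bob,
    κ.2.2 j e * N.symbol κ a.1.1 (fun e => a.2 e t) (fun i => X i t) e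

/-- One run of the scheme: Alice's message together with Bob's output. The network code and the
secret are uniform and independent, and the secret is independent of the message. -/
noncomputable def experiment [Fintype F] (N : Network V E) (A : Calvin E F C b m z) :
    PMF (Message F b m × Message F b m) :=
  (PMF.uniformOfFintype (Coeffs E F C b)).bind fun κ =>
    (A.message κ).bind fun M =>
      (PMF.uniformOfFintype (Secret F C b)).bind fun s =>
        (A.attack κ M (encode s M)).map fun a => (M, decode s (N.received κ (encode s M) a))

/-- The probability that Bob outputs something else than Alice's message. -/
noncomputable def errorProb [Fintype F] (N : Network V E) (A : Calvin E F C b m z) : ℝ≥0∞ :=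
  (N.experiment A).toOuterMeasure {p | p.2 ≠ p.1}

end Network

/-! ## Programs with a step count

A random access machine over a field. It has index registers, which hold natural numbers, and
two-dimensional arrays of field elements. Programs are finite and know neither the field nor the
dimensions; a step is an operation on field elements or on indices, a test, or the start of a
loop or of a pass through it. -/

/-- An array cell: the array, and the index registers that hold the row and the column. -/
structure Cell where
  arr : ℕ
  row : ℕ
  col : ℕ

/-- Programs. -/
inductive Prog : Type
  /-- `r := k` -/
  | idxConst (r k : ℕ)
  /-- `r := s + t` -/
  | idxAdd (r s t : ℕ)
  /-- `r := s - t` (truncated) -/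
  | idxSub (r s t : ℕ)
  /-- `x := 0` -/
  | zero (x : Cell)
  /-- `x := 1` -/
  | one (x : Cell)
  /-- `x := y + z` -/
  | add (x y z : Cell)
  /-- `x := y - z` -/
  | sub (x y z : Cell)
  /-- `x := y * z` -/
  | mul (x y z : Cell)
  /-- `x := y⁻¹`, with `0⁻¹ = 0` -/
  | inv (x y : Cell)
  | seq (p q : Prog)
  /-- if `x = 0` then `p` else `q` -/
  | ifZero (x : Cell) (p q : Prog)
  /-- if `r < s` then `p` else `q` -/
  | ifLt (r s : ℕ) (p q : Prog)
  /-- `for r = 0, 1, …, s - 1 do p`, where `s` is evaluated once, at the start -/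
  | loop (r s : ℕ) (p : Prog)

/-- The state of the machine. -/
structure State (F : Type*) where
  idx : ℕ → ℕ
  mem : ℕ → ℕ → ℕ → F

/-- `iter f k a` applies `f 0`, `f 1`, …, `f (k - 1)` to `a`, in this order. -/
def iter {α : Type*} (f : ℕ → α → α) : ℕ → α → α
  | 0, a => a
  | k + 1, a => f k (iter f k a)

namespace State

variable {F : Type*}

/-- Write an index register. -/
def setIdx (σ : State F) (r k : ℕ) : State F :=
  { σ with idx := fun r' => if r' = r then k else σ.idx r' }

/-- Read a cell. -/
def get (σ : State F) (x : Cell) : F := σ.mem x.arr (σ.idx x.row) (σ.idx x.col)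

/-- Write a cell. -/
def set (σ : State F) (x : Cell) (a : F) : State F :=
  { σ with mem := fun n i j =>
      if n = x.arr ∧ i = σ.idx x.row ∧ j = σ.idx x.col then a else σ.mem n i j }

end State

/-- Running a program: the final state and the number of steps. -/
def Prog.exec {F : Type*} [Field F] [DecidableEq F] : Prog → State F → State F × ℕ
  | .idxConst r k, σ => (σ.setIdx r k, 1)
  | .idxAdd r s t, σ => (σ.setIdx r (σ.idx s + σ.idx t), 1)
  | .idxSub r s t, σ => (σ.setIdx r (σ.idx s - σ.idx t), 1)
  | .zero x, σ => (σ.set x 0, 1)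
  | .one x, σ => (σ.set x 1, 1)
  | .add x y z, σ => (σ.set x (σ.get y + σ.get z), 1)
  | .sub x y z, σ => (σ.set x (σ.get y - σ.get z), 1)
  | .mul x y z, σ => (σ.set x (σ.get y * σ.get z), 1)
  | .inv x y, σ => (σ.set x (σ.get y)⁻¹, 1)
  | .seq p q, σ =>
      let τ := p.exec σ
      let υ := q.exec τ.1
      (υ.1, τ.2 + υ.2)
  | .ifZero x p q, σ =>
      let τ := if σ.get x = 0 then p.exec σ else q.exec σ
      (τ.1, τ.2 + 1)
  | .ifLt r s p q, σ =>
      let τ := if σ.idx r < σ.idx s then p.exec σ else q.exec σ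
      (τ.1, τ.2 + 1)
  | .loop r s p, σ =>
      iter (fun i τ =>
        let υ := p.exec (τ.1.setIdx r i)
        (υ.1, τ.2 + υ.2 + 1)) (σ.idx s) (σ, 1)

/-- An array that holds a matrix in its upper left corner and is zero elsewhere. -/
def store {F : Type*} [Zero F] {k l : ℕ} (A : Matrix (Fin k) (Fin l) F) (i j : ℕ) : F :=
  if h : i < k ∧ j < l then A ⟨i, h.1⟩ ⟨j, h.2⟩ else 0

/-- The initial state: three dimensions in the index registers 0, 1, 2, three matrices in the
arrays 0, 1, 2, and zero elsewhere. -/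
def initial {F : Type*} [Zero F] (d₀ d₁ d₂ : ℕ) (A₀ A₁ A₂ : ℕ → ℕ → F) : State F where
  idx r := if r = 0 then d₀ else if r = 1 then d₁ else if r = 2 then d₂ else 0
  mem n := if n = 0 then A₀ else if n = 1 then A₁ else if n = 2 then A₂ else fun _ _ => 0

/-- From the state `σ`, the program `p` writes the matrix `A` to array 3 in at most `t` steps. -/
def Prog.Computes {F : Type*} [Field F] [DecidableEq F] (p : Prog) (σ : State F) {k l : ℕ}
    (A : Matrix (Fin k) (Fin l) F) (t : ℕ) : Prop :=
  (∀ (i : Fin k) (j : Fin l), (p.exec σ).1.mem 3 i j = A i j) ∧ (p.exec σ).2 ≤ t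

/-- `enc` computes Alice's encoder and `dec` computes Bob's decoder, both in at most `K n C²`
steps, for all fields and dimensions. -/
def CodeComplexity.{u} (enc dec : Prog) (K : ℕ) : Prop :=
  ∀ (F : Type u) [Field F] [DecidableEq F] (C b m : ℕ), 1 ≤ C → b ≤ C → ∀ s : Secret F C b,
    (∀ M : Message F b m,
      enc.Computes (initial C b m (store M) (store fun _ : Fin 1 => s.1) (store s.2))
        (encode s M) (K * blockLength C b m * C ^ 2)) ∧
    (∀ Y : Received F C b m,
      dec.Computes (initial C b m (store Y) (store fun _ : Fin 1 => s.1) (store s.2))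
        (decode s Y) (K * blockLength C b m * C ^ 2))

/-- `node` computes the linear combinations that a node sends: from `k × d` coefficients and `d`
packets of length `n`, in a number of steps that is polynomial in these dimensions. -/
def NodeComplexity.{u} (node : Prog) (K : ℕ) : Prop :=
  ∀ (F : Type u) [Field F] [DecidableEq F] (k d n : ℕ)
    (U : Matrix (Fin k) (Fin d) F) (Y : Matrix (Fin d) (Fin n) F),
    node.Computes (initial k d n (store U) (store Y) fun _ _ => 0) (U * Y)
      (K * (k + 1) * (d + 1) * (n + 1))

end RandomSecret

/-! The error probability is split into three events, each of probability O(1/q) once the block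
length and the number of links are bounded. The first concerns the network code. For a fixed code
and a fixed set S of links, Bob's packets depend linearly on Alice's symbols and on those that
Calvin puts on S. The code is good (`Network.Separates`) if no nonzero slice x of Alice can be
cancelled with the help of z links. Bad codes are counted in `Network.card_cancels`: fix S, an index
i normalized to x_i = 1, and the set A of links with nonzero symbols, and let W consist of Alice and
the heads of the links in A. If Bob lies in W, a link with nonzero symbol enters him, and his C
coefficients for it are forced by the zero output. Otherwise W is a cut, which has at least C links
by flow conservation; all of them carry zero, and each zero forces one coordinate. As Calvin's
symbols vanish off S and C - z ≥ b, at most a fraction 1/q of the codes is left, and a union bound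
over S, i, A finishes the count.

Next, X ends with the identity, so Alice's part cancels in Y - T̂X and only combinations of Calvin's
injections remain (`Network.output_injection`). If the parity symbols R detect every nonzero
combination of these, then Y - T̂X and (Y - T̂X)P have the same column space, and X explains Y;
separation makes X the only explanation (`Network.decodeCodeword_received`).

It remains to see that R rarely fails. R is irregular (repeated or zero symbols) with probability at
most C²/q. For regular R the map from H to L is a bijection, by a Vandermonde determinant
(`Regular.exists_bijective`). Hence the average over (R, H) becomes one over (R, L), and for fixed L
the distribution of Calvin's attack does not involve R. The attack yields at most q^z combinations,
each nonzero one is a polynomial of degree at most n and missed by at most n^C vectors R, and z < C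
(`card_not_detects`).

For the complexity, encoder and decoder each solve a linear system with C rows: Alice one with C
unknowns and b right-hand sides, Bob the system [D T̂] with C + b unknowns and n right-hand sides.
Gauss-Jordan elimination costs O(nC²). Bob needs only the part X of the solution to be unique, so
the invariant `Reduced` tracks uniqueness of the unknowns from d on alone. The lemma `solved_iff`
turns the outcome into the "exactly one solution" of the definitions. Rules for `Prog.Run` carry
states and step counts through the programs. -/

namespace RandomSecret

/-! ## States that agree up to scratch memory -/

section States

variable {F : Type*}

@[simp] theorem State.setIdx_idx (σ : State F) (r k r' : ℕ) :
    (σ.setIdx r k).idx r' = if r' = r then k else σ.idx r' := rfl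

@[simp] theorem State.setIdx_mem (σ : State F) (r k : ℕ) : (σ.setIdx r k).mem = σ.mem := rfl

@[simp] theorem State.set_idx (σ : State F) (x : Cell) (a : F) : (σ.set x a).idx = σ.idx := rfl

theorem State.set_mem (σ : State F) (x : Cell) (a : F) (n i j : ℕ) :
    (σ.set x a).mem n i j =
      if n = x.arr ∧ i = σ.idx x.row ∧ j = σ.idx x.col then a else σ.mem n i j := rfl

theorem State.set_mem_of_ne (σ : State F) (x : Cell) (a : F) {n : ℕ} (h : n ≠ x.arr) :
    (σ.set x a).mem n = σ.mem n := by
  funext i j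
  simp [State.set_mem, h]

/-- `τ` extends `σ` by a computation that uses only the scratch array 9 and the index registers
from 22 on. -/
def Scratch (σ τ : State F) : Prop :=
  (∀ r < 22, τ.idx r = σ.idx r) ∧ ∀ n ≠ 9, τ.mem n = σ.mem n

theorem Scratch.refl (σ : State F) : Scratch σ σ := ⟨fun _ _ => rfl, fun _ _ => rfl⟩

theorem Scratch.trans {σ τ υ : State F} (h : Scratch σ τ) (h' : Scratch τ υ) : Scratch σ υ :=
  ⟨fun r hr => (h'.1 r hr).trans (h.1 r hr), fun n hn => (h'.2 n hn).trans (h.2 n hn)⟩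

theorem Scratch.setIdx (σ : State F) {r : ℕ} (hr : 22 ≤ r) (k : ℕ) : Scratch σ (σ.setIdx r k) :=
  ⟨fun r' hr' => by simp; omega, fun _ _ => rfl⟩

theorem Scratch.set (σ : State F) {x : Cell} (hx : x.arr = 9) (a : F) : Scratch σ (σ.set x a) :=
  ⟨fun _ _ => rfl, fun _ hn => State.set_mem_of_ne σ x a (by rwa [hx])⟩

/-- `τ` is `σ` up to the contents of the arrays `X` and 9 and the index registers from 20 on. -/
def Upto (X : ℕ) (σ τ : State F) : Prop :=
  (∀ r < 20, τ.idx r = σ.idx r) ∧ ∀ n, n ≠ X → n ≠ 9 → τ.mem n = σ.mem n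

theorem Upto.refl (X : ℕ) (σ : State F) : Upto X σ σ := ⟨fun _ _ => rfl, fun _ _ _ => rfl⟩

theorem Upto.trans {X : ℕ} {σ τ υ : State F} (h : Upto X σ τ) (h' : Upto X τ υ) : Upto X σ υ :=
  ⟨fun r hr => (h'.1 r hr).trans (h.1 r hr), fun n hn hn' => (h'.2 n hn hn').trans (h.2 n hn hn')⟩

end States

/-! ## Hoare-style rules with step counts -/

section Rules

variable {F : Type*} [Field F] [DecidableEq F]

/-- From `σ`, the program `p` reaches a state that satisfies `Q` in at most `t` steps. -/
def Prog.Run (p : Prog) (σ : State F) (Q : State F → Prop) (t : ℕ) : Prop :=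
  Q (p.exec σ).1 ∧ (p.exec σ).2 ≤ t

namespace Prog.Run

variable {p q : Prog} {σ : State F} {Q Q' : State F → Prop} {t t' : ℕ}

theorem mono (h : p.Run σ Q t) (hQ : ∀ τ, Q τ → Q' τ) (ht : t ≤ t') : p.Run σ Q' t' :=
  ⟨hQ _ h.1, h.2.trans ht⟩

theorem weaken (h : p.Run σ Q t) (hQ : ∀ τ, Q τ → Q' τ) : p.Run σ Q' t := h.mono hQ le_rfl

theorem seq (h : p.Run σ Q t) (h' : ∀ τ, Q τ → q.Run τ Q' t') :
    (Prog.seq p q).Run σ Q' (t + t') := by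
  obtain ⟨h₁, h₂⟩ := h
  obtain ⟨h₃, h₄⟩ := h' _ h₁
  exact ⟨by simpa [Prog.exec] using h₃, by simpa [Prog.exec] using Nat.add_le_add h₂ h₄⟩

theorem ifLt {r s : ℕ} (h : σ.idx r < σ.idx s → p.Run σ Q t)
    (h' : ¬ σ.idx r < σ.idx s → q.Run σ Q t) : (Prog.ifLt r s p q).Run σ Q (t + 1) := by
  by_cases hc : σ.idx r < σ.idx s
  · obtain ⟨h₁, h₂⟩ := h hc
    exact ⟨by simpa [Prog.exec, hc] using h₁, by simpa [Prog.exec, hc] using h₂⟩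
  · obtain ⟨h₁, h₂⟩ := h' hc
    exact ⟨by simpa [Prog.exec, hc] using h₁, by simpa [Prog.exec, hc] using h₂⟩

theorem ifZero {x : Cell} (h : σ.get x = 0 → p.Run σ Q t)
    (h' : σ.get x ≠ 0 → q.Run σ Q t) : (Prog.ifZero x p q).Run σ Q (t + 1) := by
  by_cases hc : σ.get x = 0
  · obtain ⟨h₁, h₂⟩ := h hc
    exact ⟨by simpa [Prog.exec, hc] using h₁, by simpa [Prog.exec, hc] using h₂⟩
  · obtain ⟨h₁, h₂⟩ := h' hc
    exact ⟨by simpa [Prog.exec, hc] using h₁, by simpa [Prog.exec, hc] using h₂⟩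

/-- The invariant is indexed by the number of completed passes. Each pass is charged one step beyond
its body, and the start of the loop one more. -/
theorem loop {r s : ℕ} (I : ℕ → State F → Prop) (h₀ : I 0 σ)
    (h : ∀ i < σ.idx s, ∀ τ, I i τ → p.Run (τ.setIdx r i) (I (i + 1)) t) :
    (Prog.loop r s p).Run σ (I (σ.idx s)) (σ.idx s * (t + 1) + 1) := by
  have key : ∀ k ≤ σ.idx s,
      I k (iter (fun i (τ : State F × ℕ) =>
        ((p.exec (τ.1.setIdx r i)).1, τ.2 + (p.exec (τ.1.setIdx r i)).2 + 1)) k (σ, 1)).1 ∧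
      (iter (fun i (τ : State F × ℕ) =>
        ((p.exec (τ.1.setIdx r i)).1, τ.2 + (p.exec (τ.1.setIdx r i)).2 + 1)) k (σ, 1)).2 ≤
        k * (t + 1) + 1 := by
    intro k
    induction k with
    | zero => intro _; exact ⟨h₀, by simp [iter]⟩
    | succ k ih =>
      intro hk
      obtain ⟨h₁, h₂⟩ := ih (by omega)
      obtain ⟨h₃, h₄⟩ := h k (by omega) _ h₁
      refine ⟨h₃, ?_⟩
      simp only [iter]
      rw [Nat.succ_mul]
      omega
  exact key _ le_rfl

end Prog.Run

/-- The program `p` leaves the value `v` in the cell `(0, 0)` of the scratch array. -/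
def Prog.Evaluates (p : Prog) (σ : State F) (v : F) (t : ℕ) : Prop :=
  p.Run σ (fun τ => Scratch σ τ ∧ τ.mem 9 0 0 = v) t

/-- Here v k is the accumulator after k passes. The loop register 22 counts as scratch, so such a
loop may run inside `fill`, which uses 20 and 21. -/
theorem Prog.Evaluates.accLoop {p : Prog} {s t : ℕ} {σ : State F} (v : ℕ → F)
    (h₀ : σ.mem 9 0 0 = v 0)
    (h : ∀ k < σ.idx s, ∀ τ, Scratch σ τ → τ.idx 22 = k → τ.mem 9 0 0 = v k →
      p.Evaluates τ (v (k + 1)) t) :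
    (Prog.loop 22 s p).Evaluates σ (v (σ.idx s)) (σ.idx s * (t + 1) + 1) := by
  refine Prog.Run.loop (fun k τ => Scratch σ τ ∧ τ.mem 9 0 0 = v k) ⟨Scratch.refl σ, h₀⟩ ?_
  rintro k hk τ ⟨hτ, hv⟩
  have hs := hτ.trans (Scratch.setIdx τ le_rfl k)
  exact (h k hk _ hs (by simp) (by simpa using hv)).weaken
    fun υ hυ => ⟨hs.trans hυ.1, hυ.2⟩

/-- The program that fills `R` rows and `S` columns of the array `X`, from the column `o` on, with
the values computed by `p` in the scratch array. -/
def fill (X R o S : ℕ) (p : Prog) : Prog :=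
  .loop 20 R (.loop 21 S (.seq p (.seq (.idxAdd 23 o 21)
    (.seq (.zero ⟨X, 20, 23⟩) (.add ⟨X, 20, 23⟩ ⟨X, 20, 23⟩ ⟨9, 14, 14⟩)))))

/-- The body is run while X is already partly overwritten, so its value is required in every state
that agrees with the initial one up to X and scratch memory. Register 14, kept at zero, addresses
the scratch cell. Each entry costs three steps of copying and one for the pass. -/
theorem fill_run {X R o S T : ℕ} {p : Prog} {σ : State F} (f : ℕ → ℕ → F) (hX : X ≠ 9)
    (hS : S < 20) (ho : o < 20) (hz : σ.idx 14 = 0)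
    (hp : ∀ i < σ.idx R, ∀ j < σ.idx S, ∀ τ, Upto X σ τ → τ.idx 20 = i → τ.idx 21 = j →
      p.Evaluates τ (f i j) T) :
    (fill X R o S p).Run σ (fun τ => Upto X σ τ ∧ ∀ a b, τ.mem X a b =
      if a < σ.idx R ∧ σ.idx o ≤ b ∧ b < σ.idx o + σ.idx S then f a (b - σ.idx o)
      else σ.mem X a b) (σ.idx R * (σ.idx S * (T + 4) + 2) + 1) := by
  refine Prog.Run.loop (fun i τ => Upto X σ τ ∧ ∀ a b, τ.mem X a b =
      if a < i ∧ σ.idx o ≤ b ∧ b < σ.idx o + σ.idx S then f a (b - σ.idx o)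
      else σ.mem X a b) ⟨Upto.refl X σ, by simp⟩ ?_
  rintro i hi τ ⟨hτ, hv⟩
  have hSτ : (τ.setIdx 20 i).idx S = σ.idx S := by
    simp [hτ.1 S hS]; omega
  have hl := Prog.Run.loop (p := .seq p (.seq (.idxAdd 23 o 21)
    (.seq (.zero ⟨X, 20, 23⟩) (.add ⟨X, 20, 23⟩ ⟨X, 20, 23⟩ ⟨9, 14, 14⟩)))) (r := 21) (s := S)
    (σ := τ.setIdx 20 i) (t := T + 3) (fun j υ => Upto X σ υ ∧ υ.idx 20 = i ∧
      ∀ a b, υ.mem X a b = if (a < i ∧ σ.idx o ≤ b ∧ b < σ.idx o + σ.idx S) ∨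
        (a = i ∧ σ.idx o ≤ b ∧ b < σ.idx o + j) then f a (b - σ.idx o)
      else σ.mem X a b) ?_ ?_
  · rw [hSτ] at hl
    refine hl.mono ?_ le_rfl
    rintro υ ⟨hυ, _, hw⟩
    refine ⟨hυ, fun a b => ?_⟩
    rw [hw]
    congr 1
    apply propext
    constructor
    · rintro (h | h) <;> omega
    · intro h
      omega
  · refine ⟨⟨fun r hr => ?_, fun n hn hn' => ?_⟩, by simp, fun a b => ?_⟩
    · simp only [State.setIdx_idx]
      rw [if_neg (by omega), hτ.1 r hr]
    · simpa using hτ.2 n hn hn'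
    · rw [State.setIdx_mem, hv]
      congr 1
      apply propext
      constructor
      · exact Or.inl
      · rintro (h | h) <;> omega
  · rintro j hj υ ⟨hυ, h20, hw⟩
    rw [hSτ] at hj
    have hυ' : Upto X σ (υ.setIdx 21 j) :=
      ⟨fun r hr => by
        simp only [State.setIdx_idx]; rw [if_neg (by omega), hυ.1 r hr], fun n hn hn' => hυ.2 n hn hn'⟩
    refine (hp i hi j hj (υ.setIdx 21 j) hυ' (by simpa using h20) (by simp)).seq (t' := 3) ?_
    rintro ξ ⟨hξ, hξv⟩
    have e20 : ξ.idx 20 = i := by rw [hξ.1 20 (by norm_num)]; simpa using h20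
    have e21 : ξ.idx 21 = j := by rw [hξ.1 21 (by norm_num)]; simp
    have e14 : ξ.idx 14 = 0 := by
      rw [hξ.1 14 (by norm_num), hυ'.1 14 (by norm_num), hz]
    have eo : ξ.idx o = σ.idx o := by rw [hξ.1 o (by omega), hυ'.1 o ho]
    refine ⟨⟨⟨fun r hr => ?_, fun n hn hn' => ?_⟩, ?_, fun a b => ?_⟩, by simp [Prog.exec]⟩
    · simp only [Prog.exec, State.set_idx, State.setIdx_idx]
      rw [if_neg (by omega), hξ.1 r (by omega), hυ'.1 r hr]
    · simp only [Prog.exec]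
      rw [State.set_mem_of_ne _ _ _ hn, State.set_mem_of_ne _ _ _ hn, State.setIdx_mem,
        hξ.2 n hn', hυ'.2 n hn hn']
    · simp [Prog.exec, e20]
    · have hm : ξ.mem X a b = υ.mem X a b := by rw [hξ.2 X hX]; rfl
      simp only [Prog.exec, State.set_mem, State.get, State.set_idx, State.setIdx_idx, e20, e21,
        e14, eo, State.setIdx_mem, hm, hw]
      simp only [true_and]
      by_cases hc : a = i ∧ b = σ.idx o + j
      · obtain ⟨rfl, rfl⟩ := hc
        simp [Ne.symm hX, hξv]
      · rw [if_neg (by simpa using hc), if_neg (by simpa using hc)]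
        congr 1
        apply propext
        constructor
        · rintro (h | h) <;> omega
        · rintro (h | h) <;> omega

/-- Load a cell into the cell `(0, 0)` of the scratch array. -/
def load (x : Cell) : Prog := .seq (.zero ⟨9, 14, 14⟩) (.add ⟨9, 14, 14⟩ ⟨9, 14, 14⟩ x)

theorem load_evaluates {σ : State F} {x : Cell} (hz : σ.idx 14 = 0) (hx : x.arr ≠ 9) :
    (load x).Evaluates σ (σ.get x) 2 := by
  refine ⟨⟨(Scratch.set σ (x := ⟨9, 14, 14⟩) rfl 0).trans (Scratch.set _ rfl _), ?_⟩, le_rfl⟩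
  simp [load, Prog.exec, State.set_mem, State.get, hz, hx]

theorem Prog.Evaluates.seq {p q : Prog} {σ : State F} {u v : F} {t t' : ℕ}
    (h : p.Evaluates σ u t) (h' : ∀ τ, Scratch σ τ → τ.mem 9 0 0 = u → q.Evaluates τ v t') :
    (Prog.seq p q).Evaluates σ v (t + t') :=
  Prog.Run.seq h fun τ hτ => (h' τ hτ.1 hτ.2).weaken fun _ hυ => ⟨hτ.1.trans hυ.1, hυ.2⟩

theorem Prog.Evaluates.mono {p : Prog} {σ : State F} {v : F} {t t' : ℕ}
    (h : p.Evaluates σ v t) (ht : t ≤ t') : p.Evaluates σ v t' :=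
  Prog.Run.mono h (fun _ => id) ht

/-- Clear the cell `(0, 0)` of the scratch array. -/
def clear : Prog := .zero ⟨9, 14, 14⟩

theorem clear_evaluates {σ : State F} (hz : σ.idx 14 = 0) : clear.Evaluates σ 0 1 :=
  ⟨⟨Scratch.set σ rfl 0, by simp [clear, Prog.exec, State.set_mem, hz]⟩, le_rfl⟩

/-- Add the product of two cells to the cell `(0, 0)` of the scratch array. -/
def mulAdd (x y : Cell) : Prog :=
  .seq (.mul ⟨9, 14, 15⟩ x y) (.add ⟨9, 14, 14⟩ ⟨9, 14, 14⟩ ⟨9, 14, 15⟩)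

theorem mulAdd_evaluates {σ : State F} {x y : Cell} (hz : σ.idx 14 = 0) (h1 : σ.idx 15 = 1) :
    (mulAdd x y).Evaluates σ (σ.mem 9 0 0 + σ.get x * σ.get y) 2 := by
  refine ⟨⟨(Scratch.set σ (x := ⟨9, 14, 15⟩) rfl _).trans (Scratch.set _ rfl _), ?_⟩, le_rfl⟩
  simp [mulAdd, Prog.exec, State.set_mem, State.get, hz, h1]

/-- Subtract the product of two cells from the cell `(0, 0)` of the scratch array. -/
def mulSub (x y : Cell) : Prog :=
  .seq (.mul ⟨9, 14, 15⟩ x y) (.sub ⟨9, 14, 14⟩ ⟨9, 14, 14⟩ ⟨9, 14, 15⟩)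

theorem mulSub_evaluates {σ : State F} {x y : Cell} (hz : σ.idx 14 = 0) (h1 : σ.idx 15 = 1) :
    (mulSub x y).Evaluates σ (σ.mem 9 0 0 - σ.get x * σ.get y) 2 := by
  refine ⟨⟨(Scratch.set σ (x := ⟨9, 14, 15⟩) rfl _).trans (Scratch.set _ rfl _), ?_⟩, le_rfl⟩
  simp [mulSub, Prog.exec, State.set_mem, State.get, hz, h1]

end Rules

end RandomSecret
namespace RandomSecret

/-! ## Gauss-Jordan elimination without row exchanges -/

section GaussJordan

variable {F : Type*} [Field F]

/-- The result of clearing column `j` of `A` with the pivot in row `p`. -/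
def pivot (A : ℕ → ℕ → F) (p j : ℕ) (i k : ℕ) : F :=
  if i = p then A p k * (A p j)⁻¹ else A i k - A i j * (A p k * (A p j)⁻¹)

/-- Among the first `r` rows, column `q` is the unit vector of row `i`, and row `i` vanishes
before it. -/
def IsPivot (A : ℕ → ℕ → F) (r i q : ℕ) : Prop :=
  (∀ i' < r, A i' q = if i' = i then 1 else 0) ∧ ∀ k < q, A i k = 0

/-- The invariant of the elimination of the first `e` columns of `A₀` (of `r` rows and `c`
columns) when `j` columns are done: `u` marks the rows with a pivot, and `fl` is zero iff all
columns from `d` on have got a pivot. -/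
structure Reduced (r d e c : ℕ) (A₀ A : ℕ → ℕ → F) (u : ℕ → F) (fl : F) (j : ℕ) : Prop where
  ker : ∀ v : ℕ → F, (∀ i < r, ∑ k ∈ Finset.range c, A i k * v k = 0) ↔
    ∀ i < r, ∑ k ∈ Finset.range c, A₀ i k * v k = 0
  zero : ∀ i < r, u i = 0 → ∀ k < j, A i k = 0
  piv : ∀ i < r, u i ≠ 0 → ∃ q < j, IsPivot A r i q
  ok : fl = 0 → ∀ q < j, d ≤ q → ∃ i < r, u i ≠ 0 ∧ IsPivot A r i q
  bad : fl ≠ 0 → ∃ v : ℕ → F, (∀ i < r, ∑ k ∈ Finset.range c, A₀ i k * v k = 0) ∧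
    (∀ k, e ≤ k → v k = 0) ∧ ∃ k, d ≤ k ∧ k < e ∧ v k ≠ 0

namespace Reduced

variable {r d e c j : ℕ} {A₀ A : ℕ → ℕ → F} {u : ℕ → F} {fl : F}

theorem start (A₀ : ℕ → ℕ → F) : Reduced r d e c A₀ A₀ (fun _ => 0) 0 0 where
  ker _ := Iff.rfl
  zero := by simp
  piv := by simp
  ok := by simp
  bad := by simp

/-- Only the r × c block and the first r marks matter, and this is all that the program is known to
have written. -/
theorem congr (h : Reduced r d e c A₀ A u fl j) (hj : j ≤ c) {A' : ℕ → ℕ → F} {u' : ℕ → F}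
    (hA : ∀ i < r, ∀ k < c, A' i k = A i k) (hu : ∀ i < r, u' i = u i) :
    Reduced r d e c A₀ A' u' fl j := by
  have hp : ∀ i < r, ∀ q < j, IsPivot A r i q → IsPivot A' r i q := fun i hi q hq h =>
    ⟨fun i' hi' => by rw [hA i' hi' q (by omega), h.1 i' hi'],
      fun k hk => by rw [hA i hi k (by omega), h.2 k hk]⟩
  refine ⟨fun v => ?_, fun i hi hui k hk => ?_, fun i hi hui => ?_, fun hf q hq hd => ?_, h.bad⟩
  · rw [← h.ker v]
    refine forall₂_congr fun i hi => ?_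
    rw [Finset.sum_congr rfl fun k hk => by rw [hA i hi k (Finset.mem_range.1 hk)]]
  · rw [hA i hi k (by omega)]
    exact h.zero i hi (by rwa [← hu i hi]) k hk
  · obtain ⟨q, hq, hq'⟩ := h.piv i hi (by rwa [← hu i hi])
    exact ⟨q, hq, hp i hi q hq hq'⟩
  · obtain ⟨i, hi, hui, hi'⟩ := h.ok hf q hq hd
    exact ⟨i, hi, by rwa [hu i hi], hp i hi q hq hi'⟩

/-- An unmarked row vanishes before column j, so subtracting multiples of it changes nothing there
and the old pivots survive. The row operation is invertible, hence the kernel stays the same. -/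
theorem step_pivot (h : Reduced r d e c A₀ A u fl j) {p : ℕ} (hp : p < r)
    (hup : u p = 0) (hA : A p j ≠ 0) :
    Reduced r d e c A₀ (pivot A p j) (fun i => if i = p then 1 else u i) fl (j + 1) := by
  have hlow : ∀ i, ∀ k < j, pivot A p j i k = A i k := by
    intro i k hk
    have := h.zero p hp hup k hk
    by_cases hi : i = p
    · subst hi; simp [pivot, this]
    · simp [pivot, hi, this]
  have hold : ∀ i < r, ∀ q < j, IsPivot A r i q → IsPivot (pivot A p j) r i q := fun i hi q hq h =>
    ⟨fun i' hi' => by rw [hlow i' q hq, h.1 i' hi'],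
      fun k hk => by rw [hlow i k (by omega), h.2 k hk]⟩
  have hnew : IsPivot (pivot A p j) r p j := by
    refine ⟨fun i hi => ?_, fun k hk => by rw [hlow p k hk, h.zero p hp hup k hk]⟩
    by_cases hip : i = p
    · simp [pivot, hip, hA]
    · simp [pivot, hip, hA]
  refine ⟨fun v => ?_, fun i hi hui k hk => ?_, fun i hi hui => ?_, fun hf q hq hd => ?_, h.bad⟩
  · rw [← h.ker v]
    have hrow : ∀ i, ∑ k ∈ Finset.range c, pivot A p j i k * v k = if i = p then
        (∑ k ∈ Finset.range c, A p k * v k) * (A p j)⁻¹ else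
        ∑ k ∈ Finset.range c, A i k * v k
          - A i j * ((∑ k ∈ Finset.range c, A p k * v k) * (A p j)⁻¹) := by
      intro i
      by_cases hip : i = p
      · rw [if_pos hip, Finset.sum_mul]
        exact Finset.sum_congr rfl fun k _ => by simp only [pivot, hip, if_true]; ring
      · rw [if_neg hip, Finset.sum_mul, Finset.mul_sum, ← Finset.sum_sub_distrib]
        exact Finset.sum_congr rfl fun k _ => by simp only [pivot, hip, if_false]; ring
    constructor
    · intro hv
      have hpv : ∑ k ∈ Finset.range c, A p k * v k = 0 := by
        have := hv p hp
        rw [hrow, if_pos rfl] at this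
        exact (mul_eq_zero.1 this).resolve_right (inv_ne_zero hA)
      intro i hi
      by_cases hip : i = p
      · rw [hip, hpv]
      · have := hv i hi
        rwa [hrow, if_neg hip, hpv, zero_mul, mul_zero, sub_zero] at this
    · intro hv i hi
      rw [hrow, hv i hi, hv p hp]
      simp
  · have hip : i ≠ p := by rintro rfl; simp at hui
    rw [if_neg hip] at hui
    rcases Nat.lt_succ_iff_lt_or_eq.1 hk with hk | rfl
    · rw [hlow i k hk, h.zero i hi hui k hk]
    · simp [pivot, hip, hA]
  · by_cases hip : i = p
    · exact ⟨j, Nat.lt_succ_self j, hip ▸ hnew⟩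
    · rw [if_neg hip] at hui
      obtain ⟨q, hq, hq'⟩ := h.piv i hi hui
      exact ⟨q, hq.trans (Nat.lt_succ_self j), hold i hi q hq hq'⟩
  · rcases Nat.lt_succ_iff_lt_or_eq.1 hq with hq | rfl
    · obtain ⟨i, hi, hui, hi'⟩ := h.ok hf q hq hd
      refine ⟨i, hi, ?_, hold i hi q hq hi'⟩
      split_ifs
      · exact one_ne_zero
      · exact hui
    · exact ⟨p, hp, by simp, hnew⟩

/-- Column j is supported on the marked rows, so it is the combination of the pivot columns q i, all
to its left, with coefficients A i j. The unit vector of j minus this combination lies in the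
kernel. -/
theorem exists_kernel (h : Reduced r d e c A₀ A u fl j) (hj : j < e) (he : e ≤ c)
    (hA : ∀ i < r, u i = 0 → A i j = 0) :
    ∃ v : ℕ → F, (∀ i < r, ∑ k ∈ Finset.range c, A₀ i k * v k = 0) ∧
      (∀ k, e ≤ k → v k = 0) ∧ v j ≠ 0 := by
  classical
  choose! q hq hpq using h.piv
  let U := (Finset.range r).filter fun i => u i ≠ 0
  have hU : ∀ i, i ∈ U ↔ i < r ∧ u i ≠ 0 := by simp [U]
  refine ⟨fun k => (if k = j then 1 else 0) - ∑ i ∈ U, A i j * if k = q i then 1 else 0,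
    (h.ker _).1 fun i hi => ?_, fun k hk => ?_, ?_⟩
  · simp only [mul_sub, Finset.sum_sub_distrib, Finset.mul_sum]
    rw [Finset.sum_comm]
    have h1 : ∑ k ∈ Finset.range c, A i k * (if k = j then 1 else 0) = A i j := by
      simp; omega
    have h2 : ∀ i' ∈ U, ∑ k ∈ Finset.range c, A i k * (A i' j * if k = q i' then 1 else 0) =
        if i = i' then A i' j else 0 := by
      intro i' hi'
      obtain ⟨hr, hu⟩ := (hU i').1 hi'
      have hq' := hq i' hr hu
      rw [Finset.sum_eq_single (q i') (fun b _ hb => by simp [hb])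
        (fun hb => absurd (Finset.mem_range.2 (by omega)) hb), (hpq i' hr hu).1 i hi, if_pos rfl, mul_one]
      split_ifs <;> simp
    rw [h1, Finset.sum_congr rfl h2, Finset.sum_ite_eq]
    by_cases hu : u i = 0
    · simp [hU, hu, hA i hi hu]
    · simp [hU, hu, hi]
  · beta_reduce
    rw [if_neg (by omega), Finset.sum_eq_zero, sub_zero]
    intro i hi
    have := hq i ((hU i).1 hi).1 ((hU i).1 hi).2
    rw [if_neg (by omega), mul_zero]
  · beta_reduce
    rw [if_pos rfl, Finset.sum_eq_zero, sub_zero]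
    · exact one_ne_zero
    intro i hi
    have := hq i ((hU i).1 hi).1 ((hU i).1 hi).2
    rw [if_neg (by omega), mul_zero]

/-- A column without a pivot before d concerns an unwanted unknown and does no harm. From d on it
yields a kernel vector with a nonzero wanted component, which refutes uniqueness for good. -/
theorem step_skip (h : Reduced r d e c A₀ A u fl j) (hj : j < e) (he : e ≤ c)
    (hA : ∀ i < r, u i = 0 → A i j = 0) :
    Reduced r d e c A₀ A u (if j < d then fl else 1) (j + 1) := by
  refine ⟨h.ker, fun i hi hui k hk => ?_, fun i hi hui => ?_, fun hf q hq hd => ?_, fun hf => ?_⟩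
  · rcases Nat.lt_succ_iff_lt_or_eq.1 hk with hk | rfl
    · exact h.zero i hi hui k hk
    · exact hA i hi hui
  · obtain ⟨q, hq, hq'⟩ := h.piv i hi hui
    exact ⟨q, hq.trans (Nat.lt_succ_self j), hq'⟩
  · by_cases hjd : j < d
    · rw [if_pos hjd] at hf
      exact h.ok hf q (by omega) hd
    · rw [if_neg hjd] at hf
      exact absurd hf one_ne_zero
  · by_cases hjd : j < d
    · rw [if_pos hjd] at hf
      exact h.bad hf
    · obtain ⟨v, h1, h2, h3⟩ := h.exists_kernel hj he hA
      exact ⟨v, h1, h2, j, by omega, hj, h3⟩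

/-- `w` solves the linear system of the first `e` columns of `A`, with column `e + l` as right-hand
side. -/
def Solves (A : ℕ → ℕ → F) (r e l : ℕ) (w : ℕ → F) : Prop :=
  ∀ i < r, ∑ k ∈ Finset.range e, A i k * w k = A i (e + l)

/-- Solving with right-hand side l amounts to a kernel vector of the whole matrix with entry -1 in
column e + l and 0 in the other right-hand columns; the elimination preserves the kernel. -/
theorem solves_iff (h : Reduced r d e c A₀ A u fl j) {l : ℕ} (hl : e + l < c) (w : ℕ → F) :
    Solves A r e l w ↔ Solves A₀ r e l w := by
  have key : ∀ B : ℕ → ℕ → F, ∀ i, ∑ k ∈ Finset.range c,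
      B i k * (if k < e then w k else if k = e + l then -1 else 0) =
      ∑ k ∈ Finset.range e, B i k * w k - B i (e + l) := by
    intro B i
    rw [← Finset.sum_range_add_sum_Ico _ (show e ≤ c by omega), sub_eq_add_neg]
    congr 1
    · exact Finset.sum_congr rfl fun k hk => by rw [if_pos (Finset.mem_range.1 hk)]
    · rw [Finset.sum_eq_single (e + l)]
      · simp
      · intro k hk hk'
        rw [if_neg (by have := (Finset.mem_Ico.1 hk).1; omega), if_neg hk', mul_zero]
      · intro hk
        exact absurd (Finset.mem_Ico.2 ⟨by omega, hl⟩) hk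
  have := h.ker fun k => if k < e then w k else if k = e + l then -1 else 0
  simpa only [key, sub_eq_zero, Solves] using this

/-- Each pivot unknown takes the right-hand entry of its row, and all other unknowns are zero. The
unmarked rows then read 0 = 0. -/
theorem exists_solves (h : Reduced r d e c A₀ A u fl e) {l : ℕ} (hl : e + l < c)
    (hA : ∀ i < r, u i = 0 → A i (e + l) = 0) : ∃ w, Solves A₀ r e l w := by
  classical
  choose! q hq hpq using h.piv
  let U := (Finset.range r).filter fun i => u i ≠ 0
  have hU : ∀ i, i ∈ U ↔ i < r ∧ u i ≠ 0 := by simp [U]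
  refine ⟨fun k => ∑ i ∈ U, A i (e + l) * if k = q i then 1 else 0,
    (h.solves_iff hl _).1 fun i hi => ?_⟩
  simp only [Finset.mul_sum]
  rw [Finset.sum_comm]
  have h2 : ∀ i' ∈ U, ∑ k ∈ Finset.range e, A i k * (A i' (e + l) * if k = q i' then 1 else 0) =
      if i = i' then A i' (e + l) else 0 := by
    intro i' hi'
    obtain ⟨hr, hu⟩ := (hU i').1 hi'
    have hq' := hq i' hr hu
    rw [Finset.sum_eq_single (q i') (fun b _ hb => by simp [hb])
      (fun hb => absurd (Finset.mem_range.2 (by omega)) hb), (hpq i' hr hu).1 i hi, if_pos rfl, mul_one]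
    split_ifs <;> simp
  rw [Finset.sum_congr rfl h2, Finset.sum_ite_eq]
  by_cases hu : u i = 0
  · simp [hU, hu, hA i hi hu]
  · simp [hU, hu, hi]

theorem not_solves (h : Reduced r d e c A₀ A u fl e) {l i : ℕ} (hl : e + l < c) (hi : i < r)
    (hu : u i = 0) (hA : A i (e + l) ≠ 0) (w : ℕ → F) : ¬ Solves A₀ r e l w := by
  rw [← h.solves_iff hl]
  intro hw
  refine hA ?_
  rw [← hw i hi]
  exact Finset.sum_eq_zero fun k hk => by rw [h.zero i hi hu k (Finset.mem_range.1 hk), zero_mul]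

/-- Column k is the unit vector of its pivot row i, so the sum over all rows merely selects the
right-hand entry of row i. This spares the program a record of the pivot positions. -/
theorem solves_eq (h : Reduced r d e c A₀ A u 0 e) {l : ℕ} (hl : e + l < c) {w : ℕ → F}
    (hw : Solves A₀ r e l w) {k : ℕ} (hd : d ≤ k) (hk : k < e) :
    w k = ∑ i ∈ Finset.range r, A i k * A i (e + l) := by
  obtain ⟨i, hi, hu, hp⟩ := h.ok rfl k hk hd
  have h1 : ∑ i' ∈ Finset.range r, A i' k * A i' (e + l) = A i (e + l) := by
    rw [Finset.sum_eq_single i]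
    · rw [hp.1 i hi, if_pos rfl, one_mul]
    · intro i' hi' hne
      rw [hp.1 i' (Finset.mem_range.1 hi'), if_neg hne, zero_mul]
    · intro hi'
      exact absurd (Finset.mem_range.2 hi) hi'
  rw [h1, ← (h.solves_iff hl w).2 hw i hi, Finset.sum_eq_single k]
  · rw [hp.1 i hi, if_pos rfl, one_mul]
  · intro k' hk' hne
    rcases lt_or_gt_of_ne hne with hlt | hgt
    · rw [hp.2 k' hlt, zero_mul]
    -- A column to the right of k is again wanted, hence has a pivot. Its pivot row is not i, since
    -- that row would have to vanish before k' but has a 1 in column k.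
    · obtain ⟨i', hi', hu', hp'⟩ := h.ok rfl k' (Finset.mem_range.1 hk') (by omega)
      rw [hp'.1 i hi, if_neg, zero_mul]
      rintro rfl
      have := hp'.2 k hgt
      rw [hp.1 i hi, if_pos rfl] at this
      exact one_ne_zero this
  · intro hk'
    exact absurd (Finset.mem_range.2 hk) hk'

end Reduced

end GaussJordan

end RandomSecret
namespace RandomSecret

/-! ## A program that solves linear systems -/

section Solver

variable {F : Type*}

/-- `τ` is `σ` up to the working memory of the solver. -/
def SolverFrame (σ τ : State F) : Prop :=
  (∀ r < 18, τ.idx r = σ.idx r) ∧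
    ∀ n, n ≠ 4 → n ≠ 5 → n ≠ 6 → n ≠ 7 → n ≠ 9 → τ.mem n = σ.mem n

theorem SolverFrame.refl (σ : State F) : SolverFrame σ σ :=
  ⟨fun _ _ => rfl, fun _ _ _ _ _ _ => rfl⟩

theorem SolverFrame.trans {σ τ υ : State F} (h : SolverFrame σ τ) (h' : SolverFrame τ υ) :
    SolverFrame σ υ :=
  ⟨fun r hr => (h'.1 r hr).trans (h.1 r hr), fun n h4 h5 h6 h7 h9 =>
    (h'.2 n h4 h5 h6 h7 h9).trans (h.2 n h4 h5 h6 h7 h9)⟩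

theorem Upto.solverFrame {σ τ : State F} {X : ℕ} (h : Upto X σ τ) (hX : X = 4 ∨ X = 7) :
    SolverFrame σ τ :=
  ⟨fun r hr => h.1 r (by omega), fun n h4 _ _ h7 h9 => h.2 n (by omega) h9⟩

theorem SolverFrame.setIdx (σ : State F) {r : ℕ} (hr : 18 ≤ r) (k : ℕ) :
    SolverFrame σ (σ.setIdx r k) :=
  ⟨fun r' hr' => by simp; omega, fun _ _ _ _ _ _ => rfl⟩

theorem SolverFrame.set (σ : State F) {x : Cell} (hx : x.arr = 5 ∨ x.arr = 6) (a : F) :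
    SolverFrame σ (σ.set x a) :=
  ⟨fun _ _ => rfl, fun _ _ h5 h6 _ _ => State.set_mem_of_ne σ x a (by omega)⟩

variable [Field F] [DecidableEq F]

/-- Do nothing of interest. -/
def skip : Prog := .idxConst 22 0

/-- Let register 18 be an unmarked row with a nonzero entry in the column of register 19, and the
number of rows if there is no such row. -/
def search : Prog :=
  .seq (.idxAdd 18 10 14) (.loop 20 10 (.ifZero ⟨6, 14, 20⟩
    (.ifZero ⟨4, 20, 19⟩ skip (.idxAdd 18 20 14)) skip))

theorem search_run {σ : State F} (hz : σ.idx 14 = 0) :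
    search.Run σ (fun τ => (∀ r < 20, r ≠ 18 → τ.idx r = σ.idx r) ∧ τ.mem = σ.mem ∧
      ((τ.idx 18 < σ.idx 10 ∧ σ.mem 6 0 (τ.idx 18) = 0 ∧ σ.mem 4 (τ.idx 18) (σ.idx 19) ≠ 0) ∨
        (τ.idx 18 = σ.idx 10 ∧ ∀ i < σ.idx 10, σ.mem 6 0 i = 0 → σ.mem 4 i (σ.idx 19) = 0)))
      (σ.idx 10 * 4 + 2) := by
  have h10 : (σ.setIdx 18 (σ.idx 10)).idx 10 = σ.idx 10 := by simp
  have hl := Prog.Run.loop (p := .ifZero ⟨6, 14, 20⟩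
    (.ifZero ⟨4, 20, 19⟩ skip (.idxAdd 18 20 14)) skip) (r := 20) (s := 10) (t := 3)
    (σ := σ.setIdx 18 (σ.idx 10)) (fun k τ => (∀ r < 20, r ≠ 18 → τ.idx r = σ.idx r) ∧
      τ.mem = σ.mem ∧
      ((τ.idx 18 < σ.idx 10 ∧ σ.mem 6 0 (τ.idx 18) = 0 ∧ σ.mem 4 (τ.idx 18) (σ.idx 19) ≠ 0) ∨
        (τ.idx 18 = σ.idx 10 ∧ ∀ i < k, σ.mem 6 0 i = 0 → σ.mem 4 i (σ.idx 19) = 0)))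
    ⟨fun r _ h => by simp [h], rfl, Or.inr ⟨by simp, by simp⟩⟩ ?_
  · rw [h10] at hl
    refine Prog.Run.mono (Prog.Run.seq (Q := fun τ => τ = σ.setIdx 18 (σ.idx 10)) (t := 1)
      ⟨by simp [Prog.exec, hz], le_rfl⟩ (fun τ hτ => ?_)) (fun _ => id) (le_of_eq (Nat.add_comm 1 _))
    subst hτ
    exact hl
  · rintro k hk τ ⟨h1, h2, h3⟩
    rw [h10] at hk
    have e14 : τ.idx 14 = 0 := by rw [h1 14 (by norm_num) (by norm_num), hz]
    have e19 : τ.idx 19 = σ.idx 19 := h1 19 (by norm_num) (by norm_num)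
    have hskip : ∀ υ : State F, υ = τ.setIdx 20 k →
        (σ.mem 6 0 k = 0 → σ.mem 4 k (σ.idx 19) = 0) → skip.Run υ (fun τ =>
        (∀ r < 20, r ≠ 18 → τ.idx r = σ.idx r) ∧ τ.mem = σ.mem ∧
      ((τ.idx 18 < σ.idx 10 ∧ σ.mem 6 0 (τ.idx 18) = 0 ∧ σ.mem 4 (τ.idx 18) (σ.idx 19) ≠ 0) ∨
        (τ.idx 18 = σ.idx 10 ∧ ∀ i < k + 1, σ.mem 6 0 i = 0 → σ.mem 4 i (σ.idx 19) = 0))) 1 := by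
      rintro _ rfl hA
      refine ⟨⟨fun r hr h18 => ?_, by simpa [skip, Prog.exec] using h2, ?_⟩, le_rfl⟩
      · simp only [skip, Prog.exec, State.setIdx_idx]
        rw [if_neg (by omega), if_neg (by omega), h1 r hr h18]
      · simp only [skip, Prog.exec, State.setIdx_idx]
        rw [if_neg (by omega), if_neg (by omega)]
        refine h3.imp_right fun h => ⟨h.1, fun i hi => ?_⟩
        rcases Nat.lt_succ_iff_lt_or_eq.1 hi with hi | rfl
        · exact h.2 i hi
        · exact hA
    refine Prog.Run.ifZero (t := 2) (fun hu => ?_) (fun hu => ?_)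
    · have hu' : σ.mem 6 0 k = 0 := by simpa [State.get, h2, e14] using hu
      refine Prog.Run.ifZero (t := 1) (fun ha => ?_) (fun ha => ?_)
      · have ha' : σ.mem 4 k (σ.idx 19) = 0 := by simpa [State.get, h2, e19] using ha
        exact hskip _ rfl fun _ => ha'
      · have ha' : σ.mem 4 k (σ.idx 19) ≠ 0 := by simpa [State.get, h2, e19] using ha
        refine ⟨⟨fun r hr h18 => ?_, by simpa [Prog.exec] using h2, Or.inl ?_⟩, le_rfl⟩
        · simp only [Prog.exec, State.setIdx_idx]
          rw [if_neg h18, if_neg (by omega), h1 r hr h18]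
        · simp [Prog.exec, e14, hk, hu', ha']
    · have hu' : σ.mem 6 0 k ≠ 0 := by simpa [State.get, h2, e14] using hu
      exact (hskip _ rfl fun h => absurd h hu').mono (fun _ => id) (by norm_num)

/-- The entry in row 20 and column 21 after clearing the column of register 19 with the pivot in
the row of register 18. -/
def pivotEntry : Prog :=
  .seq (.seq (.inv ⟨9, 14, 14⟩ ⟨4, 18, 19⟩) (.mul ⟨9, 14, 14⟩ ⟨4, 18, 21⟩ ⟨9, 14, 14⟩))
    (.ifLt 20 18 (.seq (.mul ⟨9, 14, 14⟩ ⟨4, 20, 19⟩ ⟨9, 14, 14⟩)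
        (.sub ⟨9, 14, 14⟩ ⟨4, 20, 21⟩ ⟨9, 14, 14⟩))
      (.ifLt 18 20 (.seq (.mul ⟨9, 14, 14⟩ ⟨4, 20, 19⟩ ⟨9, 14, 14⟩)
        (.sub ⟨9, 14, 14⟩ ⟨4, 20, 21⟩ ⟨9, 14, 14⟩)) skip))

theorem pivotEntry_evaluates {σ : State F} (hz : σ.idx 14 = 0) :
    pivotEntry.Evaluates σ
      (pivot (σ.mem 4) (σ.idx 18) (σ.idx 19) (σ.idx 20) (σ.idx 21)) 6 := by
  refine Prog.Evaluates.seq (t := 2) (t' := 4)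
    (u := σ.mem 4 (σ.idx 18) (σ.idx 21) * (σ.mem 4 (σ.idx 18) (σ.idx 19))⁻¹)
    ⟨⟨(Scratch.set σ (x := ⟨9, 14, 14⟩) rfl _).trans (Scratch.set _ rfl _), ?_⟩, le_rfl⟩ ?_
  · simp [Prog.exec, State.set_mem, State.get, hz]
  intro τ hτ hv
  have e14 : τ.idx 14 = 0 := by rw [hτ.1 14 (by norm_num), hz]
  have e18 : τ.idx 18 = σ.idx 18 := hτ.1 18 (by norm_num)
  have e19 : τ.idx 19 = σ.idx 19 := hτ.1 19 (by norm_num)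
  have e20 : τ.idx 20 = σ.idx 20 := hτ.1 20 (by norm_num)
  have e21 : τ.idx 21 = σ.idx 21 := hτ.1 21 (by norm_num)
  have hm : τ.mem 4 = σ.mem 4 := hτ.2 4 (by norm_num)
  have hne : σ.idx 20 ≠ σ.idx 18 → (Prog.seq (.mul ⟨9, 14, 14⟩ ⟨4, 20, 19⟩ ⟨9, 14, 14⟩)
        (.sub ⟨9, 14, 14⟩ ⟨4, 20, 21⟩ ⟨9, 14, 14⟩)).Evaluates τ
      (pivot (σ.mem 4) (σ.idx 18) (σ.idx 19) (σ.idx 20) (σ.idx 21)) 2 := by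
    intro h
    refine ⟨⟨(Scratch.set τ (x := ⟨9, 14, 14⟩) rfl _).trans (Scratch.set _ rfl _), ?_⟩, le_rfl⟩
    simp [Prog.exec, State.set_mem, State.get, e14, e19, e20, e21, hm, hv, pivot, h]
  refine Prog.Run.ifLt (t := 3) (fun h => (hne (by omega)).mono (by norm_num)) fun h => ?_
  refine Prog.Run.ifLt (t := 2) (fun h => (hne (by omega)).mono (by norm_num)) fun h' => ?_
  refine Prog.Run.mono (t := 1) ⟨⟨Scratch.setIdx τ le_rfl 0, ?_⟩, le_rfl⟩ (fun _ => id) (by norm_num)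
  have : σ.idx 20 = σ.idx 18 := by omega
  simpa [skip, Prog.exec, pivot, this] using hv

/-- Clear the column of register 19, if possible, else take note of the failure. -/
def reduceColumn : Prog :=
  .seq search (.ifLt 18 10
    (.seq (.one ⟨6, 14, 18⟩) (.seq (fill 7 10 14 13 pivotEntry) (fill 4 10 14 13 (load ⟨7, 20, 21⟩))))
    (.ifLt 19 11 skip (.one ⟨5, 14, 14⟩)))

/-- The search either finds a pivot, which is the case of `step_pivot`, or proves that there is
none, the case of `step_skip`. The new matrix is built in array 7 and then copied, because every
entry needs the old pivot row and column. -/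
theorem reduceColumn_run {σ : State F} {A₀ : ℕ → ℕ → F} (hz : σ.idx 14 = 0)
    (hj : σ.idx 19 < σ.idx 12) (hc : σ.idx 12 ≤ σ.idx 13)
    (h : Reduced (σ.idx 10) (σ.idx 11) (σ.idx 12) (σ.idx 13) A₀ (σ.mem 4) (σ.mem 6 0)
      (σ.mem 5 0 0) (σ.idx 19)) :
    reduceColumn.Run σ (fun τ => SolverFrame σ τ ∧
      Reduced (σ.idx 10) (σ.idx 11) (σ.idx 12) (σ.idx 13) A₀ (τ.mem 4) (τ.mem 6 0)
      (τ.mem 5 0 0) (σ.idx 19 + 1)) (σ.idx 10 * (16 * σ.idx 13 + 8) + 6) := by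
  have ht : σ.idx 10 * (16 * σ.idx 13 + 8) + 6 = (σ.idx 10 * 4 + 2) +
      ((1 + ((σ.idx 10 * (σ.idx 13 * (6 + 4) + 2) + 1) +
        (σ.idx 10 * (σ.idx 13 * (2 + 4) + 2) + 1))) + 1) := by ring
  rw [ht]
  refine (search_run hz).seq ?_
  rintro τ ⟨hi, hm, hs⟩
  have e10 : τ.idx 10 = σ.idx 10 := hi 10 (by norm_num) (by norm_num)
  have e11 : τ.idx 11 = σ.idx 11 := hi 11 (by norm_num) (by norm_num)
  have e13 : τ.idx 13 = σ.idx 13 := hi 13 (by norm_num) (by norm_num)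
  have e14 : τ.idx 14 = 0 := by rw [hi 14 (by norm_num) (by norm_num), hz]
  have e19 : τ.idx 19 = σ.idx 19 := hi 19 (by norm_num) (by norm_num)
  have hfr : SolverFrame σ τ :=
    ⟨fun r hr => hi r (by omega) (by omega), fun n _ _ _ _ _ => by rw [hm]⟩
  refine Prog.Run.ifLt (fun hlt => ?_) (fun hlt => ?_)
  · obtain ⟨hp, hup, hA⟩ : τ.idx 18 < σ.idx 10 ∧ σ.mem 6 0 (τ.idx 18) = 0 ∧
        σ.mem 4 (τ.idx 18) (σ.idx 19) ≠ 0 := by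
      rcases hs with hs | hs
      · exact hs
      · omega
    refine Prog.Run.seq (Q := fun υ => υ = τ.set ⟨6, 14, 18⟩ 1) ⟨rfl, le_rfl⟩ ?_
    rintro υ rfl
    have m4 : (τ.set ⟨6, 14, 18⟩ 1).mem 4 = σ.mem 4 := by
      rw [State.set_mem_of_ne _ _ _ (by norm_num), hm]
    refine Prog.Run.seq (t := σ.idx 10 * (σ.idx 13 * (6 + 4) + 2) + 1)
      (Prog.Run.mono (fill_run (X := 7) (R := 10) (o := 14) (S := 13) (T := 6)
        (σ := τ.set ⟨6, 14, 18⟩ 1) (fun i k => pivot (σ.mem 4) (τ.idx 18) (σ.idx 19) i k)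
        (by norm_num) (by norm_num) (by norm_num) e14 ?_) (fun _ => id) ?_) ?_
    · intro i _ k _ υ hυ h20 h21
      have := pivotEntry_evaluates (σ := υ) (by rw [hυ.1 14 (by norm_num)]; exact e14)
      rwa [h20, h21, hυ.1 18 (by norm_num), hυ.1 19 (by norm_num), State.set_idx, e19,
        hυ.2 4 (by norm_num) (by norm_num), m4] at this
    · simp [e10, e13]
    rintro υ ⟨hυ, hv⟩
    have f14 : υ.idx 14 = 0 := by rw [hυ.1 14 (by norm_num)]; exact e14
    have f10 : υ.idx 10 = σ.idx 10 := by rw [hυ.1 10 (by norm_num)]; exact e10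
    have f13 : υ.idx 13 = σ.idx 13 := by rw [hυ.1 13 (by norm_num)]; exact e13
    refine Prog.Run.mono (fill_run (X := 4) (R := 10) (o := 14) (S := 13) (T := 2)
        (σ := υ) (fun i k => υ.mem 7 i k)
        (by norm_num) (by norm_num) (by norm_num) f14 ?_) ?_ (by rw [f10, f13])
    · intro i _ k _ ξ hξ h20 h21
      have := load_evaluates (σ := ξ) (x := ⟨7, 20, 21⟩)
        (by rw [hξ.1 14 (by norm_num)]; exact f14) (by norm_num)
      rwa [State.get, h20, h21, hξ.2 7 (by norm_num) (by norm_num)] at this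
    · rintro ξ ⟨hξ, hw⟩
      refine ⟨hfr.trans (((SolverFrame.set τ (x := ⟨6, 14, 18⟩) (Or.inr rfl) 1).trans
        (hυ.solverFrame (Or.inr rfl))).trans (hξ.solverFrame (Or.inl rfl))), ?_⟩
      have h5 : ξ.mem 5 0 0 = σ.mem 5 0 0 := by
        rw [hξ.2 5 (by norm_num) (by norm_num), hυ.2 5 (by norm_num) (by norm_num),
          State.set_mem_of_ne _ _ _ (by norm_num), hm]
      rw [h5]
      refine (h.step_pivot hp hup hA).congr (by omega) (fun i hi k hk => ?_) (fun i hi => ?_)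
      · rw [hw, hv]
        simp [f10, f13, f14, e10, e13, e14, hi, hk]
      · rw [hξ.2 6 (by norm_num) (by norm_num), hυ.2 6 (by norm_num) (by norm_num),
          State.set_mem, hm]
        simp [e14]
  · have hA : ∀ i < σ.idx 10, σ.mem 6 0 i = 0 → σ.mem 4 i (σ.idx 19) = 0 := by
      rcases hs with hs | hs
      · omega
      · exact hs.2
    refine Prog.Run.mono (t := 2) (Prog.Run.ifLt (t := 1) (fun hjd => ?_) (fun hjd => ?_))
      (fun _ => id) (by omega)
    · refine ⟨⟨hfr.trans (SolverFrame.setIdx τ (by norm_num) 0), ?_⟩, le_rfl⟩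
      have := h.step_skip hj hc hA
      rw [e19, e11] at hjd
      rw [if_pos hjd] at this
      simpa [skip, Prog.exec, hm] using this
    · refine ⟨⟨hfr.trans (SolverFrame.set τ (x := ⟨5, 14, 14⟩) (Or.inl rfl) 1), ?_⟩, le_rfl⟩
      have := h.step_skip hj hc hA
      rw [e19, e11] at hjd
      rw [if_neg hjd] at this
      have h4 : (τ.set ⟨5, 14, 14⟩ 1).mem 4 = σ.mem 4 := by
        rw [State.set_mem_of_ne _ _ _ (by norm_num), hm]
      have h6 : (τ.set ⟨5, 14, 14⟩ 1).mem 6 = σ.mem 6 := by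
        rw [State.set_mem_of_ne _ _ _ (by norm_num), hm]
      have h5 : (τ.set ⟨5, 14, 14⟩ 1).mem 5 0 0 = 1 := by
        simp [State.set_mem, e14]
      simpa [Prog.exec, h4, h5, h6] using this

/-- Note a failure if a row without a pivot has a nonzero entry to the right of column `e`. -/
def checkRows : Prog :=
  .loop 20 10 (.ifZero ⟨6, 14, 20⟩
    (.loop 21 16 (.seq (.idxAdd 23 12 21) (.ifZero ⟨4, 20, 23⟩ skip (.one ⟨5, 14, 14⟩)))) skip)

/-- After the elimination an unmarked row is zero in the first e columns, so the system is
consistent exactly if such rows also vanish in the right-hand columns. -/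
theorem checkRows_run {σ : State F} (hz : σ.idx 14 = 0) :
    checkRows.Run σ (fun τ => SolverFrame σ τ ∧ τ.mem 4 = σ.mem 4 ∧
      (τ.mem 5 0 0 = 0 ↔ σ.mem 5 0 0 = 0 ∧ ∀ i < σ.idx 10, σ.mem 6 0 i = 0 →
        ∀ l < σ.idx 16, σ.mem 4 i (σ.idx 12 + l) = 0))
      (σ.idx 10 * (σ.idx 16 * 4 + 3) + 1) := by
  have inner : ∀ i < σ.idx 10, ∀ τ : State F, SolverFrame σ τ → τ.mem 4 = σ.mem 4 →
      τ.mem 6 = σ.mem 6 → τ.idx 20 = i →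
      (Prog.loop 21 16 (.seq (.idxAdd 23 12 21) (.ifZero ⟨4, 20, 23⟩ skip
        (.one ⟨5, 14, 14⟩)))).Run τ (fun υ => SolverFrame σ υ ∧ υ.mem 4 = σ.mem 4 ∧
        υ.mem 6 = σ.mem 6 ∧ υ.idx 20 = i ∧ (υ.mem 5 0 0 = 0 ↔ τ.mem 5 0 0 = 0 ∧
          ∀ l < σ.idx 16, σ.mem 4 i (σ.idx 12 + l) = 0)) (σ.idx 16 * 4 + 1) := by
    intro i _ τ hτ h4 h6 h20
    have e16 : τ.idx 16 = σ.idx 16 := hτ.1 16 (by norm_num)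
    have := Prog.Run.loop (p := .seq (.idxAdd 23 12 21) (.ifZero ⟨4, 20, 23⟩ skip
        (.one ⟨5, 14, 14⟩))) (r := 21) (s := 16) (t := 3) (σ := τ)
      (fun k υ => SolverFrame σ υ ∧ υ.mem 4 = σ.mem 4 ∧
        υ.mem 6 = σ.mem 6 ∧ υ.idx 20 = i ∧ (υ.mem 5 0 0 = 0 ↔ τ.mem 5 0 0 = 0 ∧
          ∀ l < k, σ.mem 4 i (σ.idx 12 + l) = 0)) ⟨hτ, h4, h6, h20, by simp⟩ ?_
    · rwa [e16] at this
    rintro k hk υ ⟨h1, h2, h3, h5, h7⟩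
    have e12 : υ.idx 12 = σ.idx 12 := h1.1 12 (by norm_num)
    have e14 : υ.idx 14 = 0 := by rw [h1.1 14 (by norm_num), hz]
    refine Prog.Run.seq (t := 1) (t' := 2)
      (Q := fun ξ => ξ = (υ.setIdx 21 k).setIdx 23 (σ.idx 12 + k)) ?_ ?_
    · exact ⟨by simp [Prog.exec, e12], le_rfl⟩
    rintro ξ rfl
    refine Prog.Run.ifZero (t := 1) (fun hg => ?_) (fun hg => ?_)
    · have hg' : σ.mem 4 i (σ.idx 12 + k) = 0 := by simpa [State.get, h2, h5] using hg
      refine ⟨⟨h1.trans (((SolverFrame.setIdx υ (by norm_num) k).trans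
        (SolverFrame.setIdx _ (by norm_num) _)).trans (SolverFrame.setIdx _ (by norm_num) 0)),
        by simpa [skip, Prog.exec] using h2, by simpa [skip, Prog.exec] using h3,
        by simpa [skip, Prog.exec] using h5, ?_⟩, le_rfl⟩
      simp only [skip, Prog.exec, State.setIdx_mem]
      rw [h7]
      refine and_congr_right fun _ => ⟨fun h l hl => ?_, fun h l hl => h l (by omega)⟩
      rcases Nat.lt_succ_iff_lt_or_eq.1 hl with hl | rfl
      · exact h l hl
      · exact hg'
    · have hg' : σ.mem 4 i (σ.idx 12 + k) ≠ 0 := by simpa [State.get, h2, h5] using hg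
      refine ⟨⟨h1.trans (((SolverFrame.setIdx υ (by norm_num) k).trans
        (SolverFrame.setIdx _ (by norm_num) _)).trans
          (SolverFrame.set _ (x := ⟨5, 14, 14⟩) (Or.inl rfl) 1)), ?_, ?_,
        by simpa [Prog.exec] using h5, ?_⟩, le_rfl⟩
      · simp only [Prog.exec]
        rw [State.set_mem_of_ne _ _ _ (by norm_num)]
        exact h2
      · simp only [Prog.exec]
        rw [State.set_mem_of_ne _ _ _ (by norm_num)]
        exact h3
      · simp only [Prog.exec, State.set_mem]
        simp [e14]
        exact fun _ => ⟨k, le_rfl, hg'⟩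
  have := Prog.Run.loop (p := .ifZero ⟨6, 14, 20⟩
    (.loop 21 16 (.seq (.idxAdd 23 12 21) (.ifZero ⟨4, 20, 23⟩ skip (.one ⟨5, 14, 14⟩)))) skip)
    (r := 20) (s := 10) (t := σ.idx 16 * 4 + 2) (σ := σ)
    (fun k τ => SolverFrame σ τ ∧ τ.mem 4 = σ.mem 4 ∧ τ.mem 6 = σ.mem 6 ∧
      (τ.mem 5 0 0 = 0 ↔ σ.mem 5 0 0 = 0 ∧ ∀ i < k, σ.mem 6 0 i = 0 →
        ∀ l < σ.idx 16, σ.mem 4 i (σ.idx 12 + l) = 0))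
    ⟨SolverFrame.refl σ, rfl, rfl, by simp⟩ ?_
  · exact this.mono (fun τ h => ⟨h.1, h.2.1, h.2.2.2⟩) le_rfl
  rintro k hk τ ⟨h1, h2, h3, h4⟩
  have e14 : τ.idx 14 = 0 := by rw [h1.1 14 (by norm_num), hz]
  have hfr := h1.trans (SolverFrame.setIdx τ (r := 20) (by norm_num) k)
  refine Prog.Run.ifZero (fun hg => ?_) (fun hg => ?_)
  · have hg' : σ.mem 6 0 k = 0 := by simpa [State.get, h3, e14] using hg
    refine (inner k hk _ hfr h2 h3 (by simp)).weaken ?_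
    rintro υ ⟨g1, g2, g3, -, g5⟩
    refine ⟨g1, g2, g3, g5.trans ?_⟩
    rw [State.setIdx_mem, h4, and_assoc]
    refine and_congr_right fun _ => ⟨fun h i hi => ?_, fun h => ⟨fun i hi => h i (by omega),
      h k (Nat.lt_succ_self k) hg'⟩⟩
    rcases Nat.lt_succ_iff_lt_or_eq.1 hi with hi | rfl
    · exact h.1 i hi
    · exact fun _ => h.2
  · have hg' : σ.mem 6 0 k ≠ 0 := by simpa [State.get, h3, e14] using hg
    refine Prog.Run.mono (t := 1) ⟨⟨hfr.trans (SolverFrame.setIdx _ (by norm_num) 0), h2, h3, ?_⟩,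
      le_rfl⟩ (fun _ => id) (by omega)
    simp only [skip, Prog.exec, State.setIdx_mem]
    rw [h4]
    refine and_congr_right fun _ => ⟨fun h i hi => ?_, fun h i hi => h i (by omega)⟩
    rcases Nat.lt_succ_iff_lt_or_eq.1 hi with hi | rfl
    · exact h i hi
    · exact fun h => absurd h hg'

/-- Gauss-Jordan elimination of array 4. -/
def solve : Prog := .seq (.loop 19 12 reduceColumn) checkRows

/-- What the solver leaves in array 4 and as failure flag, for the system `A₀` of `r` rows with
`e` unknowns, of which those from `d` on are wanted, and `y` right-hand sides. -/
def Solved (r d e y : ℕ) (A₀ A : ℕ → ℕ → F) (fl : F) : Prop :=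
  (fl = 0 → ∀ l < y, (∃ w, Reduced.Solves A₀ r e l w) ∧ ∀ w, Reduced.Solves A₀ r e l w →
    ∀ k, d ≤ k → k < e → w k = ∑ i ∈ Finset.range r, A i k * A i (e + l)) ∧
  (fl ≠ 0 → (∃ l < y, ∀ w, ¬ Reduced.Solves A₀ r e l w) ∨
    ∃ v : ℕ → F, (∀ i < r, ∑ k ∈ Finset.range e, A₀ i k * v k = 0) ∧
      ∃ k, d ≤ k ∧ k < e ∧ v k ≠ 0)

/-- The flag collects two kinds of failure: a wanted column without a pivot during the elimination,
and an inconsistent right-hand side found afterwards. The hypotheses on arrays 5 and 6 are the start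
of the invariant: no failure, no marks. -/
theorem solve_run {σ : State F} (hz : σ.idx 14 = 0) (hc : σ.idx 13 = σ.idx 12 + σ.idx 16)
    (hu : ∀ i, σ.mem 6 0 i = 0) (hf : σ.mem 5 0 0 = 0) :
    solve.Run σ (fun τ => SolverFrame σ τ ∧
      Solved (σ.idx 10) (σ.idx 11) (σ.idx 12) (σ.idx 16) (σ.mem 4) (τ.mem 4) (τ.mem 5 0 0))
      (σ.idx 12 * (σ.idx 10 * (16 * σ.idx 13 + 8) + 7) + 1 +
        (σ.idx 10 * (σ.idx 16 * 4 + 3) + 1)) := by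
  refine Prog.Run.seq (Prog.Run.loop (t := σ.idx 10 * (16 * σ.idx 13 + 8) + 6)
    (fun j τ => SolverFrame σ τ ∧ Reduced (σ.idx 10) (σ.idx 11) (σ.idx 12) (σ.idx 13) (σ.mem 4)
      (τ.mem 4) (τ.mem 6 0) (τ.mem 5 0 0) j) ⟨SolverFrame.refl σ, ?_⟩ ?_) ?_
  · rw [hf, show σ.mem 6 0 = fun _ => 0 from funext hu]
    exact Reduced.start _
  · rintro j hj τ ⟨hτ, hr⟩
    have hτ' := hτ.trans (SolverFrame.setIdx τ (r := 19) (by norm_num) j)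
    have e10 : (τ.setIdx 19 j).idx 10 = σ.idx 10 := hτ'.1 10 (by norm_num)
    have e11 : (τ.setIdx 19 j).idx 11 = σ.idx 11 := hτ'.1 11 (by norm_num)
    have e12 : (τ.setIdx 19 j).idx 12 = σ.idx 12 := hτ'.1 12 (by norm_num)
    have e13 : (τ.setIdx 19 j).idx 13 = σ.idx 13 := hτ'.1 13 (by norm_num)
    have e14 : (τ.setIdx 19 j).idx 14 = 0 := by rw [hτ'.1 14 (by norm_num), hz]
    have e19 : (τ.setIdx 19 j).idx 19 = j := by simp
    have := reduceColumn_run (σ := τ.setIdx 19 j) (A₀ := σ.mem 4) e14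
      (by rw [e19, e12]; exact hj) (by rw [e12, e13]; omega)
      (by rw [e10, e11, e12, e13, e19]; exact hr)
    rw [e10, e11, e12, e13, e19] at this
    exact this.weaken fun υ h => ⟨hτ'.trans h.1, h.2⟩
  · rintro τ ⟨hτ, hr⟩
    have e10 : τ.idx 10 = σ.idx 10 := hτ.1 10 (by norm_num)
    have e12 : τ.idx 12 = σ.idx 12 := hτ.1 12 (by norm_num)
    have e16 : τ.idx 16 = σ.idx 16 := hτ.1 16 (by norm_num)
    have := checkRows_run (σ := τ) (by rw [hτ.1 14 (by norm_num), hz])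
    rw [e10, e12, e16] at this
    refine this.weaken ?_
    rintro υ ⟨h1, h2, h3⟩
    refine ⟨hτ.trans h1, fun hfl l hl => ?_, fun hfl => ?_⟩
    · obtain ⟨h5, h6⟩ := h3.1 hfl
      rw [h5] at hr
      rw [h2]
      exact ⟨hr.exists_solves (by omega) fun i hi hui => h6 i hi hui l hl,
        fun w hw k hd hk => hr.solves_eq (by omega) hw hd hk⟩
    · by_cases h5 : τ.mem 5 0 0 = 0
      · rw [ne_eq, h3] at hfl
        push Not at hfl
        obtain ⟨i, hi, hui, l, hl, hA⟩ := hfl h5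
        exact Or.inl ⟨l, hl, hr.not_solves (by omega) hi hui hA⟩
      · obtain ⟨v, hv, hv', hk⟩ := hr.bad h5
        refine Or.inr ⟨v, fun i hi => ?_, hk⟩
        rw [← hv i hi]
        -- The kernel vector vanishes in the right-hand columns, so the sum may be cut down to the
        -- unknowns.
        refine Finset.sum_subset (Finset.range_mono (by omega)) fun k _ hk => ?_
        rw [hv' k (by simpa using hk), mul_zero]

end Solver

end RandomSecret
namespace RandomSecret

/-! ## The programs of the nodes, the encoder and the decoder -/

theorem store_apply {F : Type*} [Zero F] {k l : ℕ} (A : Matrix (Fin k) (Fin l) F) (i : Fin k) (j : Fin l) :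
    store A i j = A i j := by
  simp [store]

section Programs

variable {F : Type*} [Field F] [DecidableEq F]

theorem accumulate_evaluates {s t : ℕ} {p : Prog} {σ : State F} (a : F) (g : ℕ → F)
    (h₀ : σ.mem 9 0 0 = a) (h : ∀ k < σ.idx s, ∀ τ, Scratch σ τ → τ.idx 22 = k →
      p.Evaluates τ (τ.mem 9 0 0 + g k) t) :
    (Prog.loop 22 s p).Evaluates σ (a + ∑ k ∈ Finset.range (σ.idx s), g k)
      (σ.idx s * (t + 1) + 1) := by
  refine Prog.Evaluates.accLoop (fun i => a + ∑ k ∈ Finset.range i, g k) (by simpa using h₀) ?_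
  intro k hk τ hτ h22 hv
  have := h k hk τ hτ h22
  rwa [hv, add_assoc, ← Finset.sum_range_succ] at this

theorem sum_evaluates {s t : ℕ} {p : Prog} {σ : State F} (g : ℕ → F) (hz : σ.idx 14 = 0)
    (hs : s < 22) (h : ∀ k < σ.idx s, ∀ τ, Scratch σ τ → τ.idx 22 = k →
      p.Evaluates τ (τ.mem 9 0 0 + g k) t) :
    (Prog.seq clear (.loop 22 s p)).Evaluates σ (∑ k ∈ Finset.range (σ.idx s), g k)
      (σ.idx s * (t + 1) + 2) := by
  refine Prog.Evaluates.mono (Prog.Evaluates.seq (clear_evaluates hz) (t' := σ.idx s * (t + 1) + 1)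
    fun τ hτ hv => ?_) (by omega)
  have := accumulate_evaluates (s := s) (p := p) (t := t) (σ := τ) 0 g hv
    (fun k hk υ hυ => h k (by rwa [← hτ.1 s hs]) υ (hτ.trans hυ))
  rwa [hτ.1 s hs, zero_add] at this

theorem Prog.Evaluates.idxAdd {q : Prog} {σ : State F} {v : F} {r s t T : ℕ} (hr : 22 ≤ r)
    (h : q.Evaluates (σ.setIdx r (σ.idx s + σ.idx t)) v T) :
    (Prog.seq (.idxAdd r s t) q).Evaluates σ v (T + 1) := by
  refine Prog.Evaluates.mono (Prog.Run.seq (t := 1) (t' := T)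
    (Q := fun τ => τ = σ.setIdx r (σ.idx s + σ.idx t)) ⟨rfl, le_rfl⟩ ?_) (by omega)
  rintro τ rfl
  exact Prog.Run.weaken h fun υ hυ => ⟨(Scratch.setIdx σ hr _).trans hυ.1, hυ.2⟩

theorem Prog.Evaluates.idxSub {q : Prog} {σ : State F} {v : F} {r s t T : ℕ} (hr : 22 ≤ r)
    (h : q.Evaluates (σ.setIdx r (σ.idx s - σ.idx t)) v T) :
    (Prog.seq (.idxSub r s t) q).Evaluates σ v (T + 1) := by
  refine Prog.Evaluates.mono (Prog.Run.seq (t := 1) (t' := T)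
    (Q := fun τ => τ = σ.setIdx r (σ.idx s - σ.idx t)) ⟨rfl, le_rfl⟩ ?_) (by omega)
  rintro τ rfl
  exact Prog.Run.weaken h fun υ hυ => ⟨(Scratch.setIdx σ hr _).trans hυ.1, hυ.2⟩

/-- Evaluate the polynomial whose coefficients are in the row of register `row` of the array `X` at
the point in column `col` of array 1, by the scheme of Horner. -/
def horner (X row col : ℕ) : Prog :=
  .seq clear (.loop 22 4 (.seq (.idxSub 23 4 22) (.seq (.idxSub 23 23 15)
    (.seq (.add ⟨9, 14, 14⟩ ⟨9, 14, 14⟩ ⟨X, row, 23⟩) (.mul ⟨9, 14, 14⟩ ⟨9, 14, 14⟩ ⟨1, 14, col⟩)))))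

/-- After i passes the accumulator holds the top i coefficients with exponents starting at 1, since
the multiplication follows the addition. A hash entry thus costs O(n) steps, and C² of them stay
within the bound. -/
theorem horner_evaluates {X row col : ℕ} {σ : State F} (hz : σ.idx 14 = 0) (h1 : σ.idx 15 = 1)
    (hX : X ≠ 9) (hr : row < 22) (hc : col < 22) :
    (horner X row col).Evaluates σ (∑ k ∈ Finset.range (σ.idx 4),
      σ.mem X (σ.idx row) k * σ.mem 1 0 (σ.idx col) ^ (k + 1)) (σ.idx 4 * 5 + 2) := by
  set x := σ.mem 1 0 (σ.idx col)
  set n := σ.idx 4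
  refine Prog.Evaluates.mono (Prog.Evaluates.seq (clear_evaluates hz) (t' := n * 5 + 1)
    fun τ hτ hv => ?_) (by omega)
  have hn : τ.idx 4 = n := hτ.1 4 (by norm_num)
  have := Prog.Evaluates.accLoop (p := .seq (.idxSub 23 4 22) (.seq (.idxSub 23 23 15)
    (.seq (.add ⟨9, 14, 14⟩ ⟨9, 14, 14⟩ ⟨X, row, 23⟩) (.mul ⟨9, 14, 14⟩ ⟨9, 14, 14⟩ ⟨1, 14, col⟩))))
    (s := 4) (t := 4) (σ := τ)
    (fun i => ∑ k ∈ Finset.range i, σ.mem X (σ.idx row) (n - i + k) * x ^ (k + 1)) (by simpa using hv)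
    ?_
  · rw [hn] at this
    simpa using this
  intro i hi υ hυ h22 hw
  have hσ := hτ.trans hυ
  have e4 : υ.idx 4 = n := hσ.1 4 (by norm_num)
  have e15 : υ.idx 15 = 1 := by rw [hσ.1 15 (by norm_num), h1]
  refine Prog.Evaluates.idxSub (T := 3) (by norm_num) ?_
  refine Prog.Evaluates.idxSub (T := 2) (by norm_num) ?_
  refine ⟨⟨(Scratch.set _ (x := ⟨9, 14, 14⟩) rfl _).trans (Scratch.set _ rfl _), ?_⟩, le_rfl⟩
  have er : υ.idx row = σ.idx row := hσ.1 row hr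
  have ec : υ.idx col = σ.idx col := hσ.1 col hc
  have e14 : υ.idx 14 = 0 := by rw [hσ.1 14 (by norm_num), hz]
  have m1 : υ.mem 1 = σ.mem 1 := hσ.2 1 (by norm_num)
  have mX : υ.mem X = σ.mem X := hσ.2 X hX
  have hr' : row ≠ 23 := by omega
  have hc' : col ≠ 23 := by omega
  simp only [Prog.exec, State.set_mem, State.get, State.set_idx, State.setIdx_idx, State.setIdx_mem,
    if_neg hr', if_neg hc', er, ec, e14, e4, e15, h22, m1, mX, hw]
  simp only [Nat.reduceEqDiff, if_false, if_true, and_self, false_and, OfNat.one_ne_ofNat]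
  rw [Finset.sum_range_succ', hw, add_mul, Finset.sum_mul, zero_add, pow_one, add_zero]
  congr 1
  refine Finset.sum_congr rfl fun k _ => ?_
  rw [mul_assoc, ← pow_succ]
  congr 2
  omega

/-- The sum of the products of two cells, as register 22 runs up to the value of register `s`. -/
def dot (s : ℕ) (x y : Cell) : Prog := .seq clear (.loop 22 s (mulAdd x y))

theorem dot_evaluates {s : ℕ} {x y : Cell} {σ : State F} (g : ℕ → F) (hz : σ.idx 14 = 0)
    (h1 : σ.idx 15 = 1) (hs : s < 22) (h : ∀ k < σ.idx s, ∀ τ, Scratch σ τ → τ.idx 22 = k →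
      τ.get x * τ.get y = g k) :
    (dot s x y).Evaluates σ (∑ k ∈ Finset.range (σ.idx s), g k) (σ.idx s * 3 + 2) := by
  refine sum_evaluates g hz hs fun k hk τ hτ h22 => ?_
  have := mulAdd_evaluates (σ := τ) (x := x) (y := y) (by rw [hτ.1 14 (by norm_num), hz])
    (by rw [hτ.1 15 (by norm_num), h1])
  rwa [h k hk τ hτ h22] at this

/-- The linear combinations that a node sends. -/
def nodeProg : Prog := .seq (.idxConst 15 1) (fill 3 0 14 2 (dot 1 ⟨0, 20, 22⟩ ⟨1, 22, 21⟩))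

theorem nodeProg_run {k d n : ℕ} {A B : ℕ → ℕ → F} :
    nodeProg.Run (initial k d n A B fun _ _ => 0) (fun τ => ∀ i < k, ∀ j < n,
      τ.mem 3 i j = ∑ l ∈ Finset.range d, A i l * B l j)
      (1 + (k * (n * ((d * 3 + 2) + 4) + 2) + 1)) := by
  refine Prog.Run.seq (Q := fun τ => τ = (initial k d n A B fun _ _ => 0).setIdx 15 1)
    ⟨rfl, le_rfl⟩ ?_
  rintro τ rfl
  set σ := (initial k d n A B fun _ _ => 0).setIdx 15 1 with hσ
  have i0 : σ.idx 0 = k := rfl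
  have i1 : σ.idx 1 = d := rfl
  have i2 : σ.idx 2 = n := rfl
  have i14 : σ.idx 14 = 0 := rfl
  have i15 : σ.idx 15 = 1 := rfl
  have m0 : σ.mem 0 = A := rfl
  have m1 : σ.mem 1 = B := rfl
  have := fill_run (X := 3) (R := 0) (o := 14) (S := 2) (T := d * 3 + 2)
    (p := dot 1 ⟨0, 20, 22⟩ ⟨1, 22, 21⟩) (σ := σ) (fun i j => ∑ l ∈ Finset.range d, A i l * B l j)
    (by norm_num) (by norm_num) (by norm_num) i14 ?_
  · rw [i0, i2, i14] at this
    refine this.weaken ?_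
    rintro τ ⟨-, h⟩ i hi j hj
    rw [h]
    simp [hi, hj]
  · intro i hi j hj τ hτ h20 h21
    have := dot_evaluates (s := 1) (x := ⟨0, 20, 22⟩) (y := ⟨1, 22, 21⟩) (σ := τ)
      (fun l => A i l * B l j) (by rw [hτ.1 14 (by norm_num), i14])
      (by rw [hτ.1 15 (by norm_num), i15]) (by norm_num) ?_
    · rwa [hτ.1 1 (by norm_num), i1] at this
    · intro l _ υ hυ h22
      simp only [State.get]
      rw [hυ.2 0 (by norm_num), hυ.2 1 (by norm_num), hτ.2 0 (by norm_num) (by norm_num),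
        hτ.2 1 (by norm_num) (by norm_num), h22, hυ.1 20 (by norm_num), hυ.1 21 (by norm_num),
        h20, h21, m0, m1]

theorem nodeProg_complexity : NodeComplexity nodeProg 8 := by
  intro F _ _ k d n U Y
  refine ⟨fun i j => ?_, nodeProg_run.2.trans ?_⟩
  · rw [nodeProg_run.1 i i.2 j j.2, Finset.sum_range, Matrix.mul_apply]
    exact Finset.sum_congr rfl fun l _ => by rw [store_apply, store_apply]
  · have : 8 * (k + 1) * (d + 1) * (n + 1) = (1 + (k * (n * ((d * 3 + 2) + 4) + 2) + 1)) +
        (5 * (k * d * n) + 2 * (k * n) + 8 * (k * d) + 6 * k + 8 * (d * n) + 8 * d + 8 * n + 6) := by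
      ring
    omega

end Programs

end RandomSecret
namespace RandomSecret

/-! ## The decoder program -/

section Decoder

variable {F : Type*} [Field F] [DecidableEq F]

/-- The dimensions of the linear system of the decoder. -/
def decoderSetup : Prog :=
  .seq (.idxConst 15 1) (.seq (.idxAdd 3 0 2) (.seq (.idxAdd 4 3 1) (.seq (.idxAdd 10 0 14)
    (.seq (.idxAdd 11 0 14) (.seq (.idxAdd 12 0 1) (.seq (.idxAdd 16 4 14) (.idxAdd 13 12 16)))))))

/-- The entry of the discrepancy in row 20 and column 21. -/
def discrepancyEntry : Prog :=
  .seq (horner 0 20 21) (.loop 22 1 (.seq (.idxAdd 23 3 22) (mulSub ⟨0, 20, 23⟩ ⟨2, 22, 21⟩)))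

theorem discrepancyEntry_evaluates {σ : State F} (hz : σ.idx 14 = 0) (h1 : σ.idx 15 = 1) :
    discrepancyEntry.Evaluates σ
      (∑ k ∈ Finset.range (σ.idx 4), σ.mem 0 (σ.idx 20) k * σ.mem 1 0 (σ.idx 21) ^ (k + 1) -
        ∑ k ∈ Finset.range (σ.idx 1), σ.mem 0 (σ.idx 20) (σ.idx 3 + k) * σ.mem 2 k (σ.idx 21))
      (σ.idx 4 * 5 + 2 + (σ.idx 1 * 4 + 1)) := by
  refine Prog.Evaluates.seq (horner_evaluates hz h1 (by norm_num) (by norm_num) (by norm_num))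
    fun τ hτ hv => ?_
  have := accumulate_evaluates (s := 1) (p := .seq (.idxAdd 23 3 22)
      (mulSub ⟨0, 20, 23⟩ ⟨2, 22, 21⟩)) (t := 3) (σ := τ) _
    (fun k => -(σ.mem 0 (σ.idx 20) (σ.idx 3 + k) * σ.mem 2 k (σ.idx 21))) hv ?_
  · rwa [hτ.1 1 (by norm_num), Finset.sum_neg_distrib, ← sub_eq_add_neg] at this
  · intro k _ υ hυ h22
    have hσ := hτ.trans hυ
    refine Prog.Evaluates.idxAdd (T := 2) (by norm_num) ?_
    have := mulSub_evaluates (σ := υ.setIdx 23 (υ.idx 3 + υ.idx 22)) (x := ⟨0, 20, 23⟩)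
      (y := ⟨2, 22, 21⟩) (by simpa [hσ.1 14 (by norm_num)] using hz)
      (by simpa [hσ.1 15 (by norm_num)] using h1)
    simpa [State.get, hσ.1 20 (by norm_num), hσ.1 21 (by norm_num), hσ.1 3 (by norm_num), h22,
      hσ.2 0 (by norm_num), hσ.2 2 (by norm_num), sub_eq_add_neg] using this

/-- The sum of the products of the entries of two columns of the solver, which gives an entry of
the solution. -/
def decodedEntry : Prog :=
  .seq clear (.loop 22 10 (.seq (.idxAdd 23 0 20) (.seq (.idxAdd 24 12 0) (.seq (.idxAdd 24 24 21)
    (mulAdd ⟨4, 22, 23⟩ ⟨4, 22, 24⟩)))))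

theorem decodedEntry_evaluates {σ : State F} (hz : σ.idx 14 = 0) (h1 : σ.idx 15 = 1) :
    decodedEntry.Evaluates σ (∑ i ∈ Finset.range (σ.idx 10), σ.mem 4 i (σ.idx 0 + σ.idx 20) *
      σ.mem 4 i (σ.idx 12 + (σ.idx 0 + σ.idx 21))) (σ.idx 10 * 6 + 2) := by
  refine sum_evaluates _ hz (by norm_num) fun k _ τ hτ h22 => ?_
  refine Prog.Evaluates.idxAdd (T := 4) (by norm_num) ?_
  refine Prog.Evaluates.idxAdd (T := 3) (by norm_num) ?_
  refine Prog.Evaluates.idxAdd (T := 2) (by norm_num) ?_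
  have := mulAdd_evaluates (σ := ((τ.setIdx 23 (σ.idx 0 + σ.idx 20)).setIdx 24
      (σ.idx 12 + σ.idx 0)).setIdx 24 (σ.idx 12 + σ.idx 0 + σ.idx 21)) (x := ⟨4, 22, 23⟩)
      (y := ⟨4, 22, 24⟩) (by simpa [hτ.1 14 (by norm_num)] using hz)
      (by simpa [hτ.1 15 (by norm_num)] using h1)
  simpa [State.get, hτ.1 20 (by norm_num), hτ.1 21 (by norm_num), hτ.1 0 (by norm_num), h22,
      hτ.1 12 (by norm_num), hτ.2 4 (by norm_num), add_assoc] using this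

/-- Bob's decoder. -/
def decoderProg : Prog :=
  .seq decoderSetup (.seq (fill 4 0 14 0 discrepancyEntry) (.seq
    (fill 4 0 0 1 (.seq (.idxAdd 23 3 21) (load ⟨0, 20, 23⟩))) (.seq
    (fill 4 0 12 4 (load ⟨0, 20, 21⟩)) (.seq solve
    (.ifZero ⟨5, 14, 14⟩ (fill 3 1 14 2 decodedEntry) skip)))))

/-- The three fills lay out [D T̂ | Y] in array 4; the unknowns from C on form X, and those before
it are auxiliary. Only the right-hand sides C + l are read off, as they give the message columns. On
failure array 3 keeps its initial zeros, which is Bob's default output. -/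
theorem decoderProg_run {C b m : ℕ} {Y R H : ℕ → ℕ → F} :
    decoderProg.Run (initial C b m Y R H) (fun τ => ∃ A₀ A fl,
      Solved C C (C + b) (C + m + b) A₀ A fl ∧
      (∀ i < C, ∀ j < C, A₀ i j = ∑ k ∈ Finset.range (C + m + b), Y i k * R 0 j ^ (k + 1) -
        ∑ k ∈ Finset.range b, Y i (C + m + k) * H k j) ∧
      (∀ i < C, ∀ k < b, A₀ i (C + k) = Y i (C + m + k)) ∧
      (∀ i < C, ∀ l < C + m + b, A₀ i (C + b + l) = Y i l) ∧
      ∀ k < b, ∀ l < m, τ.mem 3 k l = if fl = 0 then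
        ∑ i ∈ Finset.range C, A i (C + k) * A i (C + b + (C + l)) else 0)
      (8 + ((C * (C * (((C + m + b) * 5 + 2 + (b * 4 + 1)) + 4) + 2) + 1) +
        ((C * (b * (3 + 4) + 2) + 1) + ((C * ((C + m + b) * (2 + 4) + 2) + 1) +
        (((C + b) * (C * (16 * (C + b + (C + m + b)) + 8) + 7) + 1 +
          (C * ((C + m + b) * 4 + 3) + 1)) + (b * (m * ((C * 6 + 2) + 4) + 2) + 1 + 1)))))) := by
  refine Prog.Run.seq (Q := fun σ => σ.mem = (initial C b m Y R H).mem ∧ σ.idx 0 = C ∧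
    σ.idx 1 = b ∧ σ.idx 2 = m ∧ σ.idx 3 = C + m ∧ σ.idx 4 = C + m + b ∧ σ.idx 10 = C ∧
    σ.idx 11 = C ∧ σ.idx 12 = C + b ∧ σ.idx 13 = C + b + (C + m + b) ∧ σ.idx 14 = 0 ∧
    σ.idx 15 = 1 ∧ σ.idx 16 = C + m + b) ⟨by simp [decoderSetup, Prog.exec, initial], le_rfl⟩ ?_
  rintro σ ⟨hm, i0, i1, i2, i3, i4, i10, i11, i12, i13, i14, i15, i16⟩
  have m0 : σ.mem 0 = Y := by rw [hm]; rfl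
  have m1 : σ.mem 1 = R := by rw [hm]; rfl
  have m2 : σ.mem 2 = H := by rw [hm]; rfl
  have m3 : ∀ i j, σ.mem 3 i j = 0 := by rw [hm]; intro i j; rfl
  have m5 : σ.mem 5 0 0 = 0 := by rw [hm]; rfl
  have m6 : ∀ i, σ.mem 6 0 i = 0 := by rw [hm]; intro i; rfl
  refine Prog.Run.seq (Prog.Run.mono (fill_run (X := 4) (R := 0) (o := 14) (S := 0)
    (T := (C + m + b) * 5 + 2 + (b * 4 + 1))
    (fun i j => ∑ k ∈ Finset.range (C + m + b), Y i k * R 0 j ^ (k + 1) -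
        ∑ k ∈ Finset.range b, Y i (C + m + k) * H k j) (by norm_num) (by norm_num) (by norm_num)
      i14 ?_) (fun _ => id) (by rw [i0])) ?_
  · intro i _ j _ τ hτ h20 h21
    have := discrepancyEntry_evaluates (σ := τ) (by rw [hτ.1 14 (by norm_num), i14])
      (by rw [hτ.1 15 (by norm_num), i15])
    rwa [h20, h21, hτ.1 1 (by norm_num), hτ.1 3 (by norm_num), hτ.1 4 (by norm_num), i1, i3, i4,
      hτ.2 0 (by norm_num) (by norm_num), hτ.2 1 (by norm_num) (by norm_num),
      hτ.2 2 (by norm_num) (by norm_num), m0, m1, m2] at this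
  rintro σ₁ ⟨hσ₁, v₁⟩
  refine Prog.Run.seq (Prog.Run.mono (fill_run (X := 4) (R := 0) (o := 0) (S := 1)
    (T := 3) (fun i j => Y i (C + m + j)) (by norm_num) (by norm_num) (by norm_num)
      (by rw [hσ₁.1 14 (by norm_num), i14]) ?_) (fun _ => id)
      (by rw [hσ₁.1 0 (by norm_num), hσ₁.1 1 (by norm_num), i0, i1])) ?_
  · intro i _ j _ τ hτ' h20 h21
    have hτ := hσ₁.trans hτ'
    refine Prog.Evaluates.idxAdd (T := 2) (by norm_num) ?_
    have := load_evaluates (σ := τ.setIdx 23 (τ.idx 3 + τ.idx 21)) (x := ⟨0, 20, 23⟩)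
      (by simpa [hτ.1 14 (by norm_num)] using i14) (by norm_num)
    simpa [State.get, h20, h21, hτ.1 3 (by norm_num), i3, hτ.2 0 (by norm_num) (by norm_num), m0]
      using this
  rintro σ₂ ⟨hσ₂, v₂⟩
  rw [hσ₁.1 0 (by norm_num), hσ₁.1 1 (by norm_num), i0, i1] at v₂
  replace hσ₂ := hσ₁.trans hσ₂
  refine Prog.Run.seq (Prog.Run.mono (fill_run (X := 4) (R := 0) (o := 12) (S := 4)
    (T := 2) (fun i j => Y i j) (by norm_num) (by norm_num) (by norm_num)
      (by rw [hσ₂.1 14 (by norm_num), i14]) ?_) (fun _ => id)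
      (by rw [hσ₂.1 0 (by norm_num), hσ₂.1 4 (by norm_num), i0, i4])) ?_
  · intro i _ j _ τ hτ' h20 h21
    have hτ := hσ₂.trans hτ'
    have := load_evaluates (σ := τ) (x := ⟨0, 20, 21⟩)
      (by rw [hτ.1 14 (by norm_num), i14]) (by norm_num)
    rwa [State.get, h20, h21, hτ.2 0 (by norm_num) (by norm_num), m0] at this
  rintro σ₃ ⟨hσ₃, v₃⟩
  rw [hσ₂.1 0 (by norm_num), hσ₂.1 12 (by norm_num), hσ₂.1 4 (by norm_num), i0, i12, i4] at v₃
  replace hσ₃ := hσ₂.trans hσ₃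
  have hs := solve_run (σ := σ₃) (by rw [hσ₃.1 14 (by norm_num), i14])
    (by rw [hσ₃.1 13 (by norm_num), hσ₃.1 12 (by norm_num), hσ₃.1 16 (by norm_num), i12, i13, i16])
    (by rw [hσ₃.2 6 (by norm_num) (by norm_num)]; exact m6)
    (by rw [hσ₃.2 5 (by norm_num) (by norm_num)]; exact m5)
  rw [hσ₃.1 10 (by norm_num), hσ₃.1 11 (by norm_num), hσ₃.1 12 (by norm_num),
    hσ₃.1 13 (by norm_num), hσ₃.1 16 (by norm_num), i10, i11, i12, i13, i16] at hs
  refine hs.seq ?_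
  rintro σ₄ ⟨hσ₄, hS⟩
  have j14 : σ₄.idx 14 = 0 := by rw [hσ₄.1 14 (by norm_num), hσ₃.1 14 (by norm_num), i14]
  have h3 : σ₄.mem 3 = σ.mem 3 := by
    rw [hσ₄.2 3 (by norm_num) (by norm_num) (by norm_num) (by norm_num) (by norm_num),
      hσ₃.2 3 (by norm_num) (by norm_num)]
  have hA : (∀ i < C, ∀ j < C, σ₃.mem 4 i j =
        ∑ k ∈ Finset.range (C + m + b), Y i k * R 0 j ^ (k + 1) -
        ∑ k ∈ Finset.range b, Y i (C + m + k) * H k j) ∧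
      (∀ i < C, ∀ k < b, σ₃.mem 4 i (C + k) = Y i (C + m + k)) ∧
      (∀ i < C, ∀ l < C + m + b, σ₃.mem 4 i (C + b + l) = Y i l) := by
    refine ⟨fun i hi j hj => ?_, fun i hi k hk => ?_, fun i hi l hl => ?_⟩
    · rw [v₃, if_neg (by omega), v₂, if_neg (by omega), v₁, if_pos (by omega), i14, Nat.sub_zero]
    · rw [v₃, if_neg (by omega), v₂, if_pos (by omega), Nat.add_sub_cancel_left]
    · rw [v₃, if_pos (by omega), Nat.add_sub_cancel_left]
  refine Prog.Run.ifZero (fun hf => ?_) (fun hf => ?_)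
  · have hf' : σ₄.mem 5 0 0 = 0 := by simpa [State.get, j14] using hf
    refine Prog.Run.mono (fill_run (X := 3) (R := 1) (o := 14) (S := 2) (T := C * 6 + 2)
      (fun k l => ∑ i ∈ Finset.range C, σ₄.mem 4 i (C + k) * σ₄.mem 4 i (C + b + (C + l)))
      (by norm_num) (by norm_num) (by norm_num) j14 ?_) ?_
      (by rw [hσ₄.1 1 (by norm_num), hσ₄.1 2 (by norm_num), hσ₃.1 1 (by norm_num),
        hσ₃.1 2 (by norm_num), i1, i2])
    · intro k _ l _ τ hτ h20 h21
      have e : ∀ r < 18, τ.idx r = σ.idx r := fun r hr => by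
        rw [hτ.1 r (by omega), hσ₄.1 r hr, hσ₃.1 r (by omega)]
      have := decodedEntry_evaluates (σ := τ) (by rw [e 14 (by norm_num), i14])
        (by rw [e 15 (by norm_num), i15])
      rwa [e 10 (by norm_num), e 0 (by norm_num), e 12 (by norm_num), h20, h21, i10, i0, i12,
        hτ.2 4 (by norm_num) (by norm_num)] at this
    · rintro τ ⟨-, hv⟩
      refine ⟨σ₃.mem 4, σ₄.mem 4, σ₄.mem 5 0 0, hS, hA.1, hA.2.1, hA.2.2, fun k hk l hl => ?_⟩
      rw [hv, hσ₄.1 1 (by norm_num), hσ₄.1 2 (by norm_num), hσ₃.1 1 (by norm_num),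
        hσ₃.1 2 (by norm_num), i1, i2, j14, if_pos (by omega), if_pos hf', Nat.sub_zero]
  · have hf' : σ₄.mem 5 0 0 ≠ 0 := by simpa [State.get, j14] using hf
    refine Prog.Run.mono (t := 1) ⟨⟨σ₃.mem 4, σ₄.mem 4, σ₄.mem 5 0 0, hS, hA.1, hA.2.1, hA.2.2,
      fun k _ l _ => ?_⟩, le_rfl⟩ (fun _ => id) (by omega)
    rw [if_neg hf']
    simpa [skip, Prog.exec, h3] using m3 k l

end Decoder

end RandomSecret
namespace RandomSecret

/-! ## The encoder program -/

section Encoder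

variable {F : Type*} [Field F] [DecidableEq F]

/-- The dimensions of the linear system of the encoder. -/
def encoderSetup : Prog :=
  .seq (.idxConst 15 1) (.seq (.idxAdd 3 0 2) (.seq (.idxAdd 4 3 1) (.seq (.idxAdd 10 0 14)
    (.seq (.idxAdd 12 0 14) (.seq (.idxAdd 16 1 14) (.idxAdd 13 12 16))))))

/-- The entry of the identity matrix in row 20 and column 21. -/
def identityEntry : Prog :=
  .seq clear (.ifLt 20 21 skip (.ifLt 21 20 skip (.one ⟨9, 14, 14⟩)))

theorem identityEntry_evaluates {σ : State F} (hz : σ.idx 14 = 0) :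
    identityEntry.Evaluates σ (if σ.idx 20 = σ.idx 21 then 1 else 0) 4 := by
  refine Prog.Evaluates.seq (clear_evaluates hz) (t' := 3) fun τ hτ hv => ?_
  have e20 : τ.idx 20 = σ.idx 20 := hτ.1 20 (by norm_num)
  have e21 : τ.idx 21 = σ.idx 21 := hτ.1 21 (by norm_num)
  refine Prog.Run.ifLt (t := 2) (fun h => ?_) fun h => Prog.Run.ifLt (t := 1) (fun h' => ?_)
    fun h' => ?_
  · rw [if_neg (by omega)]
    exact ⟨⟨Scratch.setIdx τ le_rfl 0, hv⟩, by simp [skip, Prog.exec]⟩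
  · rw [if_neg (by omega)]
    exact ⟨⟨Scratch.setIdx τ le_rfl 0, hv⟩, le_rfl⟩
  · rw [if_pos (by omega)]
    refine ⟨⟨Scratch.set τ rfl 1, ?_⟩, le_rfl⟩
    simp [Prog.exec, State.set_mem, hτ.1 14 (by norm_num), hz]

/-- The power of the parity symbol of row 20 whose exponent exceeds the column 21 by one. -/
def powerEntry : Prog :=
  .seq (.one ⟨9, 14, 14⟩) (.seq (.idxAdd 23 21 15)
    (.loop 22 23 (.mul ⟨9, 14, 14⟩ ⟨9, 14, 14⟩ ⟨1, 14, 20⟩)))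

/-- Each power is computed afresh, in O(C) steps. The C² entries cost O(C³), which is affordable
because C ≤ n. -/
theorem powerEntry_evaluates {σ : State F} (hz : σ.idx 14 = 0) (h1 : σ.idx 15 = 1) :
    powerEntry.Evaluates σ (σ.mem 1 0 (σ.idx 20) ^ (σ.idx 21 + 1)) (σ.idx 21 * 2 + 5) := by
  have h := Prog.Evaluates.seq (p := .one ⟨9, 14, 14⟩) (q := .seq (.idxAdd 23 21 15)
    (.loop 22 23 (.mul ⟨9, 14, 14⟩ ⟨9, 14, 14⟩ ⟨1, 14, 20⟩))) (σ := σ) (u := 1) (t := 1)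
    (t' := (σ.idx 21 + 1) * 2 + 1 + 1) (v := σ.mem 1 0 (σ.idx 20) ^ (σ.idx 21 + 1))
    ⟨⟨Scratch.set σ rfl 1, by simp [Prog.exec, State.set_mem, hz]⟩, le_rfl⟩ ?_
  · exact h.mono (by omega)
  intro τ hτ hv
  refine Prog.Evaluates.idxAdd (by norm_num) ?_
  have hτ' := hτ.trans (Scratch.setIdx τ (r := 23) (by norm_num) (τ.idx 21 + τ.idx 15))
  have e : (τ.setIdx 23 (τ.idx 21 + τ.idx 15)).idx 23 = σ.idx 21 + 1 := by
    simp [hτ.1 21 (by norm_num), hτ.1 15 (by norm_num), h1]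
  have := Prog.Evaluates.accLoop (p := .mul ⟨9, 14, 14⟩ ⟨9, 14, 14⟩ ⟨1, 14, 20⟩) (s := 23) (t := 1)
    (σ := τ.setIdx 23 (τ.idx 21 + τ.idx 15)) (fun k => σ.mem 1 0 (σ.idx 20) ^ k)
    (by simpa using hv) ?_
  · rwa [e] at this
  intro k _ υ hυ _ hw
  have hσ := hτ'.trans hυ
  refine ⟨⟨Scratch.set υ rfl _, ?_⟩, le_rfl⟩
  simp [Prog.exec, State.set_mem, State.get, hσ.1 14 (by norm_num), hσ.1 20 (by norm_num), hz, hw,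
    hσ.2 1 (by norm_num), pow_succ]

/-- The hash in row 21 and column 20, less what the message and the identity matrix contribute. -/
def residualEntry : Prog :=
  .seq (horner 3 21 20) (.sub ⟨9, 14, 14⟩ ⟨2, 21, 20⟩ ⟨9, 14, 14⟩)

theorem residualEntry_evaluates {σ : State F} (hz : σ.idx 14 = 0) (h1 : σ.idx 15 = 1) :
    residualEntry.Evaluates σ (σ.mem 2 (σ.idx 21) (σ.idx 20) -
      ∑ k ∈ Finset.range (σ.idx 4), σ.mem 3 (σ.idx 21) k * σ.mem 1 0 (σ.idx 20) ^ (k + 1))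
      (σ.idx 4 * 5 + 2 + 1) := by
  refine Prog.Evaluates.seq (horner_evaluates hz h1 (by norm_num) (by norm_num) (by norm_num))
    fun τ hτ hv => ⟨⟨Scratch.set τ rfl _, ?_⟩, le_rfl⟩
  simp [Prog.exec, State.set_mem, State.get, hτ.1 14 (by norm_num), hτ.1 20 (by norm_num),
    hτ.1 21 (by norm_num), hz, hv, hτ.2 2 (by norm_num)]

/-- The sum of the products of the entries of two columns of the solver, which gives an entry of
Alice's block. -/
def tweakEntry : Prog :=
  .seq clear (.loop 22 10 (.seq (.idxAdd 23 0 20) (mulAdd ⟨4, 22, 21⟩ ⟨4, 22, 23⟩)))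

theorem tweakEntry_evaluates {σ : State F} (hz : σ.idx 14 = 0) (h1 : σ.idx 15 = 1) :
    tweakEntry.Evaluates σ (∑ i ∈ Finset.range (σ.idx 10), σ.mem 4 i (σ.idx 21) *
      σ.mem 4 i (σ.idx 0 + σ.idx 20)) (σ.idx 10 * 4 + 2) := by
  refine sum_evaluates _ hz (by norm_num) fun k _ τ hτ h22 => ?_
  refine Prog.Evaluates.idxAdd (T := 2) (by norm_num) ?_
  have := mulAdd_evaluates (σ := τ.setIdx 23 (σ.idx 0 + σ.idx 20)) (x := ⟨4, 22, 21⟩)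
      (y := ⟨4, 22, 23⟩) (by simpa [hτ.1 14 (by norm_num)] using hz)
      (by simpa [hτ.1 15 (by norm_num)] using h1)
  simpa [State.get, hτ.1 20 (by norm_num), hτ.1 21 (by norm_num), hτ.1 0 (by norm_num), h22,
      hτ.2 4 (by norm_num)] using this

/-- Alice's encoder. -/
def encoderProg : Prog :=
  .seq encoderSetup (.seq (fill 3 1 0 2 (load ⟨0, 20, 21⟩)) (.seq (fill 3 1 3 1 identityEntry)
    (.seq (fill 4 0 14 0 powerEntry) (.seq (fill 4 0 0 1 residualEntry) (.seq solve
    (.ifZero ⟨5, 14, 14⟩ (fill 3 1 14 0 tweakEntry) skip))))))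

/-- Array 3 first holds [0 M I], from which the right-hand side H - [0 M I]P is computed. Its first
C columns are overwritten with L only on success, so failure leaves the default L = 0. The system is
transposed: the unknowns are the entries of a row of L. -/
theorem encoderProg_run {C b m : ℕ} {M R H : ℕ → ℕ → F} :
    encoderProg.Run (initial C b m M R H) (fun τ => ∃ (X A₀ A : ℕ → ℕ → F) (fl : F),
      Solved C 0 C b A₀ A fl ∧
      (∀ i < b, ∀ k < C, X i k = 0) ∧ (∀ i < b, ∀ k < m, X i (C + k) = M i k) ∧
      (∀ i < b, ∀ k < b, X i (C + m + k) = if i = k then 1 else 0) ∧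
      (∀ j < C, ∀ k < C, A₀ j k = R 0 j ^ (k + 1)) ∧
      (∀ j < C, ∀ i < b, A₀ j (C + i) = H i j -
        ∑ k ∈ Finset.range (C + m + b), X i k * R 0 j ^ (k + 1)) ∧
      ∀ i < b, ∀ k < C + m + b, τ.mem 3 i k = if fl = 0 ∧ k < C then
        ∑ j ∈ Finset.range C, A j k * A j (C + i) else X i k)
      (7 + ((b * (m * (2 + 4) + 2) + 1) + ((b * (b * (4 + 4) + 2) + 1) +
        ((C * (C * ((C * 2 + 5) + 4) + 2) + 1) +
        ((C * (b * (((C + m + b) * 5 + 2 + 1) + 4) + 2) + 1) +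
        ((C * (C * (16 * (C + b) + 8) + 7) + 1 + (C * (b * 4 + 3) + 1)) +
          (b * (C * ((C * 4 + 2) + 4) + 2) + 1 + 1))))))) := by
  refine Prog.Run.seq (Q := fun σ => σ.mem = (initial C b m M R H).mem ∧ σ.idx 0 = C ∧
    σ.idx 1 = b ∧ σ.idx 2 = m ∧ σ.idx 3 = C + m ∧ σ.idx 4 = C + m + b ∧ σ.idx 10 = C ∧
    σ.idx 11 = 0 ∧ σ.idx 12 = C ∧ σ.idx 13 = C + b ∧ σ.idx 14 = 0 ∧
    σ.idx 15 = 1 ∧ σ.idx 16 = b) ⟨by simp [encoderSetup, Prog.exec, initial], le_rfl⟩ ?_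
  rintro σ ⟨hm, i0, i1, i2, i3, i4, i10, i11, i12, i13, i14, i15, i16⟩
  have m0 : σ.mem 0 = M := by rw [hm]; rfl
  have m1 : σ.mem 1 = R := by rw [hm]; rfl
  have m2 : σ.mem 2 = H := by rw [hm]; rfl
  have m3 : ∀ i j, σ.mem 3 i j = 0 := by rw [hm]; intro i j; rfl
  have m5 : σ.mem 5 0 0 = 0 := by rw [hm]; rfl
  have m6 : ∀ i, σ.mem 6 0 i = 0 := by rw [hm]; intro i; rfl
  refine Prog.Run.seq (Prog.Run.mono (fill_run (X := 3) (R := 1) (o := 0) (S := 2) (T := 2)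
    (fun i j => M i j) (by norm_num) (by norm_num) (by norm_num)
      i14 ?_) (fun _ => id) (by rw [i1, i2])) ?_
  · intro i _ j _ τ hτ h20 h21
    have := load_evaluates (σ := τ) (x := ⟨0, 20, 21⟩)
      (by rw [hτ.1 14 (by norm_num), i14]) (by norm_num)
    rwa [State.get, h20, h21, hτ.2 0 (by norm_num) (by norm_num), m0] at this
  rintro σ₁ ⟨hσ₁, v₁⟩
  rw [i0, i1, i2] at v₁
  refine Prog.Run.seq (Prog.Run.mono (fill_run (X := 3) (R := 1) (o := 3) (S := 1)
    (T := 4) (fun i j => if i = j then 1 else 0) (by norm_num) (by norm_num) (by norm_num)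
      (by rw [hσ₁.1 14 (by norm_num), i14]) ?_) (fun _ => id)
      (by rw [hσ₁.1 1 (by norm_num), i1])) ?_
  · intro i _ j _ τ hτ' h20 h21
    have hτ := hσ₁.trans hτ'
    have := identityEntry_evaluates (σ := τ) (by rw [hτ.1 14 (by norm_num), i14])
    rwa [h20, h21] at this
  rintro σ₂ ⟨hσ₂, v₂⟩
  rw [hσ₁.1 3 (by norm_num), hσ₁.1 1 (by norm_num), i3, i1] at v₂
  replace hσ₂ := hσ₁.trans hσ₂
  refine Prog.Run.seq (Prog.Run.mono (fill_run (X := 4) (R := 0) (o := 14) (S := 0)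
    (T := C * 2 + 5) (fun i j => R 0 i ^ (j + 1)) (by norm_num) (by norm_num) (by norm_num)
      (by rw [hσ₂.1 14 (by norm_num), i14]) ?_) (fun _ => id)
      (by rw [hσ₂.1 0 (by norm_num), i0])) ?_
  · intro i _ j hj τ hτ h20 h21
    rw [hσ₂.1 0 (by norm_num), i0] at hj
    have := powerEntry_evaluates (σ := τ) (by rw [hτ.1 14 (by norm_num), hσ₂.1 14 (by norm_num), i14])
      (by rw [hτ.1 15 (by norm_num), hσ₂.1 15 (by norm_num), i15])
    rw [h20, h21, hτ.2 1 (by norm_num) (by norm_num), hσ₂.2 1 (by norm_num) (by norm_num), m1]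
      at this
    exact this.mono (by omega)
  rintro σ₃ ⟨hσ₃, v₃⟩
  rw [hσ₂.1 0 (by norm_num), hσ₂.1 14 (by norm_num), i0, i14] at v₃
  have k₃ : ∀ r < 20, σ₃.idx r = σ.idx r := fun r hr => by rw [hσ₃.1 r hr, hσ₂.1 r hr]
  have m₃ : ∀ n, n ≠ 3 → n ≠ 4 → n ≠ 9 → σ₃.mem n = σ.mem n := fun n h h' h'' => by
    rw [hσ₃.2 n h' h'', hσ₂.2 n h h'']
  have x₃ : σ₃.mem 3 = σ₂.mem 3 := hσ₃.2 3 (by norm_num) (by norm_num)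
  refine Prog.Run.seq (Prog.Run.mono (fill_run (X := 4) (R := 0) (o := 0) (S := 1)
    (T := (C + m + b) * 5 + 2 + 1) (fun j i => H i j -
      ∑ k ∈ Finset.range (C + m + b), σ₂.mem 3 i k * R 0 j ^ (k + 1))
      (by norm_num) (by norm_num) (by norm_num)
      (by rw [k₃ 14 (by norm_num), i14]) ?_) (fun _ => id)
      (by rw [k₃ 0 (by norm_num), k₃ 1 (by norm_num), i0, i1])) ?_
  · intro j _ i _ τ hτ h20 h21
    have := residualEntry_evaluates (σ := τ) (by rw [hτ.1 14 (by norm_num), k₃ 14 (by norm_num), i14])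
      (by rw [hτ.1 15 (by norm_num), k₃ 15 (by norm_num), i15])
    rwa [h20, h21, hτ.1 4 (by norm_num), k₃ 4 (by norm_num), i4,
      hτ.2 1 (by norm_num) (by norm_num), hτ.2 2 (by norm_num) (by norm_num),
      hτ.2 3 (by norm_num) (by norm_num), m₃ 1 (by norm_num) (by norm_num) (by norm_num),
      m₃ 2 (by norm_num) (by norm_num) (by norm_num), m1, m2, x₃] at this
  rintro σ₄ ⟨hσ₄, v₄⟩
  rw [k₃ 0 (by norm_num), k₃ 1 (by norm_num), i0, i1] at v₄
  have k₄ : ∀ r < 20, σ₄.idx r = σ.idx r := fun r hr => by rw [hσ₄.1 r hr, k₃ r hr]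
  have m₄ : ∀ n, n ≠ 3 → n ≠ 4 → n ≠ 9 → σ₄.mem n = σ.mem n := fun n h h' h'' => by
    rw [hσ₄.2 n h' h'', m₃ n h h' h'']
  have x₄ : σ₄.mem 3 = σ₂.mem 3 := by rw [hσ₄.2 3 (by norm_num) (by norm_num), x₃]
  have hs := solve_run (σ := σ₄) (by rw [k₄ 14 (by norm_num), i14])
    (by rw [k₄ 13 (by norm_num), k₄ 12 (by norm_num), k₄ 16 (by norm_num), i12, i13, i16])
    (by rw [m₄ 6 (by norm_num) (by norm_num) (by norm_num)]; exact m6)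
    (by rw [m₄ 5 (by norm_num) (by norm_num) (by norm_num)]; exact m5)
  rw [k₄ 10 (by norm_num), k₄ 11 (by norm_num), k₄ 12 (by norm_num),
    k₄ 13 (by norm_num), k₄ 16 (by norm_num), i10, i11, i12, i13, i16] at hs
  refine hs.seq ?_
  rintro σ₅ ⟨hσ₅, hS⟩
  have k₅ : ∀ r < 18, σ₅.idx r = σ.idx r := fun r hr => by rw [hσ₅.1 r hr, k₄ r (by omega)]
  have j14 : σ₅.idx 14 = 0 := by rw [k₅ 14 (by norm_num), i14]
  have x₅ : σ₅.mem 3 = σ₂.mem 3 := by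
    rw [hσ₅.2 3 (by norm_num) (by norm_num) (by norm_num) (by norm_num) (by norm_num), x₄]
  have hA : (∀ i < b, ∀ k < C, σ₂.mem 3 i k = 0) ∧ (∀ i < b, ∀ k < m, σ₂.mem 3 i (C + k) = M i k) ∧
      (∀ i < b, ∀ k < b, σ₂.mem 3 i (C + m + k) = if i = k then 1 else 0) ∧
      (∀ j < C, ∀ k < C, σ₄.mem 4 j k = R 0 j ^ (k + 1)) ∧
      (∀ j < C, ∀ i < b, σ₄.mem 4 j (C + i) = H i j -
        ∑ k ∈ Finset.range (C + m + b), σ₂.mem 3 i k * R 0 j ^ (k + 1)) := by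
    refine ⟨fun i hi k hk => ?_, fun i hi k hk => ?_, fun i hi k hk => ?_, fun j hj k hk => ?_,
      fun j hj i hi => ?_⟩
    · rw [v₂, if_neg (by omega), v₁, if_neg (by omega), m3]
    · rw [v₂, if_neg (by omega), v₁, if_pos (by omega), Nat.add_sub_cancel_left]
    · rw [v₂, if_pos (by omega), Nat.add_sub_cancel_left]
    · rw [v₄, if_neg (by omega), v₃, if_pos (by omega), Nat.sub_zero]
    · rw [v₄, if_pos (by omega), Nat.add_sub_cancel_left]
  refine Prog.Run.ifZero (fun hf => ?_) (fun hf => ?_)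
  · have hf' : σ₅.mem 5 0 0 = 0 := by simpa [State.get, j14] using hf
    refine Prog.Run.mono (fill_run (X := 3) (R := 1) (o := 14) (S := 0) (T := C * 4 + 2)
      (fun i k => ∑ j ∈ Finset.range C, σ₅.mem 4 j k * σ₅.mem 4 j (C + i))
      (by norm_num) (by norm_num) (by norm_num) j14 ?_) ?_
      (by rw [k₅ 1 (by norm_num), k₅ 0 (by norm_num), i1, i0])
    · intro i _ k _ τ hτ h20 h21
      have e : ∀ r < 18, τ.idx r = σ.idx r := fun r hr => by
        rw [hτ.1 r (by omega), k₅ r hr]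
      have := tweakEntry_evaluates (σ := τ) (by rw [e 14 (by norm_num), i14])
        (by rw [e 15 (by norm_num), i15])
      rwa [e 10 (by norm_num), e 0 (by norm_num), h20, h21, i10, i0,
        hτ.2 4 (by norm_num) (by norm_num)] at this
    · rintro τ ⟨-, hv⟩
      refine ⟨σ₂.mem 3, σ₄.mem 4, σ₅.mem 4, σ₅.mem 5 0 0, hS, hA.1, hA.2.1, hA.2.2.1, hA.2.2.2.1,
        hA.2.2.2.2, fun i hi k hk => ?_⟩
      rw [hv, k₅ 1 (by norm_num), k₅ 0 (by norm_num), i1, i0, j14, x₅, Nat.sub_zero]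
      congr 1
      apply propext
      constructor
      · exact fun h => ⟨hf', by omega⟩
      · exact fun h => by omega
  · have hf' : σ₅.mem 5 0 0 ≠ 0 := by simpa [State.get, j14] using hf
    refine Prog.Run.mono (t := 1) ⟨⟨σ₂.mem 3, σ₄.mem 4, σ₅.mem 4, σ₅.mem 5 0 0, hS, hA.1, hA.2.1,
      hA.2.2.1, hA.2.2.2.1, hA.2.2.2.2, fun i _ k _ => ?_⟩, le_rfl⟩ (fun _ => id) (by omega)
    rw [if_neg (fun h => hf' h.1)]
    simp [skip, Prog.exec, x₅]

end Encoder

end RandomSecret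
namespace RandomSecret

/-! ## The programs compute the code -/

section Correctness

variable {F : Type*} [Field F]

/-- The elimination treats one right-hand side at a time, with a column of W stacked above a column
of X as unknowns. If the flag is set, either some column has no solution, or a kernel vector with
nonzero X-part turns any solution X into a second one; the latter needs at least one column. -/
theorem solved_iff {r d t y : ℕ} {A₀ A : ℕ → ℕ → F} {fl : F} (h : Solved r d (d + t) y A₀ A fl)
    (D : Matrix (Fin r) (Fin d) F) (T : Matrix (Fin r) (Fin t) F) (Y : Matrix (Fin r) (Fin y) F)
    (hD : ∀ (i : Fin r) (j : Fin d), A₀ i j = D i j) (hT : ∀ (i : Fin r) (k : Fin t), A₀ i (d + k) = T i k)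
    (hY : ∀ (i : Fin r) (l : Fin y), A₀ i (d + t + l) = Y i l) :
    (fl = 0 → ∀ X : Matrix (Fin t) (Fin y) F, (∃ W : Matrix (Fin d) (Fin y) F, T * X + D * W = Y) ↔
      X = Matrix.of fun (k : Fin t) (l : Fin y) => ∑ i ∈ Finset.range r, A i (d + k) * A i (d + t + l)) ∧
    (fl ≠ 0 → 0 < y → ¬ ∃! X : Matrix (Fin t) (Fin y) F,
      ∃ W : Matrix (Fin d) (Fin y) F, T * X + D * W = Y) := by
  have hsum : ∀ (v : ℕ → F) (i : Fin r), ∑ k ∈ Finset.range (d + t), A₀ i k * v k =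
      ∑ k : Fin t, T i k * v (d + k) + ∑ k : Fin d, D i k * v k := by
    intro v i
    rw [Finset.range_eq_Ico, ← Finset.sum_Ico_consecutive _ (Nat.zero_le d) (Nat.le_add_right d t),
      add_comm, ← Finset.range_eq_Ico, Finset.sum_range, Finset.sum_Ico_eq_sum_range,
      Nat.add_sub_cancel_left, Finset.sum_range]
    congr 1
    · exact Finset.sum_congr rfl fun k _ => by rw [hT]
    · exact Finset.sum_congr rfl fun k _ => by rw [hD]
  let glue : (Fin d → F) → (Fin t → F) → ℕ → F := fun w x k =>
    if hk : k < d then w ⟨k, hk⟩ else if hk' : k - d < t then x ⟨k - d, hk'⟩ else 0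
  have hg1 : ∀ w x (k : Fin d), glue w x k = w k := fun w x k => by simp [glue]
  have hg2 : ∀ w x (k : Fin t), glue w x (d + k) = x k := fun w x k => by simp [glue]
  have hsol : ∀ (X : Matrix (Fin t) (Fin y) F) (W : Matrix (Fin d) (Fin y) F), T * X + D * W = Y →
      ∀ l : Fin y, Reduced.Solves A₀ r (d + t) l (glue (fun k => W k l) fun k => X k l) := by
    intro X W hXW l i hi
    have := congrFun (congrFun hXW ⟨i, hi⟩) l
    rw [hsum _ ⟨i, hi⟩, hY ⟨i, hi⟩ l, ← this, Matrix.add_apply, Matrix.mul_apply, Matrix.mul_apply]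
    simp only [hg1, hg2]
  constructor
  · intro hf X
    have hS := h.1 hf
    constructor
    · rintro ⟨W, hW⟩
      ext k l
      have := (hS l l.2).2 _ (hsol X W hW l) (d + k) (by omega) (by omega)
      exact (hg2 (fun k => W k l) (fun k => X k l) k).symm.trans this
    · rintro rfl
      choose! w hw using fun l hl => (hS l hl).1
      refine ⟨Matrix.of fun (k : Fin d) (l : Fin y) => w l k, ?_⟩
      ext i l
      have h1 := hw l l.2 i i.2
      rw [hsum, hY] at h1
      rw [← h1, Matrix.add_apply, Matrix.mul_apply, Matrix.mul_apply]
      congr 1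
      refine Finset.sum_congr rfl fun k _ => ?_
      rw [(hS l l.2).2 _ (hw l l.2) (d + k) (by omega) (by omega)]
      rfl
  · rintro hf hy ⟨X, ⟨W, hW⟩, hX⟩
    rcases h.2 hf with ⟨l, hl, hno⟩ | ⟨v, hv, k, hk, hk', hvk⟩
    · exact hno _ (hsol X W hW ⟨l, hl⟩)
    -- The kernel vector is added to every column at once; column 0 then exposes the difference.
    · have := hX (X + Matrix.of fun (k : Fin t) _ => v (d + k))
        ⟨W + Matrix.of fun (k : Fin d) _ => v k, ?_⟩
      · have := congrFun (congrFun this ⟨k - d, by omega⟩) ⟨0, hy⟩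
        rw [Matrix.add_apply, add_eq_left] at this
        refine hvk ?_
        simpa [Nat.add_sub_cancel' hk] using this
      · rw [Matrix.mul_add, Matrix.mul_add, add_add_add_comm, hW, add_eq_left]
        ext i l
        rw [Matrix.add_apply, Matrix.mul_apply, Matrix.mul_apply, Matrix.zero_apply]
        have := hv i i.2
        rwa [hsum] at this

variable {C b m : ℕ}

/-- The hash is affine in L, with the first C rows of P as linear part. Both the encoder program and
the bijection between H and L rest on this. -/
theorem assemble_mul_parityCheck (L : Matrix (Fin b) (Fin C) F) (M : Message F b m) (R : Fin C → F) :
    assemble L M * parityCheck m b R =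
      L * Matrix.of (fun (k j : Fin C) => R j ^ ((k : ℕ) + 1)) + assemble 0 M * parityCheck m b R := by
  ext i j
  change ∑ l, assemble L M i l * R j ^ ((l : ℕ) + 1) = ∑ k : Fin C, L i k * R j ^ ((k : ℕ) + 1) +
    ∑ l, assemble 0 M i l * R j ^ ((l : ℕ) + 1)
  unfold blockLength
  simp only [Fin.sum_univ_add, assemble, Fin.append_left, Fin.append_right, Fin.val_castAdd,
    Fin.val_natAdd, Matrix.zero_apply, zero_mul, Finset.sum_const_zero, zero_add, add_assoc]

theorem decodeCodeword_eq {s : Secret F C b} {Y : Received F C b m} {X : Codeword F C b m}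
    (h : ∀ Z, Explains s Y Z ↔ Z = X) : decodeCodeword s Y = X := by
  have hex : ∃! Z, Explains s Y Z := ⟨X, (h X).2 rfl, fun Z hZ => (h Z).1 hZ⟩
  exact (dif_pos hex).trans ((h _).1 hex.choose_spec.1)

theorem decodeCodeword_eq_zero {s : Secret F C b} {Y : Received F C b m}
    (h : ¬ ∃! X, Explains s Y X) : decodeCodeword s Y = 0 := dif_neg h

theorem tweak_eq {s : Secret F C b} {M : Message F b m} {L : Matrix (Fin b) (Fin C) F}
    (h : ∀ Z, s.2 = assemble Z M * parityCheck m b s.1 ↔ Z = L) : tweak s M = L := by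
  have hex : ∃! Z, s.2 = assemble Z M * parityCheck m b s.1 :=
    ⟨L, (h L).2 rfl, fun Z hZ => (h Z).1 hZ⟩
  exact (dif_pos hex).trans ((h _).1 hex.choose_spec.1)

theorem tweak_eq_zero {s : Secret F C b} {M : Message F b m}
    (h : ¬ ∃! L, s.2 = assemble L M * parityCheck m b s.1) : tweak s M = 0 := dif_neg h

variable [DecidableEq F]

theorem decoderProg_correct (s : Secret F C b) (hC : 1 ≤ C) (Y : Received F C b m) (i : Fin b)
    (j : Fin m) : (decoderProg.exec (initial C b m (store Y) (store fun _ : Fin 1 => s.1)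
      (store s.2))).1.mem 3 i j = decode s Y i j := by
  obtain ⟨A₀, A, fl, hS, hD, hT, hY, hout⟩ := (decoderProg_run (C := C) (b := b) (m := m)
    (Y := store Y) (R := store fun _ : Fin 1 => s.1) (H := store s.2)).1
  rw [hout i i.2 j j.2]
  have hD' : ∀ i j : Fin C, A₀ i j = discrepancy s Y i j := by
    intro i j
    rw [hD i i.2 j j.2, Finset.sum_range, Finset.sum_range]
    change _ = ∑ l, Y i l * s.1 j ^ ((l : ℕ) + 1) - ∑ k, Y i (Fin.natAdd (C + m) k) * s.2 k j
    refine congrArg₂ (· - ·) (Finset.sum_congr rfl fun k _ => ?_) (Finset.sum_congr rfl fun k _ => ?_)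
    · exact congrArg₂ (fun x y => x * y ^ ((k : ℕ) + 1)) (store_apply Y i k)
        (store_apply (fun _ : Fin 1 => s.1) 0 j)
    · exact congrArg₂ (· * ·) (store_apply Y i (Fin.natAdd (C + m) k)) (store_apply s.2 k j)
  have hT' : ∀ (i : Fin C) (k : Fin b), A₀ i (C + k) = transferEstimate Y i k := by
    intro i k
    rw [hT i i.2 k k.2]
    exact store_apply Y i (Fin.natAdd (C + m) k)
  obtain ⟨h1, h2⟩ := solved_iff (y := blockLength C b m) hS (discrepancy s Y) (transferEstimate Y) Y
    hD' hT' fun i l => by rw [hY i i.2 l l.2, store_apply]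
  unfold decode
  by_cases hf : fl = 0
  · rw [if_pos hf, decodeCodeword_eq (h1 hf)]
    rfl
  -- Here `1 ≤ C` guarantees that there is a right-hand side at all.
  · rw [if_neg hf, decodeCodeword_eq_zero (h2 hf (by unfold blockLength; omega))]
    rfl

theorem encoderProg_correct (s : Secret F C b) (M : Message F b m) (i : Fin b)
    (j : Fin (blockLength C b m)) :
    (encoderProg.exec (initial C b m (store M) (store fun _ : Fin 1 => s.1)
      (store s.2))).1.mem 3 i j = encode s M i j := by
  obtain ⟨X, A₀, A, fl, hS, hX1, hX2, hX3, hT, hY, hout⟩ := (encoderProg_run (C := C) (b := b)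
    (m := m) (M := store M) (R := store fun _ : Fin 1 => s.1) (H := store s.2)).1
  rw [hout i i.2 j j.2]
  have hR : ∀ j : Fin C, store (fun _ : Fin 1 => s.1) 0 j = s.1 j := fun j =>
    store_apply (fun _ : Fin 1 => s.1) 0 j
  have hX : ∀ (i : Fin b) (k : Fin (blockLength C b m)), X i k = assemble 0 M i k := by
    intro i k
    refine Fin.addCases (fun k => Fin.addCases (fun k => ?_) (fun k => ?_) k) (fun k => ?_) k
    · simpa [assemble, Matrix.one_apply, Fin.ext_iff] using hX3 i i.2 k k.2
    · simpa [assemble] using hX1 i i.2 k k.2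
    · simpa [assemble, store_apply] using hX2 i i.2 k k.2
  -- Alice wants every unknown, so the auxiliary block is empty and its matrix has no columns.
  have hS' : Solved C 0 (0 + C) b A₀ A fl := by rwa [zero_add]
  obtain ⟨h1, h2⟩ := solved_iff hS' (0 : Matrix (Fin C) (Fin 0) F)
    (Matrix.of fun (j k : Fin C) => s.1 j ^ ((k : ℕ) + 1))
    (s.2 - assemble 0 M * parityCheck m b s.1).transpose (fun _ j => j.elim0)
    (fun j k => by rw [zero_add, hT j j.2 k k.2, hR]; rfl)
    (fun j i => by
      rw [zero_add, hY j j.2 i i.2, store_apply, Finset.sum_range]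
      refine congrArg (s.2 i j - ·) ?_
      exact Finset.sum_congr rfl fun k _ => by rw [hX, hR]; rfl)
  have hiff : ∀ L : Matrix (Fin b) (Fin C) F, s.2 = assemble L M * parityCheck m b s.1 ↔
      ∃ W : Matrix (Fin 0) (Fin b) F, Matrix.of (fun (j k : Fin C) => s.1 j ^ ((k : ℕ) + 1))
        * L.transpose + (0 : Matrix (Fin C) (Fin 0) F) * W =
        (s.2 - assemble 0 M * parityCheck m b s.1).transpose := by
    intro L
    rw [assemble_mul_parityCheck, ← sub_eq_iff_eq_add]
    simp only [Matrix.zero_mul, add_zero, exists_const]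
    rw [← Matrix.transpose_inj, Matrix.transpose_mul, eq_comm]
    rfl
  have henc : ∀ L : Matrix (Fin b) (Fin C) F, assemble L M i j =
      if hj : (j : ℕ) < C then L i ⟨j, hj⟩ else assemble 0 M i j := by
    intro L
    revert j
    intro j
    refine Fin.addCases (fun k => Fin.addCases (fun k => ?_) (fun k => ?_) k) (fun k => ?_) j
    · simp [assemble, add_assoc]
    · simp [assemble]
    · simp [assemble]
  unfold encode
  rw [henc]
  by_cases hf : fl = 0
  · rw [tweak_eq (L := Matrix.of fun (l : Fin b) (k : Fin C) =>
        ∑ i ∈ Finset.range C, A i (0 + k) * A i (0 + C + l)) fun L => ?_]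
    · by_cases hj : (j : ℕ) < C
      · rw [if_pos ⟨hf, hj⟩, dif_pos hj]
        simp only [zero_add, Matrix.of_apply]
      · rw [if_neg fun h => hj h.2, dif_neg hj, hX]
    · rw [hiff, h1 hf, ← Matrix.transpose_inj]
      rfl
  · have hno : ¬ ∃! L, s.2 = assemble L M * parityCheck m b s.1 := by
      rintro ⟨L, hL, hu⟩
      -- The row index i witnesses b > 0, that is, that there is a right-hand side.
      refine h2 hf (by have := i.2; omega) ⟨L.transpose, (hiff L).1 hL, fun Z hZ => ?_⟩
      rw [← Matrix.transpose_transpose Z] at hZ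
      rw [← hu _ ((hiff Z.transpose).2 hZ), Matrix.transpose_transpose]
    rw [tweak_eq_zero hno, if_neg fun h => hf h.1, hX]
    by_cases hj : (j : ℕ) < C
    · rw [dif_pos hj]
      have := hX1 i i.2 j hj
      rwa [hX] at this
    · rw [dif_neg hj]

theorem codeComplexity : CodeComplexity encoderProg decoderProg 400 := by
  intro F _ _ C b m hC hb s
  have hn : C ≤ C + m + b := by omega
  have hm : m ≤ C + m + b := by omega
  generalize hN : C + m + b = n at hn hm
  have e1 : C * n ≤ C ^ 2 * n := by nlinarith [Nat.mul_le_mul_right (C * n) hC]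
  have e2 : n ≤ C * n := by nlinarith
  have e3 : C ≤ n := hn
  have e4 : C ^ 3 ≤ C ^ 2 * n := by rw [pow_succ]; exact Nat.mul_le_mul_left _ hn
  have e5 : C ^ 2 ≤ C ^ 2 * n := Nat.le_mul_of_pos_right _ (by omega)
  have e6 : 400 * n * C ^ 2 = 400 * (C ^ 2 * n) := by ring
  refine ⟨fun M => ⟨encoderProg_correct s M, encoderProg_run.2.trans ?_⟩,
    fun Y => ⟨decoderProg_correct s hC Y, decoderProg_run.2.trans ?_⟩⟩
  · unfold blockLength
    rw [hN, e6]
    -- With b replaced by C and m by n, each monomial is at most a multiple of C²n by the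
    -- inequalities above. The constant 400 covers the sum of the coefficients, also for the
    -- decoder.
    refine le_trans (b := 7 + ((C * (n * (2 + 4) + 2) + 1) + ((C * (C * (4 + 4) + 2) + 1) +
        ((C * (C * ((C * 2 + 5) + 4) + 2) + 1) +
        ((C * (C * ((n * 5 + 2 + 1) + 4) + 2) + 1) +
        ((C * (C * (16 * (C + C) + 8) + 7) + 1 + (C * (C * 4 + 3) + 1)) +
          (C * (C * ((C * 4 + 2) + 4) + 2) + 1 + 1))))))) (by gcongr) ?_
    ring_nf
    ring_nf at e1 e2 e4 e5
    omega
  · unfold blockLength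
    rw [hN, e6]
    refine le_trans (b := 8 + ((C * (C * ((n * 5 + 2 + (C * 4 + 1)) + 4) + 2) + 1) +
        ((C * (C * (3 + 4) + 2) + 1) + ((C * (n * (2 + 4) + 2) + 1) +
        (((C + C) * (C * (16 * (C + C + n) + 8) + 7) + 1 +
          (C * (n * 4 + 3) + 1)) + (C * (n * ((C * 6 + 2) + 4) + 2) + 1 + 1)))))) (by gcongr) ?_
    ring_nf
    ring_nf at e1 e2 e4 e5
    omega

end Correctness

end RandomSecret
namespace RandomSecret

/-! ## Network codes that tell Alice's packets from Calvin's -/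

namespace Network

section Cut

variable {V E : Type*} [DecidableEq V] [Fintype E]

/-- The supremum is attained: the zero flow is admissible, and the value is bounded by the number of
links. -/
theorem exists_isFlow_capacity (N : Network V E) : ∃ f, N.IsFlow f N.capacity := by
  refine Nat.sSup_mem (s := {k | ∃ f, N.IsFlow f k}) ⟨0, fun _ => 0, by simp [IsFlow]⟩
    ⟨Fintype.card E, ?_⟩
  rintro k ⟨f, h1, -, h3⟩
  calc k ≤ ∑ e with N.src e = N.alice, f e := by omega
    _ ≤ ∑ e, f e := Finset.sum_le_sum_of_subset (Finset.filter_subset _ _)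
    _ ≤ ∑ _e : E, 1 := Finset.sum_le_sum fun e _ => h1 e
    _ = Fintype.card E := by simp

/-- Every cut between Alice and Bob has at least as many links as the capacity tells. -/
theorem capacity_le_card_cut (N : Network V E) (W : Finset V) (ha : N.alice ∈ W)
    (hb : N.bob ∉ W) :
    N.capacity ≤ (Finset.univ.filter fun e => N.src e ∈ W ∧ N.tgt e ∉ W).card := by
  obtain ⟨f, h1, h2, h3⟩ := N.exists_isFlow_capacity
  -- Flow conservation at each node of W, with Alice's surplus equal to the capacity. Summed over W,
  -- the links inside cancel and those leaving W must carry at least the capacity.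
  have key : ∀ v ∈ W, ∑ e with N.src e = v, f e =
      ∑ e with N.tgt e = v, f e + if v = N.alice then N.capacity else 0 := by
    intro v hv
    by_cases hva : v = N.alice
    · rw [if_pos hva, hva, h3]
    · rw [if_neg hva, add_zero, h2 v hva (by rintro rfl; exact hb hv)]
  have hfib : ∀ g : E → V, ∑ v ∈ W, ∑ e with g e = v, f e = ∑ e with g e ∈ W, f e := by
    intro g
    rw [← Finset.sum_fiberwise_of_maps_to (s := Finset.univ.filter fun e => g e ∈ W) (t := W) (g := g)
      (fun e he => (Finset.mem_filter.1 he).2)]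
    refine Finset.sum_congr rfl fun v hv => Finset.sum_congr ?_ fun _ _ => rfl
    ext e
    simp only [Finset.mem_filter, Finset.mem_univ, true_and]
    exact ⟨fun h => ⟨h ▸ hv, h⟩, fun h => h.2⟩
  have hsum := Finset.sum_congr rfl key
  rw [Finset.sum_add_distrib, hfib, hfib, Finset.sum_ite_eq' W N.alice, if_pos ha] at hsum
  have hsplit : ∑ e with N.src e ∈ W, f e ≤
      ∑ e with N.tgt e ∈ W, f e + ∑ e with N.src e ∈ W ∧ N.tgt e ∉ W, f e := by
    rw [Finset.sum_filter, Finset.sum_filter, Finset.sum_filter, ← Finset.sum_add_distrib]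
    refine Finset.sum_le_sum fun e _ => ?_
    by_cases hs : N.src e ∈ W <;> by_cases ht : N.tgt e ∈ W <;> simp [hs, ht]
  calc N.capacity ≤ ∑ e with N.src e ∈ W ∧ N.tgt e ∉ W, f e := by omega
    _ ≤ ∑ _e with N.src _e ∈ W ∧ N.tgt _e ∉ W, 1 := Finset.sum_le_sum fun e _ => h1 e
    _ = _ := by simp

end Cut

/-! ### Linearity of the network in Alice's and Calvin's symbols -/

section Linear

variable {V E F : Type*} [DecidableEq V] [Fintype E] [DecidableEq E] [Field F] {C b : ℕ}

theorem symbol_add (N : Network V E) (κ : Coeffs E F C b) (S : Finset E) (w w' : E → F)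
    (x x' : Fin b → F) (e : E) :
    N.symbol κ S (w + w') (x + x') e = N.symbol κ S w x e + N.symbol κ S w' x' e := by
  induction e using N.wellFounded_feeds.induction with
  | _ e ih =>
    rw [symbol_eq, symbol_eq N κ S w, symbol_eq N κ S w']
    split_ifs
    · rfl
    · simp [mul_add, Finset.sum_add_distrib]
    · rw [← Finset.sum_add_distrib]
      exact Finset.sum_congr rfl fun e' _ => by rw [ih e' e'.2, mul_add]

theorem symbol_smul (N : Network V E) (κ : Coeffs E F C b) (S : Finset E) (a : F) (w : E → F)
    (x : Fin b → F) (e : E) :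
    N.symbol κ S (a • w) (a • x) e = a * N.symbol κ S w x e := by
  induction e using N.wellFounded_feeds.induction with
  | _ e ih =>
    rw [symbol_eq, symbol_eq N κ S w]
    split_ifs
    · rfl
    · rw [Finset.mul_sum]
      exact Finset.sum_congr rfl fun i _ => by simp only [Pi.smul_apply, smul_eq_mul]; ring
    · rw [Finset.mul_sum]
      exact Finset.sum_congr rfl fun e' _ => by rw [ih e' e'.2]; ring

theorem symbol_congr (N : Network V E) (κ : Coeffs E F C b) (S : Finset E) {w w' : E → F}
    (h : ∀ e ∈ S, w e = w' e) (x : Fin b → F) (e : E) :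
    N.symbol κ S w x e = N.symbol κ S w' x e := by
  induction e using N.wellFounded_feeds.induction with
  | _ e ih =>
    rw [symbol_eq, symbol_eq N κ S w']
    split_ifs with hS
    · exact h e hS
    · rfl
    · exact Finset.sum_congr rfl fun e' _ => by rw [ih e' e'.2]

/-- What Bob's decoder gets in one time slot, as a function of what Calvin puts on the links in `S`
and of what Alice sends. -/
noncomputable def output (N : Network V E) (κ : Coeffs E F C b) (S : Finset E) :
    (E → F) × (Fin b → F) →ₗ[F] Fin C → F where
  toFun p j := ∑ e with N.tgt e = N.bob, κ.2.2 j e * N.symbol κ S p.1 p.2 e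
  map_add' p p' := by
    funext j
    simp [symbol_add, mul_add, Finset.sum_add_distrib]
  map_smul' a p := by
    funext j
    simp only [Prod.smul_fst, Prod.smul_snd, symbol_smul, Pi.smul_apply, smul_eq_mul,
      RingHom.id_apply, Finset.mul_sum]
    exact Finset.sum_congr rfl fun e _ => by ring

theorem output_apply (N : Network V E) (κ : Coeffs E F C b) (S : Finset E)
    (p : (E → F) × (Fin b → F)) (j : Fin C) :
    N.output κ S p j = ∑ e with N.tgt e = N.bob, κ.2.2 j e * N.symbol κ S p.1 p.2 e := rfl

theorem output_congr (N : Network V E) (κ : Coeffs E F C b) (S : Finset E) {w w' : E → F}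
    (h : ∀ e ∈ S, w e = w' e) (x : Fin b → F) :
    N.output κ S (w, x) = N.output κ S (w', x) := by
  funext j
  simp only [output_apply, N.symbol_congr κ S h]

/-- With the network code `κ`, no packets of Alice but zero look as if they came from `z` links. -/
def Separates (N : Network V E) (κ : Coeffs E F C b) (z : ℕ) : Prop :=
  ∀ S : Finset E, S.card ≤ z → ∀ w x, N.output κ S (w, x) = 0 → x = 0

end Linear

/-! ### Counting by determined coordinates -/

section Counting

/-- Restriction to the coordinates outside the range of φ is injective on B, so each determined
coordinate saves a factor q. -/
theorem card_le_of_determined {α γ ι F : Type*} [Fintype γ] [Fintype ι] [Fintype F]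
    (c : α → ι → F) (φ : γ → ι) (hφ : Function.Injective φ) (B : Finset α)
    (h : ∀ a ∈ B, ∀ a' ∈ B, (∀ i, (∀ g, φ g ≠ i) → c a i = c a' i) → a = a') :
    B.card * Fintype.card F ^ Fintype.card γ ≤ Fintype.card F ^ Fintype.card ι := by
  classical
  let J : Finset ι := (Finset.univ.image φ)ᶜ
  have hJ : Fintype.card J + Fintype.card γ = Fintype.card ι := by
    rw [Fintype.card_coe, Finset.card_compl, Finset.card_image_of_injective _ hφ, Finset.card_univ]
    exact Nat.sub_add_cancel (Fintype.card_le_of_injective φ hφ)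
  have hB : B.card ≤ Fintype.card (J → F) := by
    refine Finset.card_le_card_of_injOn (t := Finset.univ) (fun a (i : J) => c a i) (by simp) ?_
    intro a ha a' ha' haa
    refine h a ha a' ha' fun i hi => ?_
    exact congrFun haa ⟨i, by simpa [J] using hi⟩
  calc B.card * Fintype.card F ^ Fintype.card γ
      ≤ Fintype.card (J → F) * Fintype.card F ^ Fintype.card γ := Nat.mul_le_mul_right _ hB
    _ = _ := by rw [Fintype.card_fun, ← pow_add, hJ]

theorem eq_of_sum_eq {ι M : Type*} [Fintype ι] [AddCommGroup M] {f g : ι → M} {i : ι}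
    (h : ∑ j, f j = ∑ j, g j) (hfg : ∀ j, j ≠ i → f j = g j) : f i = g i := by
  classical
  rw [← Finset.add_sum_erase _ f (Finset.mem_univ i),
    ← Finset.add_sum_erase _ g (Finset.mem_univ i),
    Finset.sum_congr rfl fun j hj => hfg j (Finset.ne_of_mem_erase hj)] at h
  exact add_right_cancel h

end Counting

end Network

end RandomSecret
namespace RandomSecret

namespace Network

/-! ### Few network codes let Calvin cancel a packet -/

section Generic

/-- The coordinates of a network code, a slice of the codeword, and the symbols of Calvin. -/
inductive Coord (E : Type*) (C b : ℕ)
  | source (e : E) (i : Fin b)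
  | inner (e e' : E)
  | sink (j : Fin C) (e : E)
  | packet (i : Fin b)
  | inject (e : E)

/-- The coordinates as a sum type. -/
def coordEquiv (E : Type*) (C b : ℕ) :
    Coord E C b ≃ (E × Fin b) ⊕ (E × E) ⊕ (Fin C × E) ⊕ Fin b ⊕ E where
  toFun
    | .source e i => .inl (e, i)
    | .inner e e' => .inr (.inl (e, e'))
    | .sink j e => .inr (.inr (.inl (j, e)))
    | .packet i => .inr (.inr (.inr (.inl i)))
    | .inject e => .inr (.inr (.inr (.inr e)))
  invFun
    | .inl p => .source p.1 p.2
    | .inr (.inl p) => .inner p.1 p.2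
    | .inr (.inr (.inl p)) => .sink p.1 p.2
    | .inr (.inr (.inr (.inl i))) => .packet i
    | .inr (.inr (.inr (.inr e))) => .inject e
  left_inv c := by cases c <;> rfl
  right_inv c := by rcases c with _ | _ | _ | _ | _ <;> rfl

instance {E : Type*} [Fintype E] {C b : ℕ} : Fintype (Coord E C b) :=
  Fintype.ofEquiv _ (coordEquiv E C b).symm

theorem card_coord (E : Type*) [Fintype E] (C b : ℕ) : Fintype.card (Coord E C b) =
    Fintype.card E * b + Fintype.card E * Fintype.card E + C * Fintype.card E +
      b + Fintype.card E := by
  rw [Fintype.card_congr (coordEquiv E C b)]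
  simp [Fintype.card_sum, Fintype.card_prod, add_assoc]

theorem card_coeffs (E F : Type*) [Fintype E] [DecidableEq E] [Fintype F] (C b : ℕ) :
    Fintype.card (Coeffs E F C b) = Fintype.card F ^
      (Fintype.card E * b + Fintype.card E * Fintype.card E + C * Fintype.card E) := by
  simp only [Fintype.card_prod, Fintype.card_fun, Fintype.card_fin, ← pow_mul, pow_add]
  rw [mul_assoc, mul_comm b, mul_comm C]

/-- The value of a coordinate. -/
def coord {E F : Type*} {C b : ℕ} (a : Coeffs E F C b × (Fin b → F) × (E → F)) : Coord E C b → F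
  | .source e i => a.1.1 e i
  | .inner e e' => a.1.2.1 e e'
  | .sink j e => a.1.2.2 j e
  | .packet i => a.2.1 i
  | .inject e => a.2.2 e

variable {V E F : Type*} [DecidableEq V] [Fintype E] [DecidableEq E] [Field F] {C b : ℕ}

/-- Bob gets nothing but zeros although Alice sends a packet whose `i`-th symbol is one; Calvin
uses the links in `S`, and `A` is the set of links with a nonzero symbol. -/
structure Cancels (N : Network V E) (S : Finset E) (i : Fin b) (A : Finset E)
    (a : Coeffs E F C b × (Fin b → F) × (E → F)) : Prop where
  packet : a.2.1 i = 1
  inject : ∀ e, e ∉ S → a.2.2 e = 0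
  support : ∀ e, N.symbol a.1 S a.2.2 a.2.1 e ≠ 0 ↔ e ∈ A
  output : N.output a.1 S (a.2.2, a.2.1) = 0

/-- A cut link carries zero, and this fixes one coordinate: Calvin's symbol if the link is in S, the
coefficient of x_i = 1 if it starts at Alice, and otherwise the coefficient of an incoming link `p
e` whose symbol is nonzero. The right-hand side of the equation is known, because all symbols can be
computed along the network from the remaining coordinates, with zeros on the cut. -/
theorem Cancels.ext_of_cut {N : Network V E} {S : Finset E} {i : Fin b} {A : Finset E}
    {a a' : Coeffs E F C b × (Fin b → F) × (E → F)} (h : Cancels N S i A a)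
    (h' : Cancels N S i A a') (p : E → E)
    (hp : ∀ e, N.src e ∈ insert N.alice (A.image N.tgt) → N.src e ≠ N.alice →
      p e ∈ A ∧ N.tgt (p e) = N.src e) (cut : E → Prop)
    (hcut : ∀ e, cut e → N.src e ∈ insert N.alice (A.image N.tgt) ∧ e ∉ A)
    (h1 : ∀ e k, (¬ (cut e ∧ e ∉ S ∧ N.src e = N.alice) ∨ k ≠ i) → a.1.1 e k = a'.1.1 e k)
    (h2 : ∀ e e', (¬ (cut e ∧ e ∉ S ∧ N.src e ≠ N.alice) ∨ e' ≠ p e) →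
      a.1.2.1 e e' = a'.1.2.1 e e')
    (h3 : a.1.2.2 = a'.1.2.2)
    (h4 : ∀ k, k ≠ i → a.2.1 k = a'.2.1 k)
    (h5 : ∀ e, e ∈ S → ¬ cut e → a.2.2 e = a'.2.2 e) : a = a' := by
  obtain ⟨⟨k1, k2, k3⟩, x, w⟩ := a
  obtain ⟨⟨k1', k2', k3'⟩, x', w'⟩ := a'
  dsimp only at h1 h2 h3 h4 h5
  have hzero : ∀ e, cut e → N.symbol (k1, k2, k3) S w x e = 0 ∧
      N.symbol (k1', k2', k3') S w' x' e = 0 := fun e he =>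
    ⟨not_not.1 fun hne => (hcut e he).2 ((h.support e).1 hne),
      not_not.1 fun hne => (hcut e he).2 ((h'.support e).1 hne)⟩
  have hx : x = x' := by
    funext k
    by_cases hk : k = i
    · exact hk ▸ h.packet.trans h'.packet.symm
    · exact h4 k hk
  have hw : w = w' := by
    funext e
    by_cases hS : e ∈ S
    · by_cases hc : cut e
      · have := hzero e hc
        rw [symbol_eq, symbol_eq, if_pos hS, if_pos hS] at this
        rw [this.1, this.2]
      · exact h5 e hS hc
    · exact (h.inject e hS).trans (h'.inject e hS).symm
  subst hx hw
  have hsym : ∀ e, N.symbol (k1, k2, k3) S w x e = N.symbol (k1', k2', k3') S w x e := by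
    intro e
    induction e using N.wellFounded_feeds.induction with
    | _ e ih =>
      by_cases hc : cut e
      · rw [(hzero e hc).1, (hzero e hc).2]
      · rw [symbol_eq, symbol_eq N (k1', k2', k3')]
        split_ifs
        · rfl
        · exact Finset.sum_congr rfl fun k _ =>
            congrArg (· * x k) (h1 e k (Or.inl fun h => hc h.1))
        · exact Finset.sum_congr rfl fun e' _ =>
            congrArg₂ (· * ·) (h2 e e' (Or.inl fun h => hc h.1)) (ih e' e'.2)
  have e1 : k1 = k1' := by
    funext e k
    by_cases hk : ¬ (cut e ∧ e ∉ S ∧ N.src e = N.alice) ∨ k ≠ i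
    · exact h1 e k hk
    · push Not at hk
      obtain ⟨⟨hc, hS, hs⟩, rfl⟩ := hk
      have hz := hsym e
      rw [symbol_eq, symbol_eq, if_neg hS, if_neg hS, if_pos hs, if_pos hs] at hz
      have := eq_of_sum_eq (i := k) hz fun j hj => congrArg (· * x j) (h1 e j (Or.inr hj))
      have hxk : x k = 1 := h.packet
      simpa [hxk] using this
  have e2 : k2 = k2' := by
    funext e e'
    by_cases hk : ¬ (cut e ∧ e ∉ S ∧ N.src e ≠ N.alice) ∨ e' ≠ p e
    · exact h2 e e' hk
    · push Not at hk
      obtain ⟨⟨hc, hS, hs⟩, rfl⟩ := hk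
      obtain ⟨hA, ht⟩ := hp e (hcut e hc).1 hs
      have hz := hsym e
      rw [symbol_eq, symbol_eq, if_neg hS, if_neg hS, if_neg hs, if_neg hs] at hz
      have := eq_of_sum_eq (i := ⟨p e, ht⟩) hz fun j hj =>
        congrArg₂ (· * ·) (h2 e j (Or.inr fun h => hj (Subtype.ext h))) (hsym j)
      dsimp only at this
      rw [← hsym] at this
      exact mul_right_cancel₀ ((h.support _).2 hA) this
  subst e1 e2 h3
  rfl

/-- Bob's coefficients do not influence the symbols on the links. Each zero among the C outputs is
therefore a linear equation for his coefficient of e₀, with the nonzero symbol of e₀ as factor. -/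
theorem Cancels.ext_of_sink {N : Network V E} {S : Finset E} {i : Fin b} {A : Finset E}
    {a a' : Coeffs E F C b × (Fin b → F) × (E → F)} (h : Cancels N S i A a)
    (h' : Cancels N S i A a') {e₀ : E} (he : e₀ ∈ A) (ht : N.tgt e₀ = N.bob)
    (h1 : a.1.1 = a'.1.1) (h2 : a.1.2.1 = a'.1.2.1)
    (h3 : ∀ j e, e ≠ e₀ → a.1.2.2 j e = a'.1.2.2 j e)
    (h4 : ∀ k, k ≠ i → a.2.1 k = a'.2.1 k)
    (h5 : ∀ e, e ∈ S → a.2.2 e = a'.2.2 e) : a = a' := by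
  obtain ⟨⟨k1, k2, k3⟩, x, w⟩ := a
  obtain ⟨⟨k1', k2', k3'⟩, x', w'⟩ := a'
  dsimp only at h1 h2 h3 h4 h5
  have hx : x = x' := by
    funext k
    by_cases hk : k = i
    · exact hk ▸ h.packet.trans h'.packet.symm
    · exact h4 k hk
  have hw : w = w' := by
    funext e
    by_cases hS : e ∈ S
    · exact h5 e hS
    · exact (h.inject e hS).trans (h'.inject e hS).symm
  subst hx hw h1 h2
  have hsym : ∀ e, N.symbol (k1, k2, k3) S w x e = N.symbol (k1, k2, k3') S w x e := by
    intro e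
    induction e using N.wellFounded_feeds.induction with
    | _ e ih =>
      rw [symbol_eq, symbol_eq N (k1, k2, k3')]
      split_ifs
      · rfl
      · rfl
      · exact Finset.sum_congr rfl fun e' _ => by rw [ih e' e'.2]
  have e3 : k3 = k3' := by
    funext j e
    by_cases hk : e = e₀
    · subst hk
      have hz := (congrFun h.output j).trans (congrFun h'.output j).symm
      rw [output_apply, output_apply, Finset.sum_filter, Finset.sum_filter] at hz
      have := eq_of_sum_eq (i := e) hz fun e' he' => by
        dsimp only
        rw [h3 j e' he', hsym]
      dsimp only at this
      rw [if_pos ht, if_pos ht, ← hsym] at this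
      exact mul_right_cancel₀ ((h.support e).2 he) this
    · exact h3 j e hk
  subst e3
  rfl

variable [Fintype F]

open Classical in
-- One determined coordinate comes from x_i = 1, |E| - |S| come from Calvin's silence off S, and at
-- least C from the zero output or from the cut. Since |S| ≤ z and b + z ≤ C, they number at least 1
-- + |E| + b.
theorem card_cancels (N : Network V E) {z : ℕ} (hN : N.capacity = C) (hz : b + z ≤ C)
    (S : Finset E) (hS : S.card ≤ z) (i : Fin b) (A : Finset E) :
    (Finset.univ.filter fun a : Coeffs E F C b × (Fin b → F) × (E → F) =>
      Cancels N S i A a).card * Fintype.card F ≤ Fintype.card (Coeffs E F C b) := by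
  have hq : 0 < Fintype.card F := Fintype.card_pos
  -- The slice and Calvin's symbols account for b + |E| free coordinates beyond the network code;
  -- the one determined coordinate in excess yields the factor q.
  suffices h : ∃ (γ : Type _) (_ : Fintype γ) (φ : γ → Coord E C b), Function.Injective φ ∧
      1 + Fintype.card E + b ≤ Fintype.card γ ∧
      ∀ a, Cancels N S i A a → ∀ a' : Coeffs E F C b × (Fin b → F) × (E → F), Cancels N S i A a' →
        (∀ c, (∀ g, φ g ≠ c) → coord a c = coord a' c) → a = a' by
    obtain ⟨γ, _, φ, hφ, hc, hdet⟩ := h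
    have := card_le_of_determined coord φ hφ (Finset.univ.filter fun a : Coeffs E F C b ×
      (Fin b → F) × (E → F) => Cancels N S i A a) fun a ha a' ha' =>
        hdet a (Finset.mem_filter.1 ha).2 a' (Finset.mem_filter.1 ha').2
    rw [card_coord, add_assoc _ b, pow_add _ _ (b + _), ← card_coeffs E F C b] at this
    refine Nat.le_of_mul_le_mul_right (c := Fintype.card F ^ (b + Fintype.card E)) ?_ (pow_pos hq _)
    refine le_trans ?_ this
    rw [mul_assoc, ← pow_succ']
    exact Nat.mul_le_mul_left _ (Nat.pow_le_pow_right hq (by omega))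
  have hSc : Fintype.card {e // e ∉ S} = Fintype.card E - S.card := by
    simp [Fintype.card_subtype_compl]
  have hSE : S.card ≤ Fintype.card E := Finset.card_le_univ S
  by_cases hb : N.bob ∈ insert N.alice (A.image N.tgt)
  · obtain ⟨e₀, he, ht⟩ : ∃ e ∈ A, N.tgt e = N.bob := by
      rcases Finset.mem_insert.1 hb with hb | hb
      · exact absurd hb.symm N.alice_ne_bob
      · exact Finset.mem_image.1 hb
    refine ⟨Unit ⊕ {e // e ∉ S} ⊕ Fin C, inferInstance,
      Sum.elim (fun _ => .packet i) (Sum.elim (fun e => .inject e) fun j => .sink j e₀), ?_, ?_, ?_⟩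
    · rintro (_ | e | j) (_ | e' | j') h <;> simp_all [Subtype.ext_iff]
    · simp only [Fintype.card_sum, Fintype.card_unit, hSc, Fintype.card_fin]
      omega
    · intro a ha a' ha' hc
      refine ha.ext_of_sink ha' he ht (funext₂ fun e k => hc (.source e k) ?_)
        (funext₂ fun e e' => hc (.inner e e') ?_) (fun j e hne => hc (.sink j e) ?_)
        (fun k hk => hc (.packet k) ?_) (fun e heS => hc (.inject e) ?_)
      · rintro (_ | _ | _) h <;> simp at h
      · rintro (_ | _ | _) h <;> simp at h
      · rintro (_ | _ | _) h <;> simp at h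
        exact hne h.2.symm
      · rintro (_ | _ | _) h <;> simp at h
        exact hk h.symm
      · rintro (_ | ⟨e', he'⟩ | _) h <;> simp at h
        exact he' (h ▸ heS)
  · set W := insert N.alice (A.image N.tgt) with hW
    have hcard := N.capacity_le_card_cut W (Finset.mem_insert_self _ _) hb
    rw [hN] at hcard
    have hp : ∀ e, N.src e ∈ W → N.src e ≠ N.alice → ∃ e' ∈ A, N.tgt e' = N.src e := by
      intro e he hne
      exact Finset.mem_image.1 ((Finset.mem_insert.1 he).resolve_left hne)
    choose! p hpA hpt using hp
    let cut : E → Prop := fun e => N.src e ∈ W ∧ N.tgt e ∉ W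
    refine ⟨Unit ⊕ {e // e ∉ S} ⊕ {e // cut e}, inferInstance,
      Sum.elim (fun _ => .packet i) (Sum.elim (fun e => .inject e) fun e =>
        if e.1 ∈ S then .inject e else if N.src e = N.alice then .source e i else .inner e (p e)),
        ?_, ?_, ?_⟩
    · rintro (_ | e | e) (_ | e' | e') h
      · rfl
      · simp at h
      · simp only [Sum.elim_inl, Sum.elim_inr] at h
        split_ifs at h
      · simp at h
      · simpa [Subtype.ext_iff] using h
      · simp only [Sum.elim_inl, Sum.elim_inr] at h
        split_ifs at h with h6
        simp only [Coord.inject.injEq] at h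
        exact absurd (h ▸ h6) e.2
      · simp only [Sum.elim_inl, Sum.elim_inr] at h
        split_ifs at h
      · simp only [Sum.elim_inl, Sum.elim_inr] at h
        split_ifs at h with h6
        simp only [Coord.inject.injEq] at h
        exact absurd (h ▸ h6) e'.2
      · simp only [Sum.elim_inr] at h
        split_ifs at h <;> simp_all [Subtype.ext_iff]
    · have : Fintype.card {e // cut e} =
          (Finset.univ.filter fun e => N.src e ∈ W ∧ N.tgt e ∉ W).card := by
        rw [Fintype.card_subtype]
      simp only [Fintype.card_sum, Fintype.card_unit, hSc]
      omega
    · intro a ha a' ha' hc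
      refine ha.ext_of_cut ha' p (fun e he hne => ⟨hpA e he hne, hpt e he hne⟩) cut
        (fun e he => ⟨he.1, fun hA => he.2 (Finset.mem_insert_of_mem (Finset.mem_image_of_mem _ hA))⟩)
        (fun e k hk => hc (.source e k) ?_) (fun e e' hk => hc (.inner e e') ?_)
        (funext₂ fun j e => hc (.sink j e) ?_)
        (fun k hk => hc (.packet k) ?_) (fun e heS hcut => hc (.inject e) ?_)
      · rintro (_ | _ | ⟨e', he'⟩) h
        · simp at h
        · simp at h
        · simp only [Sum.elim_inr] at h
          split_ifs at h with h6 h7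
          simp only [Coord.source.injEq] at h
          obtain ⟨rfl, rfl⟩ := h
          exact hk.elim (fun h => h ⟨he', h6, h7⟩) fun h => h rfl
      · rintro (_ | _ | ⟨e', he'⟩) h
        · simp at h
        · simp at h
        · simp only [Sum.elim_inr] at h
          split_ifs at h with h6 h7
          simp only [Coord.inner.injEq] at h
          obtain ⟨rfl, rfl⟩ := h
          exact hk.elim (fun h => h ⟨he', h6, h7⟩) fun h => h rfl
      · rintro (_ | _ | ⟨e', he'⟩) h
        · simp at h
        · simp at h
        · simp only [Sum.elim_inr] at h
          split_ifs at h
      · rintro (_ | _ | ⟨e', he'⟩) h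
        · simp only [Sum.elim_inl, Coord.packet.injEq] at h
          exact hk h.symm
        · simp at h
        · simp only [Sum.elim_inr] at h
          split_ifs at h
      · rintro (_ | ⟨e', he'⟩ | ⟨e', he'⟩) h
        · simp at h
        · simp only [Sum.elim_inl, Sum.elim_inr, Coord.inject.injEq] at h
          exact he' (h ▸ heS)
        · simp only [Sum.elim_inr] at h
          split_ifs at h
          simp only [Coord.inject.injEq] at h
          exact hcut (h ▸ he')

open Classical in
/-- All but a small fraction of the network codes separate Alice's packets from Calvin's. -/
theorem card_not_separates (N : Network V E) {z : ℕ} (hN : N.capacity = C) (hz : b + z ≤ C) :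
    (Finset.univ.filter fun κ : Coeffs E F C b => ¬ N.Separates κ z).card * Fintype.card F ≤
      2 ^ Fintype.card E * b * 2 ^ Fintype.card E * Fintype.card (Coeffs E F C b) := by
  -- Union bound over Calvin's links, the normalized index and the support; the size of the support
  -- pattern enters as the second power of two.
  let T : Finset (Finset E × Fin b × Finset E) := Finset.univ.filter fun t => t.1.card ≤ z
  have hT : T.card ≤ 2 ^ Fintype.card E * b * 2 ^ Fintype.card E := by
    refine (Finset.card_le_univ T).trans (le_of_eq ?_)
    simp [Fintype.card_prod, mul_assoc]
  have hsub : (Finset.univ.filter fun κ : Coeffs E F C b => ¬ N.Separates κ z) ⊆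
      T.biUnion fun t => (Finset.univ.filter fun a : Coeffs E F C b × (Fin b → F) × (E → F) =>
        Cancels N t.1 t.2.1 t.2.2 a).image Prod.fst := by
    intro κ hκ
    have hκ' := (Finset.mem_filter.1 hκ).2
    unfold Separates at hκ'
    push Not at hκ'
    obtain ⟨S, hS, w, x, h0, hx⟩ := hκ'
    obtain ⟨i, hi⟩ := Function.ne_iff.1 hx
    -- The witness is scaled to x_i = 1 and cleared off S, where Calvin's values are ignored anyway.
    let w' : E → F := (x i)⁻¹ • fun e => if e ∈ S then w e else 0
    let x' : Fin b → F := (x i)⁻¹ • x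
    refine Finset.mem_biUnion.2 ⟨(S, i, Finset.univ.filter fun e => N.symbol κ S w' x' e ≠ 0),
      by simpa [T] using hS, Finset.mem_image.2 ⟨(κ, x', w'), ?_, rfl⟩⟩
    refine Finset.mem_filter.2 ⟨Finset.mem_univ _, ⟨?_, fun e he => ?_, fun e => by simp, ?_⟩⟩
    · simpa [x'] using inv_mul_cancel₀ hi
    · simp [w', he]
    · dsimp only
      rw [show (w', x') = (x i)⁻¹ • ((fun e => if e ∈ S then w e else 0 : E → F), x) from rfl,
        map_smul, N.output_congr κ S (w' := w) (fun e he => by simp [he]), h0, smul_zero]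
  calc _ ≤ (∑ t ∈ T, ((Finset.univ.filter fun a : Coeffs E F C b × (Fin b → F) × (E → F) =>
        Cancels N t.1 t.2.1 t.2.2 a).image Prod.fst).card) * Fintype.card F :=
        Nat.mul_le_mul_right _ ((Finset.card_le_card hsub).trans Finset.card_biUnion_le)
    _ ≤ ∑ _t ∈ T, Fintype.card (Coeffs E F C b) := by
        rw [Finset.sum_mul]
        refine Finset.sum_le_sum fun t ht => ?_
        exact (Nat.mul_le_mul_right _ Finset.card_image_le).trans
          (N.card_cancels hN hz t.1 (Finset.mem_filter.1 ht).2 t.2.1 t.2.2)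
    _ ≤ _ := by
        rw [Finset.sum_const, smul_eq_mul]
        exact Nat.mul_le_mul_right _ hT

end Generic

end Network

end RandomSecret
namespace RandomSecret

/-! ## When Bob decodes correctly -/

/-- Duality: if a column of A were outside the column space of AB, some linear functional would
vanish on that space but not on the column, contrary to the inclusion of left kernels. -/
theorem exists_mul_eq_of_vecMul {F r n k : Type*} [Field F] [Fintype r] [DecidableEq r] [Fintype n]
    [Fintype k] [DecidableEq k] (A : Matrix r n F) (B : Matrix n k F)
    (h : ∀ v, Matrix.vecMul v (A * B) = 0 → Matrix.vecMul v A = 0) :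
    ∃ W : Matrix k n F, A * B * W = A := by
  have hcol : ∀ t, ∃ w : k → F, (A * B).mulVec w = A.col t := by
    intro t
    by_contra hno
    have hmem : A.col t ∉ LinearMap.range (A * B).mulVecLin := by
      rintro ⟨w, hw⟩
      exact hno ⟨w, hw⟩
    obtain ⟨f, hf, hker⟩ := Submodule.exists_le_ker_of_notMem hmem
    have hdot : ∀ y : r → F, f y = dotProduct (fun j => f (Pi.single j 1)) y := by
      intro y
      conv_lhs => rw [pi_eq_sum_univ' y]
      rw [map_sum]
      exact Finset.sum_congr rfl fun j _ => by rw [map_smul, smul_eq_mul, mul_comm]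
    have h0 : Matrix.vecMul (fun j => f (Pi.single j 1)) (A * B) = 0 := by
      funext i
      have : f ((A * B).col i) = 0 := hker ⟨Pi.single i 1, by
        rw [Matrix.mulVecLin_apply, Matrix.mulVec_single_one]⟩
      rwa [hdot] at this
    refine hf ?_
    rw [hdot]
    exact congrFun (h _ h0) t
  choose w hw using hcol
  refine ⟨Matrix.of fun i t => w t i, ?_⟩
  ext j t
  exact congrFun (hw t) j

namespace Network

variable {V E F : Type*} [DecidableEq V] [Fintype E] [DecidableEq E] [Field F] {C b m z : ℕ}

/-- What Calvin injects, less the combination of his injections in the last `b` time slots that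
Bob subtracts. -/
def injection (X : Codeword F C b m) (a : Attack E F z (blockLength C b m)) (e : E)
    (t : Fin (blockLength C b m)) : F :=
  a.2 e t - ∑ i, X i t * a.2 e (Fin.natAdd (C + m) i)

/-- The columns of T̂ are Bob's outputs in the last b slots, where Alice sends the unit vectors.
Subtracting T̂X therefore removes exactly her contribution, and a combination of Calvin's late
injections with it. -/
theorem output_injection (N : Network V E) (κ : Coeffs E F C b) (L : Matrix (Fin b) (Fin C) F)
    (M : Message F b m) (a : Attack E F z (blockLength C b m)) (j : Fin C)
    (t : Fin (blockLength C b m)) :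
    (N.received κ (assemble L M) a - transferEstimate (N.received κ (assemble L M) a) *
      assemble L M) j t =
    N.output κ a.1.1 (fun e => injection (assemble L M) a e t, 0) j := by
  set X := assemble L M
  have hp : ((fun e => injection X a e t, 0) : (E → F) × (Fin b → F)) =
      (fun e => a.2 e t, fun i => X i t) - ∑ i, X i t •
        ((fun e => a.2 e (Fin.natAdd (C + m) i), fun k => X k (Fin.natAdd (C + m) i)) :
          (E → F) × (Fin b → F)) := by
    refine Prod.ext ?_ ?_
    · funext e
      simp [injection, Prod.fst_sum]
    · funext k
      simp [Prod.snd_sum, X, assemble, Matrix.one_apply]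
  rw [hp, map_sub, map_sum]
  simp only [map_smul, Pi.sub_apply, Finset.sum_apply, Pi.smul_apply, smul_eq_mul]
  rw [Matrix.sub_apply, Matrix.mul_apply]
  refine congrArg₂ (· - ·) rfl (Finset.sum_congr rfl fun i _ => ?_)
  rw [mul_comm]
  rfl

/-- A combination of Bob's rows becomes a combination of at most z injections, with coefficients
that do not depend on the time slot. This is what the parity symbols have to detect. -/
theorem exists_output_eq (N : Network V E) (κ : Coeffs E F C b) (S : Finset E) (v : Fin C → F) :
    ∃ c : E → F, ∀ w, ∑ j, v j * N.output κ S (w, 0) j = ∑ e ∈ S, c e * w e := by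
  let g : (E → F) →ₗ[F] F := (∑ j, v j • LinearMap.proj j) ∘ₗ N.output κ S ∘ₗ LinearMap.inl F _ _
  have hg : ∀ w, g w = ∑ j, v j * N.output κ S (w, 0) j := by
    intro w
    simp [g]
  refine ⟨fun e => g (Pi.single e 1), fun w => ?_⟩
  have hw : g w = g (∑ e ∈ S, w e • Pi.single e 1) := by
    rw [hg, hg, N.output_congr κ S (w' := ∑ e ∈ S, w e • Pi.single e 1)]
    intro e he
    rw [Finset.sum_apply, Finset.sum_eq_single e]
    · simp
    · intro e' _ hne
      simp [hne.symm]
    · exact fun h => absurd he h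
  rw [← hg, hw, map_sum]
  exact Finset.sum_congr rfl fun e _ => by rw [map_smul, smul_eq_mul, mul_comm]

/-- The parity symbols `R` detect every nonzero combination of what Calvin injects. -/
def Detects (X : Codeword F C b m) (a : Attack E F z (blockLength C b m)) (R : Fin C → F) : Prop :=
  ∀ c : E → F, (∀ j, ∑ t, (∑ e ∈ a.1.1, c e * injection X a e t) * R j ^ ((t : ℕ) + 1) = 0) →
    ∀ t, ∑ e ∈ a.1.1, c e * injection X a e t = 0

/-- Detection says that passing from Y - T̂X to (Y - T̂X)P creates no new left kernel vectors, which
makes X an explanation. For another explanation Z, the difference T̂(Z - X) is an output of Calvin's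
injections alone, and separation forces Z = X. -/
theorem decodeCodeword_received (N : Network V E) {κ : Coeffs E F C b} (hκ : N.Separates κ z)
    {s : Secret F C b} {L : Matrix (Fin b) (Fin C) F} {M : Message F b m}
    (hs : s.2 = assemble L M * parityCheck m b s.1) {a : Attack E F z (blockLength C b m)}
    (ha : Detects (assemble L M) a s.1) :
    decodeCodeword s (N.received κ (assemble L M) a) = assemble L M := by
  set X := assemble L M with hX
  set Y := N.received κ X a
  set T := transferEstimate Y
  set P := parityCheck m b s.1
  have hres : ∀ j t, (Y - T * X) j t = N.output κ a.1.1 (fun e => injection X a e t, 0) j :=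
    fun j t => N.output_injection κ L M a j t
  have hD : discrepancy s Y = (Y - T * X) * P := by
    rw [discrepancy, hs, Matrix.sub_mul, Matrix.mul_assoc]
  obtain ⟨W₀, hW₀⟩ := exists_mul_eq_of_vecMul (Y - T * X) P (by
    intro v hv
    obtain ⟨c, hc⟩ := N.exists_output_eq κ a.1.1 v
    have hrow : ∀ t, Matrix.vecMul v (Y - T * X) t = ∑ e ∈ a.1.1, c e * injection X a e t := by
      intro t
      rw [← hc]
      change ∑ j, v j * (Y - T * X) j t = _
      exact Finset.sum_congr rfl fun j _ => congrArg (v j * ·) (hres j t)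
    funext t
    rw [hrow, ha c _ t]
    · rfl
    · intro j
      have := congrFun hv j
      rw [← Matrix.vecMul_vecMul] at this
      refine Eq.trans (Finset.sum_congr rfl fun t _ => ?_) this
      rw [hrow]
      rfl)
  refine decodeCodeword_eq fun Z => ⟨?_, ?_⟩
  · rintro ⟨W, hW⟩
    rw [hD] at hW
    have hdiff : T * (Z - X) = (Y - T * X) * (1 - P * W) := by
      rw [Matrix.mul_sub, Matrix.mul_sub, Matrix.mul_one, ← Matrix.mul_assoc]
      conv_rhs => rw [← hW]
      rw [hW]
      have : T * Z = Y - (Y - T * X) * P * W := eq_sub_of_add_eq hW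
      rw [this]
      abel
    refine sub_eq_zero.1 ?_
    set Q : Matrix _ _ F := 1 - P * W
    ext k t
    let p : Fin (blockLength C b m) → (E → F) × (Fin b → F) :=
      fun t => (fun e => a.2 e t, fun i => X i t)
    let u : Fin (blockLength C b m) → (E → F) × (Fin b → F) :=
      fun t => (fun e => injection X a e t, 0)
    -- The slots p of the last b columns produce T̂, and u produces the residual. So this is column
    -- t of `hdiff`, written as a single vanishing output whose Alice part is column t of Z - X.
    have hz : N.output κ a.1.1 (∑ i, (Z - X) i t • p (Fin.natAdd (C + m) i) -
        ∑ t', Q t' t • u t') = 0 := by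
      rw [map_sub, map_sum, map_sum, sub_eq_zero]
      funext j
      have := congrFun (congrFun hdiff j) t
      rw [Matrix.mul_apply, Matrix.mul_apply] at this
      simp only [map_smul, Finset.sum_apply, Pi.smul_apply, smul_eq_mul]
      refine Eq.trans (Finset.sum_congr rfl fun i _ => ?_) (this.trans
        (Finset.sum_congr rfl fun t' _ => ?_))
      · rw [mul_comm]
        rfl
      · rw [hres, mul_comm]
    have hsnd : (∑ i, (Z - X) i t • p (Fin.natAdd (C + m) i) -
        ∑ t', Q t' t • u t').2 = fun k => (Z - X) k t := by
      funext k
      simp [Prod.snd_sum, p, u, hX, assemble, Matrix.one_apply]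
    exact congrFun (hsnd.symm.trans (hκ a.1.1 a.1.2 _ _ hz)) k
  · rintro rfl
    refine ⟨W₀, ?_⟩
    rw [hD, hW₀]
    exact add_sub_cancel _ _

theorem decode_received (N : Network V E) {κ : Coeffs E F C b} (hκ : N.Separates κ z)
    {s : Secret F C b} {L : Matrix (Fin b) (Fin C) F} {M : Message F b m}
    (hs : s.2 = assemble L M * parityCheck m b s.1) {a : Attack E F z (blockLength C b m)}
    (ha : Detects (assemble L M) a s.1) :
    decode s (N.received κ (assemble L M) a) = M := by
  funext i j
  rw [decode, N.decodeCodeword_received hκ hs ha]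
  simp [assemble]

end Network

/-! ### Regular parity symbols make hash and block equivalent -/

section Parity

variable {F : Type*} [Field F] {C b m : ℕ}

/-- The parity symbols are distinct and nonzero. -/
def Regular (R : Fin C → F) : Prop := Function.Injective R ∧ ∀ j, R j ≠ 0

/-- The first C rows of P form a Vandermonde matrix scaled by the symbols R, invertible for distinct
nonzero symbols. Hence a uniform H makes L uniform for every regular R, and the codeword reveals
nothing about which regular R was used. -/
theorem Regular.exists_bijective {R : Fin C → F} (hR : Regular R) (M : Message F b m) :
    ∃ f : Matrix (Fin b) (Fin C) F ≃ Matrix (Fin b) (Fin C) F,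
      ∀ H, tweak (R, H) M = f H ∧ H = assemble (f H) M * parityCheck m b R := by
  let A : Matrix (Fin C) (Fin C) F := Matrix.of fun k j => R j ^ ((k : ℕ) + 1)
  have hA : A.transpose = Matrix.diagonal R * Matrix.vandermonde R := by
    ext j k
    rw [Matrix.diagonal_mul, Matrix.vandermonde_apply, ← pow_succ']
    rfl
  have hdet : IsUnit A.det := by
    rw [isUnit_iff_ne_zero, ← Matrix.det_transpose, hA, Matrix.det_mul, Matrix.det_diagonal]
    exact mul_ne_zero (Finset.prod_ne_zero_iff.2 fun j _ => hR.2 j)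
      (Matrix.det_vandermonde_ne_zero_iff.2 hR.1)
  let G := assemble (0 : Matrix (Fin b) (Fin C) F) M * parityCheck m b R
  have hiff : ∀ H L : Matrix (Fin b) (Fin C) F, H = assemble L M * parityCheck m b R ↔
      L = (H - G) * A⁻¹ := by
    intro H L
    rw [assemble_mul_parityCheck, ← sub_eq_iff_eq_add]
    change H - G = L * A ↔ _
    constructor
    · intro h
      rw [h, Matrix.mul_nonsing_inv_cancel_right _ _ hdet]
    · rintro rfl
      rw [Matrix.nonsing_inv_mul_cancel_right _ _ hdet]
  refine ⟨⟨fun H => (H - G) * A⁻¹, fun L => L * A + G, fun H => ?_, fun L => ?_⟩, fun H =>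
    ⟨tweak_eq fun Z => hiff H Z, (hiff H _).2 rfl⟩⟩
  · beta_reduce
    rw [Matrix.nonsing_inv_mul_cancel_right _ _ hdet, sub_add_cancel]
  · beta_reduce
    rw [add_sub_cancel_right, Matrix.mul_nonsing_inv_cancel_right _ _ hdet]

end Parity

end RandomSecret
namespace RandomSecret

/-! ## Probabilities -/

section Probability

variable {α β ρ : Type*}

theorem toOuterMeasure_le_one (p : PMF α) (s : Set α) : p.toOuterMeasure s ≤ 1 :=
  (p.toOuterMeasure.mono (Set.subset_univ s)).trans
    (le_of_eq ((p.toOuterMeasure_apply_eq_one_iff Set.univ).2 (Set.subset_univ _)))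

theorem toOuterMeasure_bind_le (p : PMF α) (f : α → PMF β) (s : Set β) {c : ℝ≥0∞}
    (h : ∀ a, (f a).toOuterMeasure s ≤ c) : (p.bind f).toOuterMeasure s ≤ c := by
  rw [PMF.toOuterMeasure_bind_apply]
  calc ∑' a, p a * (f a).toOuterMeasure s ≤ ∑' a, p a * c :=
        ENNReal.tsum_le_tsum fun a => mul_le_mul_right (h a) _
    _ = c := by rw [ENNReal.tsum_mul_right, p.tsum_coe, one_mul]

theorem toOuterMeasure_uniform_bind_le [Fintype α] [Nonempty α] (f : α → PMF β) (s : Set β)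
    {c : ℝ≥0∞} (h : ∑ a, (f a).toOuterMeasure s ≤ c * Fintype.card α) :
    ((PMF.uniformOfFintype α).bind f).toOuterMeasure s ≤ c := by
  rw [PMF.toOuterMeasure_bind_apply, tsum_fintype]
  simp only [PMF.uniformOfFintype_apply]
  rw [← Finset.mul_sum]
  refine (mul_le_mul_right h _).trans (le_of_eq ?_)
  rw [mul_comm, mul_assoc, ENNReal.mul_inv_cancel (by simp) (by simp), mul_one]

/-- Exchanging the sums turns the left side into the expected number of r with P r a, so a bound for
every single a suffices. -/
theorem sum_toOuterMeasure_le [Fintype ρ] (p : PMF α) (P : ρ → α → Prop)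
    [∀ r a, Decidable (P r a)] {c : ℝ≥0∞}
    (h : ∀ a, ((Finset.univ.filter fun r => P r a).card : ℝ≥0∞) ≤ c) :
    ∑ r, p.toOuterMeasure {a | P r a} ≤ c := by
  simp only [PMF.toOuterMeasure_apply]
  rw [← tsum_fintype (L := .unconditional _), ENNReal.tsum_comm]
  calc ∑' a, ∑' r, Set.indicator {a | P r a} p a ≤ ∑' a, p a * c := by
        refine ENNReal.tsum_le_tsum fun a => ?_
        classical
        rw [tsum_fintype]
        simp only [Set.indicator_apply, Set.mem_ofPred_eq]
        rw [← Finset.sum_filter, Finset.sum_const, nsmul_eq_mul, mul_comm]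
        exact mul_le_mul_right (h a) _
    _ = c := by rw [ENNReal.tsum_mul_right, p.tsum_coe, one_mul]

end Probability

/-! ## Bad secrets are rare -/

section Secrets

variable {F : Type*} [Field F] [Fintype F] {C b m z : ℕ}

open Classical in
theorem card_not_regular : (Finset.univ.filter fun R : Fin C → F => ¬ Regular R).card *
    Fintype.card F ≤ C ^ 2 * Fintype.card F ^ C := by
  -- The C² pairs serve both conditions: off the diagonal two symbols coincide, on the diagonal one
  -- vanishes. Either event determines one symbol from the others.
  let B : Fin C × Fin C → Finset (Fin C → F) := fun p =>
    Finset.univ.filter fun R => if p.1 = p.2 then R p.2 = 0 else R p.1 = R p.2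
  have hB : ∀ p, (B p).card * Fintype.card F ≤ Fintype.card F ^ C := by
    intro p
    have := Network.card_le_of_determined (fun (R : Fin C → F) => R) (fun _ : Unit => p.2)
      (fun _ _ _ => rfl) (B p) ?_
    · simpa using this
    intro R hR R' hR' h
    have hR := (Finset.mem_filter.1 hR).2
    have hR' := (Finset.mem_filter.1 hR').2
    funext j
    by_cases hj : p.2 = j
    · subst hj
      split_ifs at hR hR' with hp
      · rw [hR, hR']
      · rw [← hR, ← hR']
        exact h p.1 fun _ => Ne.symm hp
    · exact h j fun _ => hj
  have hsub : (Finset.univ.filter fun R : Fin C → F => ¬ Regular R) ⊆ Finset.univ.biUnion B := by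
    intro R hR
    have hR := (Finset.mem_filter.1 hR).2
    by_contra hno
    refine hR ⟨fun i j hij => ?_, fun j hj => ?_⟩
    · by_contra hne
      exact hno (Finset.mem_biUnion.2 ⟨(i, j), Finset.mem_univ _, by simp [B, hne, hij]⟩)
    · exact hno (Finset.mem_biUnion.2 ⟨(j, j), Finset.mem_univ _, by simp [B, hj]⟩)
  calc _ ≤ (∑ p, (B p).card) * Fintype.card F :=
        Nat.mul_le_mul_right _ ((Finset.card_le_card hsub).trans Finset.card_biUnion_le)
    _ ≤ ∑ _p : Fin C × Fin C, Fintype.card F ^ C := by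
        rw [Finset.sum_mul]
        exact Finset.sum_le_sum fun p _ => hB p
    _ = _ := by simp [pow_two]

open Classical in
-- Every symbol of R must be a root of one nonzero polynomial of degree at most n.
theorem card_roots_le {n : ℕ} {y : Fin n → F} (hy : y ≠ 0) :
    (Finset.univ.filter fun R : Fin C → F => ∀ j, ∑ t, y t * R j ^ ((t : ℕ) + 1) = 0).card ≤
      n ^ C := by
  let p : Polynomial F := ∑ t : Fin n, Polynomial.monomial ((t : ℕ) + 1) (y t)
  have hcoeff : ∀ t : Fin n, p.coeff ((t : ℕ) + 1) = y t := by
    intro t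
    simp only [p, Polynomial.finsetSum_coeff, Polynomial.coeff_monomial]
    rw [Finset.sum_eq_single t]
    · simp
    · intro t' _ hne
      rw [if_neg fun h => hne (Fin.ext (by omega))]
    · simp
  have hp : p ≠ 0 := by
    intro h0
    refine hy (funext fun t => ?_)
    rw [← hcoeff, h0]
    rfl
  have hdeg : p.natDegree ≤ n :=
    Polynomial.natDegree_sum_le_of_forall_le _ _ fun t _ =>
      (Polynomial.natDegree_monomial_le _).trans (by omega)
  have heval : ∀ r, p.eval r = ∑ t, y t * r ^ ((t : ℕ) + 1) := by
    intro r
    simp [p, Polynomial.eval_finsetSum]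
  have hsub : (Finset.univ.filter fun R : Fin C → F => ∀ j, ∑ t, y t * R j ^ ((t : ℕ) + 1) = 0) ⊆
      Fintype.piFinset fun _ : Fin C => p.roots.toFinset := by
    intro R hR
    have hR := (Finset.mem_filter.1 hR).2
    refine Fintype.mem_piFinset.2 fun j => ?_
    rw [Multiset.mem_toFinset, Polynomial.mem_roots hp, Polynomial.IsRoot, heval]
    exact hR j
  refine (Finset.card_le_card hsub).trans ?_
  rw [Fintype.card_piFinset, Finset.prod_const, Finset.card_univ, Fintype.card_fin]
  exact Nat.pow_le_pow_left ((Multiset.toFinset_card_le _).trans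
    ((Polynomial.card_roots' p).trans hdeg)) C

open Classical in
-- Only the values of c on Calvin's links matter, which leaves at most q^z words to be detected.
-- Each nonzero one is missed by at most n^C vectors R, and z + 1 ≤ C gains the factor q.
theorem card_not_detects {E : Type*} [Fintype E] [DecidableEq E] (hz : z < C)
    (X : Codeword F C b m) (a : Attack E F z (blockLength C b m)) :
    (Finset.univ.filter fun R : Fin C → F => ¬ Network.Detects X a R).card * Fintype.card F ≤
      blockLength C b m ^ C * Fintype.card F ^ C := by
  let y : (a.1.1 → F) → Fin (blockLength C b m) → F :=
    fun c t => ∑ e : a.1.1, c e * Network.injection X a e t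
  have hsub : (Finset.univ.filter fun R : Fin C → F => ¬ Network.Detects X a R) ⊆
      (Finset.univ.filter fun c => y c ≠ 0).biUnion fun c =>
        Finset.univ.filter fun R : Fin C → F => ∀ j, ∑ t, y c t * R j ^ ((t : ℕ) + 1) = 0 := by
    intro R hR
    have hR := (Finset.mem_filter.1 hR).2
    unfold Network.Detects at hR
    push Not at hR
    obtain ⟨c, hc, t, ht⟩ := hR
    have hy : ∀ t, y (fun e => c e) t = ∑ e ∈ a.1.1, c e * Network.injection X a e t := fun t =>
      Finset.sum_coe_sort a.1.1 fun e => c e * Network.injection X a e t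
    refine Finset.mem_biUnion.2 ⟨fun e => c e, Finset.mem_filter.2 ⟨Finset.mem_univ _, ?_⟩,
      Finset.mem_filter.2 ⟨Finset.mem_univ _, fun j => ?_⟩⟩
    · intro h0
      exact ht ((hy t).symm.trans (congrFun h0 t))
    · simp only [hy]
      exact hc j
  have hq : 0 < Fintype.card F := Fintype.card_pos
  have h1 : (Finset.univ.filter fun R : Fin C → F => ¬ Network.Detects X a R).card ≤
      Fintype.card F ^ z * blockLength C b m ^ C := by
    calc _ ≤ ∑ c ∈ Finset.univ.filter fun c => y c ≠ 0, blockLength C b m ^ C :=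
          (Finset.card_le_card hsub).trans (Finset.card_biUnion_le.trans
            (Finset.sum_le_sum fun c hc => card_roots_le (Finset.mem_filter.1 hc).2))
      _ ≤ _ := by
          rw [Finset.sum_const, smul_eq_mul]
          refine Nat.mul_le_mul_right _ ((Finset.card_le_univ _).trans ?_)
          rw [Fintype.card_fun, Fintype.card_coe]
          exact Nat.pow_le_pow_right hq a.1.2
  calc _ ≤ Fintype.card F ^ z * blockLength C b m ^ C * Fintype.card F := Nat.mul_le_mul_right _ h1
    _ = blockLength C b m ^ C * Fintype.card F ^ (z + 1) := by ring
    _ ≤ _ := Nat.mul_le_mul_left _ (Nat.pow_le_pow_right hq hz)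

end Secrets

/-! ## The error probability -/

namespace Network

variable {V E F : Type*} [DecidableEq V] [Fintype E] [DecidableEq E] [Field F] [Fintype F]
  {C b m z : ℕ}

/-- The probability that Bob errs, for a given network code and a given message. -/
theorem error_le_of_separates (N : Network V E) {κ : Coeffs E F C b} (hκ : N.Separates κ z)
    (hz : z < C) (A : Calvin E F C b m z) (M : Message F b m) :
    ((PMF.uniformOfFintype (Secret F C b)).bind fun s =>
      (A.attack κ M (encode s M)).map fun a =>
        (M, decode s (N.received κ (encode s M) a))).toOuterMeasure {p | p.2 ≠ p.1} ≤
      ((C ^ 2 + blockLength C b m ^ C : ℕ) : ℝ≥0∞) / Fintype.card F := by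
  classical
  set K := C ^ 2 + blockLength C b m ^ C
  have hq : (Fintype.card F : ℝ≥0∞) ≠ 0 := by simp
  refine toOuterMeasure_uniform_bind_le _ _ ?_
  simp only [PMF.toOuterMeasure_map_apply]
  rw [Fintype.sum_prod_type]
  -- The failure is expressed through R, L and the attack, without H, so that R can later be counted
  -- with L and the attack held fixed.
  let Err : (Fin C → F) → Matrix (Fin b) (Fin C) F → Attack E F z (blockLength C b m) → Prop :=
    fun R L a => ¬ Regular R ∨ ¬ Detects (assemble L M) a R
  have hrow : ∀ R : Fin C → F, ∑ H : Matrix (Fin b) (Fin C) F,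
      (A.attack κ M (encode (R, H) M)).toOuterMeasure
        ((fun a => (M, decode (R, H) (N.received κ (encode (R, H) M) a))) ⁻¹' {p | p.2 ≠ p.1}) ≤
      ∑ L, (A.attack κ M (assemble L M)).toOuterMeasure {a | Err R L a} := by
    intro R
    by_cases hR : Regular R
    · obtain ⟨f, hf⟩ := hR.exists_bijective M
      rw [← Equiv.sum_comp f fun L =>
        (A.attack κ M (assemble L M)).toOuterMeasure {a | Err R L a}]
      refine Finset.sum_le_sum fun H _ => ?_
      rw [encode, (hf H).1]
      refine MeasureTheory.OuterMeasure.mono _ fun a ha => Or.inr fun hdet => ha ?_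
      exact N.decode_received hκ (s := (R, H)) (hf H).2 hdet
    · refine Finset.sum_le_sum fun L _ => (toOuterMeasure_le_one _ _).trans (le_of_eq ?_)
      refine ((PMF.toOuterMeasure_apply_eq_one_iff _ _).2 fun a _ => Or.inl hR).symm
  have hErr : ∀ L a, ((Finset.univ.filter fun R => Err R L a).card : ℝ≥0∞) ≤
      (K : ℝ≥0∞) / Fintype.card F * (Fintype.card F : ℝ≥0∞) ^ C := by
    intro L a
    have h1 : (Finset.univ.filter fun R => Err R L a).card * Fintype.card F ≤
        K * Fintype.card F ^ C := by
      rw [Finset.filter_or]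
      refine (Nat.mul_le_mul_right _ (Finset.card_union_le _ _)).trans ?_
      rw [add_mul, add_mul]
      exact Nat.add_le_add card_not_regular (card_not_detects hz _ a)
    rw [ENNReal.mul_comm_div, ← mul_div_assoc, ENNReal.le_div_iff_mul_le (Or.inl hq) (Or.inl (by simp))]
    exact_mod_cast h1
  calc _ ≤ ∑ R, ∑ L, (A.attack κ M (assemble L M)).toOuterMeasure {a | Err R L a} :=
        Finset.sum_le_sum fun R _ => hrow R
    -- With L outside, the distribution of the attack no longer depends on R; this is where the
    -- secrecy of R enters.
    _ = ∑ L, ∑ R, (A.attack κ M (assemble L M)).toOuterMeasure {a | Err R L a} := Finset.sum_comm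
    _ ≤ ∑ _L : Matrix (Fin b) (Fin C) F,
          (K : ℝ≥0∞) / Fintype.card F * (Fintype.card F : ℝ≥0∞) ^ C :=
        Finset.sum_le_sum fun L _ => sum_toOuterMeasure_le _ (fun R a => Err R L a) (hErr L)
    _ = _ := by
        rw [Finset.sum_const, nsmul_eq_mul, Finset.card_univ, Fintype.card_prod, Fintype.card_fun,
          Fintype.card_fin]
        push_cast
        ring

theorem errorProb_le (N : Network V E) (hN : N.capacity = C) (hz : b + z = C)
    (A : Calvin E F C b m z) :
    N.errorProb A ≤ ((C ^ 2 + blockLength C b m ^ C +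
      2 ^ Fintype.card E * b * 2 ^ Fintype.card E : ℕ) : ℝ≥0∞) / Fintype.card F := by
  classical
  -- For b = 0 the message is empty and no error is possible. Otherwise z < C, as detection
  -- requires.
  rcases Nat.eq_zero_or_pos b with rfl | hb
  · have : N.errorProb A = 0 := by
      have hs : ({p : Message F 0 m × Message F 0 m | p.2 ≠ p.1}) = ∅ := by
        ext p
        simp only [Set.mem_ofPred_eq, Set.mem_empty_iff_false, iff_false, not_not]
        exact Subsingleton.elim _ _
      rw [errorProb, hs]
      exact MeasureTheory.OuterMeasure.empty _
    rw [this]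
    exact zero_le
  have hq : (Fintype.card F : ℝ≥0∞) ≠ 0 := by simp
  set K := C ^ 2 + blockLength C b m ^ C
  set D := 2 ^ Fintype.card E * b * 2 ^ Fintype.card E
  refine toOuterMeasure_uniform_bind_le _ _ ?_
  have hκ : ∀ κ : Coeffs E F C b, ((A.message κ).bind fun M =>
      (PMF.uniformOfFintype (Secret F C b)).bind fun s =>
        (A.attack κ M (encode s M)).map fun a =>
          (M, decode s (N.received κ (encode s M) a))).toOuterMeasure {p | p.2 ≠ p.1} ≤
      (K : ℝ≥0∞) / Fintype.card F + if ¬ N.Separates κ z then 1 else 0 := by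
    intro κ
    by_cases h : N.Separates κ z
    · rw [if_neg (not_not.2 h), add_zero]
      exact toOuterMeasure_bind_le _ _ _ fun M => N.error_le_of_separates h (by omega) A M
    · rw [if_pos h]
      exact (toOuterMeasure_le_one _ _).trans le_add_self
  have hD : ((Finset.univ.filter fun κ : Coeffs E F C b => ¬ N.Separates κ z).card : ℝ≥0∞) ≤
      (D : ℝ≥0∞) / Fintype.card F * Fintype.card (Coeffs E F C b) := by
    rw [ENNReal.mul_comm_div, ← mul_div_assoc, ENNReal.le_div_iff_mul_le (Or.inl hq) (Or.inl (by simp))]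
    exact_mod_cast N.card_not_separates hN hz.le
  calc _ ≤ ∑ κ : Coeffs E F C b,
        ((K : ℝ≥0∞) / Fintype.card F + if ¬ N.Separates κ z then 1 else 0) :=
        Finset.sum_le_sum fun κ _ => hκ κ
    _ = (K : ℝ≥0∞) / Fintype.card F * Fintype.card (Coeffs E F C b) +
        ((Finset.univ.filter fun κ : Coeffs E F C b => ¬ N.Separates κ z).card : ℝ≥0∞) := by
        rw [Finset.sum_add_distrib, Finset.sum_const, nsmul_eq_mul, Finset.card_univ, mul_comm,
          Finset.sum_boole]
    _ ≤ (K : ℝ≥0∞) / Fintype.card F * Fintype.card (Coeffs E F C b) +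
        (D : ℝ≥0∞) / Fintype.card F * Fintype.card (Coeffs E F C b) := add_le_add_right hD _
    _ = _ := by
        rw [← add_mul, ENNReal.div_add_div_same]
        push_cast
        rfl

end Network

/-! ## Size of the secret and rate -/

theorem exists_secret_equiv (F : Type*) {C b : ℕ} (hb : b ≤ C) :
    ∃ k ≤ C ^ 2 + C, Nonempty (Secret F C b ≃ (Fin k → F)) := by
  refine ⟨C + b * C, by nlinarith, ⟨?_⟩⟩
  exact ((Equiv.refl _).prodCongr ((Equiv.curry (Fin b) (Fin C) F).symm.trans
    (Equiv.arrowCongr finProdFinEquiv (Equiv.refl F)))).trans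
    ((Equiv.sumArrowEquivProdArrow _ _ _).symm.trans
      (Equiv.arrowCongr finSumFinEquiv (Equiv.refl F)))

theorem exists_rate_ge (C z : ℕ) (hz : z ≤ C) {α : ℝ} (hα : 0 < α) :
    ∃ m₀ : ℕ, ∀ m ≥ m₀, (C : ℝ) - z - α ≤ rate C (C - z) m := by
  set b := C - z
  have hb : (C : ℝ) - z = b := by rw [Nat.cast_sub hz]
  -- The rate falls short of b by (C + b)b/n, and n ≥ m. The extra 1 in the threshold keeps n
  -- positive also when C = 0.
  obtain ⟨m₀, hm₀⟩ := exists_nat_ge (((C : ℝ) + b) * b / α)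
  refine ⟨m₀ + 1, fun m hm => ?_⟩
  have hm' : ((C : ℝ) + b) * b / α ≤ m :=
    hm₀.trans (Nat.cast_le.2 (by omega))
  have hpos : (0 : ℝ) < (blockLength C b m : ℝ) := by
    rw [Nat.cast_pos]
    unfold blockLength
    omega
  have hmn : (m : ℝ) ≤ (blockLength C b m : ℝ) := by
    rw [Nat.cast_le]
    unfold blockLength
    omega
  rw [hb, rate, one_sub_mul, div_mul_eq_mul_div]
  have : ((C : ℝ) + b) * b / (blockLength C b m : ℝ) ≤ α := by
    rw [div_le_iff₀ hpos]
    rw [div_le_iff₀ hα] at hm'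
    nlinarith
  linarith

end RandomSecret
/-! ## The main theorem -/

namespace RandomSecret

theorem NodeComplexity.mono.{u} {node : Prog} {K L : ℕ} (h : NodeComplexity.{u} node K)
    (hKL : K ≤ L) : NodeComplexity.{u} node L :=
  fun F _ _ k d n U Y => ⟨(h F k d n U Y).1, (h F k d n U Y).2.trans (by gcongr)⟩

end RandomSecret

theorem theorem3 :
    -- the secret consists of at most `C ^ 2 + C` symbols
    (∀ (F : Type*) (C b : ℕ), b ≤ C →
      ∃ k ≤ C ^ 2 + C, Nonempty (RandomSecret.Secret F C b ≃ (Fin k → F))) ∧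
    -- polynomial time, with code complexity `O(n C ^ 2)`
    (∃ (enc dec node : RandomSecret.Prog) (K : ℕ),
      RandomSecret.CodeComplexity enc dec K ∧ RandomSecret.NodeComplexity node K) ∧
    -- the rate `C - z` is achieved on every network, by a scheme that does not depend on it
    (∀ C z : ℕ, z ≤ C → ∀ α : ℝ, 0 < α → ∃ m₀ : ℕ, ∀ m ≥ m₀,
      (C : ℝ) - z - α ≤ RandomSecret.rate C (C - z) m ∧
      ∀ ε : ℝ, 0 < ε → ∀ ℓ : ℕ, ∃ q₀ : ℕ,
        ∀ (F : Type*) [Field F] [Fintype F], q₀ ≤ Fintype.card F →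
        ∀ (V E : Type*) [DecidableEq V] [Fintype E] [DecidableEq E]
          (N : RandomSecret.Network V E), Fintype.card E ≤ ℓ → N.capacity = C →
        ∀ A : RandomSecret.Calvin E F C (C - z) m z, N.errorProb A ≤ ENNReal.ofReal ε) := by
  refine ⟨fun F C b hb => RandomSecret.exists_secret_equiv F hb,
    ⟨RandomSecret.encoderProg, RandomSecret.decoderProg, RandomSecret.nodeProg, 400,
      RandomSecret.codeComplexity, RandomSecret.nodeProg_complexity.mono (by norm_num)⟩,
    fun C z hz α hα => ?_⟩
  obtain ⟨m₀, h⟩ := RandomSecret.exists_rate_ge C z hz hα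
  refine ⟨m₀, fun m hm => ⟨h m hm, fun ε hε ℓ => ?_⟩⟩
  -- With ℓ in place of the number of links, K depends neither on the field nor on the network, so
  -- q₀ ≥ K/ε works uniformly.
  set K : ℕ := C ^ 2 + RandomSecret.blockLength C (C - z) m ^ C + 2 ^ ℓ * (C - z) * 2 ^ ℓ
  obtain ⟨q₀, hq₀⟩ := exists_nat_ge ((K : ℝ) / ε)
  refine ⟨q₀, fun F _ _ hF V E _ _ _ N hE hN A => ?_⟩
  refine (N.errorProb_le hN (Nat.sub_add_cancel hz) A).trans ?_
  have hq : (0 : ℝ) < Fintype.card F := Nat.cast_pos.2 Fintype.card_pos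
  have hK : (K : ℝ) / Fintype.card F ≤ ε := by
    rw [div_le_iff₀ hq, mul_comm, ← div_le_iff₀ hε]
    exact hq₀.trans (Nat.cast_le.2 hF)
  refine le_trans ?_ (ENNReal.ofReal_le_ofReal hK)
  rw [ENNReal.ofReal_div_of_pos hq, ENNReal.ofReal_natCast, ENNReal.ofReal_natCast]
  refine ENNReal.div_le_div_right (Nat.cast_le.2 ?_) _
  have : 2 ^ Fintype.card E ≤ 2 ^ ℓ := Nat.pow_le_pow_right two_pos hE
  exact Nat.add_le_add_left (Nat.mul_le_mul (Nat.mul_le_mul_right _ this) this) _
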